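/- Let $V:\mathbb{C}\to(-\infty,+\infty]$ be lower semicontinuous with $\liminf_{|z|\to\infty}\big(V(z)-(2+\epsilon)\log|z|\big)=+\infty$ for some $\epsilon>0$. For a potential $V$ write $\Sigma_V=\overline{\{V<\infty\}}$, and let $\mu_V$ be its equilibrium measure, i.e. the minimizer of $$I_V(\mu)=\iint\log\frac{1}{|z-w|}\,\mu(dz)\,\mu(dw)+\int V\,d\mu$$ among probability measures $\mu$ carried by $\Sigma_V$. (The energy is understood as the double integral of $\log\frac1{|z-w|}+\frac12V(z)+\frac12V(w)$.) Let $S_V=\operatorname{supp}\mu_V$. Write $U^\nu(z)=\int\log\frac1{|z-w|}\,\nu(dw)$ and $\mathbb{D}=\{|z|<1\}$. Let $\rho,\alpha,t>0$. Assume that $S_V=\rho\overline{\mathbb{D}}$, that $V$ is finite and locally $C^{1,1}$ in $\rho\mathbb{D}$, and that $\frac{1}{4\pi}\Delta V\ge\alpha$ almost everywhere in $\rho\mathbb{D}$. Let $\nu$ be a finite positive measure on $\mathbb{C}$ with $\operatorname{supp}\nu\cap\rho\mathbb{D}=\emptyset$ and $\int\log(1+|w|)\,\nu(dw)<\infty$.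 Let $R\in C(\rho\overline{\mathbb{D}})$ be real-valued and harmonic in $\rho\mathbb{D}$, and assume that the inner normal derivative $$\partial_n^-R(z)=\lim_{\varepsilon\downarrow0}\frac{R(z)-R(z-\varepsilon z/|z|)}{\varepsilon}$$ exists for every $|z|=\rho$ and is bounded, with $\|\partial_n^-R\|_\infty=\sup_{|z|=\rho}|\partial_n^-R(z)|$. Set $$W(z)=\begin{cases}tV(z)+2U^\nu(z)+2R(z),&|z|\le\rho,\\+\infty,&|z|>\rho.\end{cases}$$ Then $$S_W\supset\{z\in\rho\mathbb{D}:\operatorname{dist}(z,\{|w|>\rho\})\ge\kappa\},\qquad \kappa=4\sqrt{\frac{\max\big(\|\nu\|,\;2\rho\|\partial_n^-R\|_\infty+t-1\big)}{\alpha t}}.$$ -/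

import Mathlib

open MeasureTheory Filter Topology
open scoped ENNReal

noncomputable section

namespace LogPotential

/-- The logarithmic kernel `log (1 / |z - w|)`, with values in `(-∞, +∞]`; it is `+∞` on the
diagonal. -/
def logKernel (z w : ℂ) : EReal := -ENNReal.log (edist z w)

/-- The integral of an extended real function as (integral of the positive part) minus (integral of
the negative part). It is only used where at least one of the two is finite. -/
def eintegral {X : Type*} [MeasurableSpace X] (μ : Measure X) (f : X → EReal) : EReal :=
  ((∫⁻ x, (f x).toENNReal ∂μ : ℝ≥0∞) : EReal) - ((∫⁻ x, (-f x).toENNReal ∂μ : ℝ≥0∞) : EReal)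

/-- The logarithmic potential `U^μ(z) = ∫ log (1 / |z - w|) μ(dw)`. -/
def potential (μ : Measure ℂ) (z : ℂ) : EReal := eintegral μ (fun w => logKernel z w)

/-- The weighted logarithmic energy
`I_V(μ) = ∬ log (1 / |z - w|) μ(dz) μ(dw) + ∫ V dμ` of a probability measure `μ`, written as the
double integral of `log (1 / |z - w|) + V(z) / 2 + V(w) / 2`. For a potential `V` that is lower
semicontinuous with values in `(-∞, +∞]` and has the growth `HasLogGrowth`, this integrand is
bounded below, so the energy is defined for every `μ`, also where the two integrals are not
defined separately. -/
def energy (V : ℂ → EReal) (μ : Measure ℂ) : EReal :=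
  eintegral (μ.prod μ) (fun p =>
    logKernel p.1 p.2 + (((1 / 2 : ℝ) : EReal) * V p.1 + ((1 / 2 : ℝ) : EReal) * V p.2))

/-- `Σ_V`, the closure of the set on which `V` is finite. -/
def domainClosure (V : ℂ → EReal) : Set ℂ := closure {z | V z < ⊤}

/-- `liminf_{|z| → ∞} (V(z) - (2 + ε) log |z|) = +∞` for some `ε > 0`. -/
def HasLogGrowth (V : ℂ → EReal) : Prop :=
  ∃ ε : ℝ, 0 < ε ∧
    Tendsto (fun z : ℂ => V z - (((2 + ε) * Real.log ‖z‖ : ℝ) : EReal)) (cocompact ℂ) (𝓝 ⊤)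

/-- `μ` is an equilibrium measure of `V`: a probability measure carried by `Σ_V` which minimizes the
energy `I_V` among all such measures. -/
structure IsEquilibriumMeasure (V : ℂ → EReal) (μ : Measure ℂ) : Prop where
  isProbabilityMeasure : IsProbabilityMeasure μ
  carried : μ (domainClosure V)ᶜ = 0
  energy_le : ∀ μ' : Measure ℂ, IsProbabilityMeasure μ' → μ' (domainClosure V)ᶜ = 0 →
    energy V μ ≤ energy V μ'

/-- `f` is locally `C^{1,1}` on the open set `s`: differentiable with locally Lipschitz
derivative. -/
def IsLocallyC11On (f : ℂ → ℝ) (s : Set ℂ) : Prop :=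
  DifferentiableOn ℝ f s ∧ LocallyLipschitzOn s (fderiv ℝ f)

/-- `d` is the derivative of `f` at the boundary point `z ≠ 0` of a disk centred at the origin, in
the direction of the outer unit normal `z / |z|` and taken from inside the disk:
`d = lim_{ε ↓ 0} (f(z) - f(z - ε z / |z|)) / ε`. -/
def HasInnerNormalDeriv (f : ℂ → ℝ) (z : ℂ) (d : ℝ) : Prop :=
  Tendsto (fun ε : ℝ => (f z - f (z - (ε : ℂ) * (z / (‖z‖ : ℂ)))) / ε) (𝓝[>] 0) (𝓝 d)

/-- The perturbed potential: `t V + 2 U^ν + 2 R` on the closed disk of radius `ρ` about the origin,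
and `+∞` outside it. -/
def perturbedPotential (ρ t : ℝ) (V : ℂ → EReal) (ν : Measure ℂ) (R : ℂ → ℝ) (z : ℂ) : EReal :=
  open Classical in
  if z ∈ Metric.closedBall (0 : ℂ) ρ then
    (t : EReal) * V z + 2 * potential ν z + ((2 * R z : ℝ) : EReal)
  else ⊤

/-- The width `κ = 4 √(max(‖ν‖, 2 ρ ‖∂R‖_∞ + (t - 1)) / (α t))`, where `dR` is the normal derivative
of `R` on the circle of radius `ρ` and `‖∂R‖_∞` its supremum norm there. -/
def kappa (ρ α t : ℝ) (ν : Measure ℂ) (dR : ℂ → ℝ) : ℝ :=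
  4 * Real.sqrt
    (max (ν.real Set.univ) (2 * ρ * (⨆ z : Metric.sphere (0 : ℂ) ρ, |dR z|) + (t - 1)) / (α * t))

end LogPotential

end

/-! Argue by contradiction. Let $d=\rho-|z_0|\ge\kappa$ and suppose $z_0\notin S_W$. The proof
replaces the exterior charge $\nu$ by an equivalent charge inside the disk, which is then subtracted
from $t\mu_V$.

Density. An equilibrium measure satisfies $U^\mu+V/2\ge F$ quasi-everywhere, with equality on the
support up to semicontinuity (`IsVariational`). Since $S_V$ is the whole disk, $U^{\mu_V}=F-V/2$ in
its interior, and the bound on $\Delta V$ becomes $\mu_V\ge\alpha\cdot$area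
(`smul_volume_restrict_ball_le`).

Balayage. `exists_sweep` moves $\nu$, together with an auxiliary uniform charge, onto the annulus
$\rho-d/2<|\zeta|<\rho-d/4$. The result $\beta$ has total mass $m=\alpha t d^2/8$ and density at
most $\alpha t$, so $\tau=t\mu_V-\beta$ is a positive measure. Up to a constant, $U^\beta\le U^\nu$
on the disk, with equality inside the annulus.

Comparison. Inserting $W/2=tV/2+U^\nu+R$ in the equilibrium conditions gives $U^{\mu_W}+R\le
U^\tau+c$ $\mu_W$-almost everywhere, and the reverse inequality at the points of finite potential in
the inner disk. To spread the first inequality beyond the support, $R$ is reflected in the circle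
and a logarithm is added outside; the result $q$ is subharmonic on the plane and grows like
$g\log|z|$, with $g$ slightly above $2\rho\|\partial_n^-R\|_\infty$
(`isKinkedSubharmonic_reflectExtend`). The domination principle (`domination`) applies because
$g+(t-m)<1$; this and $\|\nu\|<m$ are what $d\ge\kappa$ provides.

Conclusion. Near $z_0$ both inequalities hold, so $U^\tau=U^{\mu_W}+R-c$ there. The right side is
harmonic near $z_0$, hence $\tau$ vanishes there. So does $\beta$, and therefore $\mu_V$, against
$z_0\in S_V$ (`mem_support_of_sweep`).

To avoid undefined differences, potentials on the disk use the nonnegative kernel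
$\log^+(2\rho/|z-w|)$ and integrals with values in `ℝ≥0∞`. -/

namespace LogPotential

/-! ### Truncated logarithmic kernels and their potentials -/

/-- The truncated logarithmic kernel `log⁺ (r / |z - w|)`, equal to `∞` on the diagonal. -/
noncomputable def truncKernel (r : ℝ) (z w : ℂ) : ℝ≥0∞ :=
  (ENNReal.log (ENNReal.ofReal r * (edist z w)⁻¹)).toENNReal

theorem continuous_truncKernel (r : ℝ) : Continuous fun p : ℂ × ℂ => truncKernel r p.1 p.2 := by
  unfold truncKernel
  refine EReal.continuous_toENNReal.comp (ENNReal.continuous_log.comp ?_)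
  exact (ENNReal.continuous_const_mul ENNReal.ofReal_ne_top).comp (continuous_edist.inv)

theorem measurable_truncKernel (r : ℝ) : Measurable fun p : ℂ × ℂ => truncKernel r p.1 p.2 :=
  (continuous_truncKernel r).measurable

theorem continuous_truncKernel_right (r : ℝ) (z : ℂ) : Continuous fun w => truncKernel r z w := by
  change Continuous ((fun p : ℂ × ℂ => truncKernel r p.1 p.2) ∘ fun w => (z, w))
  exact (continuous_truncKernel r).comp (continuous_const.prodMk continuous_id)

theorem continuous_truncKernel_left (r : ℝ) (w : ℂ) : Continuous fun z => truncKernel r z w := by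
  change Continuous ((fun p : ℂ × ℂ => truncKernel r p.1 p.2) ∘ fun z => (z, w))
  exact (continuous_truncKernel r).comp (continuous_id.prodMk continuous_const)

theorem truncKernel_self {r : ℝ} (hr : 0 < r) (z : ℂ) : truncKernel r z z = ⊤ := by
  simp [truncKernel, ENNReal.mul_top, hr]

theorem truncKernel_comm (r : ℝ) (z w : ℂ) : truncKernel r z w = truncKernel r w z := by
  simp [truncKernel, edist_comm]

theorem truncKernel_of_ne {r : ℝ} (hr : 0 < r) {z w : ℂ} (h : z ≠ w) :
    truncKernel r z w = ENNReal.ofReal (Real.log (r / ‖z - w‖)) := by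
  have h' : 0 < ‖z - w‖ := norm_pos_iff.2 (sub_ne_zero.2 h)
  rw [truncKernel, edist_dist, dist_eq_norm, ← ENNReal.ofReal_inv_of_pos h',
    ← ENNReal.ofReal_mul hr.le, ENNReal.log_ofReal_of_pos (by positivity),
    EReal.real_coe_toENNReal, div_eq_mul_inv]

theorem truncKernel_eq_zero {r : ℝ} (hr : 0 < r) {z w : ℂ} (h : r ≤ ‖z - w‖) :
    truncKernel r z w = 0 := by
  have h' : 0 < ‖z - w‖ := hr.trans_le h
  rw [truncKernel_of_ne hr (sub_ne_zero.1 (norm_pos_iff.1 h')), ENNReal.ofReal_eq_zero]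
  exact Real.log_nonpos (by positivity) ((div_le_one h').2 h)

/-- The first summand is bounded and continuous, and it is also the circle mean of the kernel over
radius `r`. The singular remainder `truncKernel r` is therefore exactly the defect in the mean value
property. -/
theorem truncKernel_add {r M : ℝ} (hr : 0 < r) (hrM : r ≤ M) {z w : ℂ} (h : ‖z - w‖ ≤ M) :
    truncKernel M z w = ENNReal.ofReal (Real.log M - Real.log (max ‖z - w‖ r)) +
      truncKernel r z w := by
  rcases eq_or_ne z w with rfl | hne
  · simp [truncKernel_self hr, truncKernel_self (hr.trans_le hrM)]
  have h' : 0 < ‖z - w‖ := norm_pos_iff.2 (sub_ne_zero.2 hne)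
  have hM := hr.trans_le hrM
  rcases le_total r ‖z - w‖ with h2 | h2
  · rw [truncKernel_eq_zero hr h2, max_eq_left h2, add_zero, truncKernel_of_ne hM hne,
      Real.log_div hM.ne' h'.ne']
  · rw [max_eq_right h2, truncKernel_of_ne hM hne, truncKernel_of_ne hr hne, ← ENNReal.ofReal_add,
      Real.log_div hM.ne' h'.ne', Real.log_div hr.ne' h'.ne']
    · ring_nf
    · exact sub_nonneg.2 (Real.log_le_log hr hrM)
    · exact Real.log_nonneg ((one_le_div h').2 h2)

theorem truncKernel_mono {r s : ℝ} (hr : 0 < r) (h : r ≤ s) (z w : ℂ) :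
    truncKernel r z w ≤ truncKernel s z w := by
  rcases eq_or_ne z w with rfl | hne
  · simp [truncKernel_self hr, truncKernel_self (hr.trans_le h)]
  have h' : 0 < ‖z - w‖ := norm_pos_iff.2 (sub_ne_zero.2 hne)
  rw [truncKernel_of_ne hr hne, truncKernel_of_ne (hr.trans_le h) hne]
  gcongr

/-- The potential of `μ` with respect to the truncated logarithmic kernel. -/
noncomputable def truncPotential (r : ℝ) (μ : Measure ℂ) (z : ℂ) : ℝ≥0∞ :=
  ∫⁻ w, truncKernel r z w ∂μ

theorem measurable_truncPotential (r : ℝ) (μ : Measure ℂ) [SFinite μ] :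
    Measurable (truncPotential r μ) :=
  (measurable_truncKernel r).lintegral_prod_right'

theorem truncPotential_mono {r s : ℝ} (hr : 0 < r) (h : r ≤ s) (μ : Measure ℂ) (z : ℂ) :
    truncPotential r μ z ≤ truncPotential s μ z :=
  lintegral_mono fun w => truncKernel_mono hr h z w

theorem truncPotential_mono_measure (r : ℝ) {μ ν : Measure ℂ} (h : μ ≤ ν) (z : ℂ) :
    truncPotential r μ z ≤ truncPotential r ν z :=
  lintegral_mono' h le_rfl

theorem lowerSemicontinuous_truncPotential (r : ℝ) (μ : Measure ℂ) :
    LowerSemicontinuous (truncPotential r μ) := by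
  rw [lowerSemicontinuous_iff_le_liminf]
  intro z
  refine le_trans ?_ (lintegral_liminf_le (μ := μ) (u := 𝓝 z) (f := fun z' w => truncKernel r z' w)
    (fun z' => (continuous_truncKernel_right r z').measurable))
  refine lintegral_mono fun w => ?_
  rw [((continuous_truncKernel_left r w).tendsto z).liminf_eq]

theorem measure_singleton_of_truncPotential {r : ℝ} (hr : 0 < r) {μ : Measure ℂ} {z : ℂ}
    (h : truncPotential r μ z ≠ ⊤) : μ {z} = 0 := by
  by_contra hne
  apply h
  refine top_le_iff.1 ?_
  calc ⊤ = ∫⁻ w in {z}, truncKernel r z w ∂μ := by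
        rw [lintegral_singleton, truncKernel_self hr, ENNReal.top_mul hne]
    _ ≤ _ := setLIntegral_le_lintegral _ _

/-- Off the diagonal the kernel vanishes once its scale is below the distance; finiteness at one
scale excludes an atom at `z` and provides the dominating function. -/
theorem tendsto_truncPotential_zero {μ : Measure ℂ} {z : ℂ} {s : ℝ} (hs : 0 < s)
    (h : truncPotential s μ z ≠ ⊤) :
    Tendsto (fun n : ℕ => truncPotential (s / (n + 1)) μ z) atTop (𝓝 0) := by
  have h0 : (0 : ℝ≥0∞) = ∫⁻ _, 0 ∂μ := by simp
  rw [h0]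
  refine tendsto_lintegral_of_dominated_convergence (truncKernel s z)
    (fun n => (continuous_truncKernel_right _ z).measurable) (fun n => ?_) h ?_
  · refine Eventually.of_forall fun w => truncKernel_mono (by positivity) ?_ z w
    exact div_le_self hs.le (by linarith [n.cast_nonneg (α := ℝ)])
  · have hae : ∀ᵐ w ∂μ, w ≠ z := by
      rw [ae_iff]; simpa using measure_singleton_of_truncPotential hs h
    filter_upwards [hae] with w hw
    refine tendsto_const_nhds.congr' ?_
    have h' : 0 < ‖z - w‖ := norm_pos_iff.2 (sub_ne_zero.2 hw.symm)
    have : Tendsto (fun n : ℕ => s / ((n : ℝ) + 1)) atTop (𝓝 0) :=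
      tendsto_const_nhds.div_atTop (tendsto_atTop_add_const_right _ _ tendsto_natCast_atTop_atTop)
    filter_upwards [this.eventually (gt_mem_nhds h')] with n hn
    exact (truncKernel_eq_zero (by positivity) hn.le).symm

/-! ### Circle averages -/

/-- The uniform probability measure on the circle with centre `z` and radius `r`. -/
noncomputable def circleMeasure (z : ℂ) (r : ℝ) : Measure ℂ :=
  ENNReal.ofReal ((2 * Real.pi)⁻¹) •
    (volume.restrict (Set.Ioc 0 (2 * Real.pi))).map (circleMap z r)

theorem lintegral_circleMeasure (z : ℂ) (r : ℝ) {f : ℂ → ℝ≥0∞} (hf : Measurable f) :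
    ∫⁻ x, f x ∂circleMeasure z r =
      ENNReal.ofReal ((2 * Real.pi)⁻¹) * ∫⁻ θ in Set.Ioc 0 (2 * Real.pi), f (circleMap z r θ) := by
  rw [circleMeasure, lintegral_smul_measure,
    lintegral_map hf (continuous_circleMap z r).measurable, smul_eq_mul]

instance isProbabilityMeasure_circleMeasure (z : ℂ) (r : ℝ) :
    IsProbabilityMeasure (circleMeasure z r) := by
  constructor
  rw [← lintegral_one, lintegral_circleMeasure z r measurable_const]
  simp only [lintegral_const, one_mul, Measure.restrict_apply MeasurableSet.univ, Set.univ_inter,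
    Real.volume_Ioc, sub_zero]
  rw [← ENNReal.ofReal_mul (by positivity), inv_mul_cancel₀ (by positivity), ENNReal.ofReal_one]

theorem circleMeasure_compl_sphere (z : ℂ) {r : ℝ} (hr : 0 ≤ r) :
    circleMeasure z r (Metric.sphere z r)ᶜ = 0 := by
  rw [circleMeasure, Measure.smul_apply, Measure.map_apply (continuous_circleMap z r).measurable
    Metric.isClosed_sphere.measurableSet.compl]
  have : circleMap z r ⁻¹' (Metric.sphere z r)ᶜ = ∅ := by
    ext θ; simp [abs_of_nonneg hr]
  simp [this]

theorem ae_circleMeasure_mem_sphere (z : ℂ) {r : ℝ} (hr : 0 ≤ r) :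
    ∀ᵐ x ∂circleMeasure z r, x ∈ Metric.sphere z r := by
  rw [ae_iff]; exact circleMeasure_compl_sphere z hr

theorem ae_circleMap_ne (z : ℂ) {r : ℝ} (hr : r ≠ 0) (w : ℂ) :
    ∀ᵐ θ : ℝ, circleMap z r θ ≠ w := by
  rw [ae_iff]
  have := ((Set.countable_singleton w).preimage_circleMap z hr).measure_zero volume
  simpa [Set.preimage] using this

theorem circleMeasure_singleton (z : ℂ) {r : ℝ} (hr : r ≠ 0) (w : ℂ) :
    circleMeasure z r {w} = 0 := by
  rw [circleMeasure, Measure.smul_apply, Measure.map_apply (continuous_circleMap z r).measurable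
    (measurableSet_singleton w)]
  have : volume.restrict (Set.Ioc 0 (2 * Real.pi)) (circleMap z r ⁻¹' {w}) = 0 :=
    ((Set.countable_singleton w).preimage_circleMap z hr).measure_zero _
  rw [this, smul_zero]

theorem lintegral_ofReal_circleMeasure {z : ℂ} {r : ℝ} (hr : 0 ≤ r) {f : ℂ → ℝ}
    (hfm : Measurable f) (hf : CircleIntegrable f z r) (h0 : ∀ x ∈ Metric.sphere z r, 0 ≤ f x) :
    ∫⁻ x, ENNReal.ofReal (f x) ∂circleMeasure z r =
      ENNReal.ofReal (Real.circleAverage f z r) := by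
  rw [lintegral_circleMeasure z r hfm.ennreal_ofReal, Real.circleAverage_def, smul_eq_mul,
    ENNReal.ofReal_mul (by positivity), intervalIntegral.integral_of_le (by positivity),
    ofReal_integral_eq_lintegral_ofReal]
  · exact (intervalIntegrable_iff_integrableOn_Ioc_of_le (by positivity)).1 hf
  · exact Eventually.of_forall fun θ => h0 _ (circleMap_mem_sphere z hr θ)

/-- `log⁺ (t / r) + log r = log (max t r)`. -/
theorem log_add_posLog {r t : ℝ} (hr : 0 < r) (ht : 0 ≤ t) :
    Real.log r + (r⁻¹ * t).posLog = Real.log (max t r) := by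
  rcases le_total t r with h | h
  · rw [max_eq_right h, Real.posLog_eq_zero_iff _ |>.2, add_zero]
    rw [abs_of_nonneg (by positivity)]
    exact (inv_mul_le_one₀ hr).2 h
  · have ht' := hr.trans_le h
    rw [max_eq_left h, Real.posLog_eq_log, Real.log_mul (by positivity) (by positivity),
      Real.log_inv]
    · ring
    · rw [abs_of_nonneg (by positivity)]
      exact (le_inv_mul_iff₀ hr).2 (by simpa using h)

theorem circleAverage_log_norm_sub (z w : ℂ) {r : ℝ} (hr : 0 < r) :
    Real.circleAverage (fun x => Real.log ‖x - w‖) z r = Real.log (max ‖z - w‖ r) := by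
  rw [circleAverage_log_norm_sub_const_eq_log_radius_add_posLog hr.ne',
    log_add_posLog hr (norm_nonneg _)]

theorem lintegral_truncKernel_circleMeasure {z w : ℂ} {r M : ℝ} (hr : 0 < r) (hM : 0 < M)
    (h : ∀ x ∈ Metric.sphere z r, ‖x - w‖ ≤ M) :
    ∫⁻ x, truncKernel M x w ∂circleMeasure z r =
      ENNReal.ofReal (Real.log M - Real.log (max ‖z - w‖ r)) := by
  have hae : ∀ᵐ x ∂circleMeasure z r, x ≠ w := by
    rw [ae_iff]; simpa using circleMeasure_singleton z hr.ne' w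
  have hint : CircleIntegrable (fun x => Real.log ‖x - w‖) z r :=
    circleIntegrable_log_norm_sub_const r
  -- The value of the integrand at `x = w` is reset to `0`, since `Real.log 0 = 0` while the kernel
  -- is infinite there; the circle measure has no atoms.
  have hmeas : Measurable fun x : ℂ => Real.log ‖x - w‖ := by fun_prop
  rw [lintegral_congr_ae (g := fun x => ENNReal.ofReal
      (if x = w then 0 else Real.log M - Real.log ‖x - w‖))]
  · rw [lintegral_ofReal_circleMeasure hr.le]
    · congr 1
      have e : Real.log M - Real.log (max ‖z - w‖ r) =
          Real.circleAverage (fun x => Real.log M - Real.log ‖x - w‖) z r := by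
        rw [Real.circleAverage_fun_sub (circleIntegrable_const _ _ _) hint,
          Real.circleAverage_const, circleAverage_log_norm_sub z w hr]
      rw [e]
      simp only [Real.circleAverage_def]
      congr 1
      refine intervalIntegral.integral_congr_ae ?_
      filter_upwards [ae_circleMap_ne z hr.ne' w] with θ hθ _
      simp only [hθ, if_false]
    · exact Measurable.ite (measurableSet_singleton w) measurable_const
        (measurable_const.sub hmeas)
    · have : CircleIntegrable (fun x => Real.log M - Real.log ‖x - w‖) z r :=
        (circleIntegrable_const _ _ _).sub hint
      refine IntervalIntegrable.congr_ae this (ae_restrict_of_ae ?_)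
      filter_upwards [ae_circleMap_ne z hr.ne' w] with θ hθ
      simp [hθ]
    · intro x hx
      split_ifs with hxw
      · rfl
      · exact sub_nonneg.2 (Real.log_le_log (norm_pos_iff.2 (sub_ne_zero.2 hxw)) (h x hx))
  · filter_upwards [hae] with x hx
    rw [truncKernel_of_ne hM hx, if_neg hx,
      Real.log_div hM.ne' (norm_ne_zero_iff.2 (sub_ne_zero.2 hx))]

/-- The circle averages of a logarithmic potential. -/
theorem lintegral_truncPotential_circleMeasure {μ : Measure ℂ} [SFinite μ] {z : ℂ} {r M : ℝ}
    (hr : 0 < r) (hrM : r ≤ M) (h : ∀ᵐ w ∂μ, ‖z - w‖ ≤ M ∧ ∀ x ∈ Metric.sphere z r, ‖x - w‖ ≤ M) :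
    ∫⁻ x, truncPotential M μ x ∂circleMeasure z r + truncPotential r μ z =
      truncPotential M μ z := by
  unfold truncPotential
  -- After Tonelli the claim is pointwise in `w`: the circle mean of the kernel is the regular
  -- summand of `truncKernel_add`.
  rw [lintegral_lintegral_swap (measurable_truncKernel M).aemeasurable,
    ← lintegral_add_right]
  · refine lintegral_congr_ae ?_
    filter_upwards [h] with w hw
    rw [lintegral_truncKernel_circleMeasure hr (hr.trans_le hrM) hw.2, truncKernel_add hr hrM hw.1]
  · exact (continuous_truncKernel_right r z).measurable

/-! ### Energies and the first variation -/

theorem eintegral_of_ae_eq_sub {X : Type*} [MeasurableSpace X] {π : Measure X}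
    {f : X → EReal} {l c : X → ℝ≥0∞} (hl : Measurable l) (hcm : Measurable c)
    (hc : ∫⁻ x, c x ∂π ≠ ⊤) (hf : ∀ᵐ x ∂π, f x = (l x : EReal) - (c x : EReal)) :
    eintegral π f = ((∫⁻ x, l x ∂π : ℝ≥0∞) : EReal) - ((∫⁻ x, c x ∂π : ℝ≥0∞) : EReal) := by
  have h1 : ∫⁻ x, (f x).toENNReal ∂π = ∫⁻ x, (l x - c x) ∂π := by
    refine lintegral_congr_ae ?_
    filter_upwards [hf] with x hx
    rw [hx, EReal.toENNReal_sub (EReal.coe_ennreal_nonneg _)]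
    simp
  have h2 : ∫⁻ x, (-f x).toENNReal ∂π = ∫⁻ x, (c x - l x) ∂π := by
    refine lintegral_congr_ae ?_
    filter_upwards [hf, ae_lt_top hcm hc] with x hx hcx
    rw [hx, EReal.neg_sub (Or.inr (EReal.coe_ennreal_ne_bot _))
      (Or.inr (by simpa using hcx.ne)), add_comm, ← sub_eq_add_neg,
      EReal.toENNReal_sub (EReal.coe_ennreal_nonneg _)]
    simp
  -- Truncated differences are the positive and negative parts of `l - c`, and adding back `c` or
  -- `l` gives `max l c` on both sides. Since the integral of `c` is finite, this identity can be
  -- rearranged even when that of `l` is infinite.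
  have h4 : ∫⁻ x, (l x - c x) ∂π + ∫⁻ x, c x ∂π = ∫⁻ x, l x ∂π + ∫⁻ x, (c x - l x) ∂π := by
    rw [← lintegral_add_right _ hcm, ← lintegral_add_left hl]
    refine lintegral_congr fun x => ?_
    rw [tsub_add_eq_max, add_tsub_eq_max]
  rw [eintegral, h1, h2]
  have hB : ∫⁻ x, (c x - l x) ∂π ≠ ⊤ :=
    ne_top_of_le_ne_top hc (lintegral_mono fun x => tsub_le_self)
  generalize ∫⁻ x, (c x - l x) ∂π = B at *
  generalize ∫⁻ x, (l x - c x) ∂π = A at *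
  generalize ∫⁻ x, l x ∂π = L at *
  generalize ∫⁻ x, c x ∂π = C at *
  lift B to NNReal using hB
  lift C to NNReal using hc
  induction A with
  | top =>
    have : L = ⊤ := by
      by_contra hL
      exact ENNReal.add_ne_top.2 ⟨hL, ENNReal.coe_ne_top⟩ (by rw [← h4]; simp)
    subst this
    simp
  | coe a =>
    have hL : L ≠ ⊤ := by
      rintro rfl
      simp at h4
    lift L to NNReal using hL
    have h5 : a + C = L + B := by exact_mod_cast h4
    have h6 : (a : ℝ) + C = L + B := by exact_mod_cast h5
    simp only [EReal.coe_nnreal_eq_coe_real]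
    rw [← EReal.coe_sub, ← EReal.coe_sub]
    congr 1
    linarith

theorem eintegral_of_ae_eq_coe_sub {X : Type*} [MeasurableSpace X] {π : Measure X}
    [IsProbabilityMeasure π] {f : X → EReal} {l : X → ℝ≥0∞} (hl : Measurable l) {C : ℝ}
    (hC : 0 ≤ C) (hf : ∀ᵐ x ∂π, f x = (l x : EReal) - (C : EReal)) :
    eintegral π f = ((∫⁻ x, l x ∂π : ℝ≥0∞) : EReal) - (C : EReal) := by
  have hC' : ((ENNReal.ofReal C : ℝ≥0∞) : EReal) = (C : EReal) := by
    rw [EReal.coe_ennreal_ofReal, max_eq_left hC]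
  rw [← hC'] at hf ⊢
  rw [eintegral_of_ae_eq_sub (c := fun _ => ENNReal.ofReal C) hl measurable_const (by simp) hf]
  simp

/-- The mutual energy of two measures with respect to a nonnegative kernel. -/
noncomputable def mutualEnergy (l : ℂ × ℂ → ℝ≥0∞) (μ ν : Measure ℂ) : ℝ≥0∞ :=
  ∫⁻ z, ∫⁻ w, l (z, w) ∂ν ∂μ

theorem mutualEnergy_comm {l : ℂ × ℂ → ℝ≥0∞} (hl : Measurable l) (hsymm : ∀ z w, l (z, w) = l (w, z)) (μ ν : Measure ℂ) [SFinite μ]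
    [SFinite ν] : mutualEnergy l μ ν = mutualEnergy l ν μ := by
  unfold mutualEnergy
  rw [lintegral_lintegral_swap (f := fun z w => l (z, w)) hl.aemeasurable]
  simp_rw [hsymm]

theorem mutualEnergy_add_left (l : ℂ × ℂ → ℝ≥0∞) (μ μ' ν : Measure ℂ) :
    mutualEnergy l (μ + μ') ν = mutualEnergy l μ ν + mutualEnergy l μ' ν :=
  lintegral_add_measure _ _ _

theorem mutualEnergy_smul_left (l : ℂ × ℂ → ℝ≥0∞) (c : ℝ≥0∞) (μ ν : Measure ℂ) :
    mutualEnergy l (c • μ) ν = c * mutualEnergy l μ ν := by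
  simp [mutualEnergy, lintegral_smul_measure]

theorem mutualEnergy_mono_measure (l : ℂ × ℂ → ℝ≥0∞) {μ μ' ν ν' : Measure ℂ} (h : μ ≤ μ')
    (h' : ν ≤ ν') : mutualEnergy l μ ν ≤ mutualEnergy l μ' ν' :=
  lintegral_mono' h fun _ => lintegral_mono' h' le_rfl

/-- First variation of the energy at a minimizer. -/
theorem mutualEnergy_self_le_of_minimal {l : ℂ × ℂ → ℝ≥0∞} (hl : Measurable l)
    (hsymm : ∀ z w, l (z, w) = l (w, z)) {D : Set ℂ} {μ : Measure ℂ} [IsProbabilityMeasure μ]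
    (hμD : μ Dᶜ = 0) (hμ : mutualEnergy l μ μ ≠ ⊤)
    (hmin : ∀ μ' : Measure ℂ, IsProbabilityMeasure μ' → μ' Dᶜ = 0 →
      mutualEnergy l μ μ ≤ mutualEnergy l μ' μ')
    (μ' : Measure ℂ) [IsProbabilityMeasure μ'] (hμD' : μ' Dᶜ = 0) (hμ' : mutualEnergy l μ' μ' ≠ ⊤) :
    mutualEnergy l μ μ ≤ mutualEnergy l μ' μ := by
  by_cases hX : mutualEnergy l μ' μ = ⊤
  · rw [hX]; exact le_top
  have hcomm := mutualEnergy_comm hl hsymm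
  -- Minimality is tested on the segment from `μ` to `μ'`, along which the energy is a quadratic
  -- polynomial in `s`.
  have key : ∀ s : ℝ, 0 < s → s < 1 →
      (mutualEnergy l μ μ).toReal ≤ (1 - s) ^ 2 * (mutualEnergy l μ μ).toReal +
        2 * s * (1 - s) * (mutualEnergy l μ' μ).toReal +
        s ^ 2 * (mutualEnergy l μ' μ').toReal := by
    intro s hs hs1
    set a := ENNReal.ofReal (1 - s) with ha
    set b := ENNReal.ofReal s with hb
    have hab : a + b = 1 := by
      rw [ha, hb, ← ENNReal.ofReal_add (by linarith) hs.le]; simp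
    have hp : IsProbabilityMeasure (a • μ + b • μ') := by
      constructor; simp [hab]
    have h := hmin (a • μ + b • μ') hp (by simp [hμD, hμD'])
    have e : mutualEnergy l (a • μ + b • μ') (a • μ + b • μ') =
        a ^ 2 * mutualEnergy l μ μ + 2 * b * a * mutualEnergy l μ' μ +
          b ^ 2 * mutualEnergy l μ' μ' := by
      rw [mutualEnergy_add_left, mutualEnergy_smul_left, mutualEnergy_smul_left, hcomm μ, hcomm μ',
        mutualEnergy_add_left, mutualEnergy_smul_left, mutualEnergy_smul_left,
        mutualEnergy_add_left, mutualEnergy_smul_left, mutualEnergy_smul_left, hcomm μ μ']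
      ring
    rw [e] at h
    have h' := ENNReal.toReal_mono (by finiteness) h
    rw [ENNReal.toReal_add (by finiteness) (by finiteness),
      ENNReal.toReal_add (by finiteness) (by finiteness)] at h'
    simpa [ENNReal.toReal_mul, ha, hb, ENNReal.toReal_ofReal hs.le,
      ENNReal.toReal_ofReal (sub_nonneg.2 hs1.le)] using h'
  rw [← ENNReal.toReal_le_toReal hμ hX]
  generalize (mutualEnergy l μ μ).toReal = j at *
  generalize (mutualEnergy l μ' μ).toReal = x at *
  generalize (mutualEnergy l μ' μ').toReal = j' at *
  by_contra! hlt
  have hK : 0 < |j + j' - 2 * x| + 1 := by positivity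
  -- If `x < j`, the linear term `2 s (x - j)` is negative; for `s < (j - x) / K` the quadratic term
  -- cannot compensate.
  obtain ⟨s, hs0, hs⟩ := exists_between (lt_min (by norm_num : (0 : ℝ) < 1)
    (div_pos (sub_pos.2 hlt) hK))
  have hs1 := hs.trans_le (min_le_left _ _)
  have hs2 := hs.trans_le (min_le_right _ _)
  rw [lt_div_iff₀ hK] at hs2
  have h1 := key s hs0 hs1
  have h2 : s * (j + j' - 2 * x) ≤ s * (|j + j' - 2 * x| + 1) :=
    mul_le_mul_of_nonneg_left (by linarith [le_abs_self (j + j' - 2 * x)]) hs0.le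
  have h3 : 0 ≤ s * (2 * (x - j) + s * (j + j' - 2 * x)) := by nlinarith
  have h4 : 0 ≤ 2 * (x - j) + s * (j + j' - 2 * x) := nonneg_of_mul_nonneg_right h3 hs0
  linarith

/-- A minimizer of the energy has potential at least its energy, up to sets that are null for every
measure of finite energy. -/
theorem ae_le_of_minimal {l : ℂ × ℂ → ℝ≥0∞} (hl : Measurable l)
    (hsymm : ∀ z w, l (z, w) = l (w, z)) {D : Set ℂ} {μ : Measure ℂ} [IsProbabilityMeasure μ]
    (hμD : μ Dᶜ = 0) (hμ : mutualEnergy l μ μ ≠ ⊤)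
    (hmin : ∀ μ' : Measure ℂ, IsProbabilityMeasure μ' → μ' Dᶜ = 0 →
      mutualEnergy l μ μ ≤ mutualEnergy l μ' μ')
    (μ' : Measure ℂ) [IsFiniteMeasure μ'] (hμD' : μ' Dᶜ = 0) (hμ' : mutualEnergy l μ' μ' ≠ ⊤) :
    ∀ᵐ z ∂μ', mutualEnergy l μ μ ≤ ∫⁻ w, l (z, w) ∂μ := by
  set J := mutualEnergy l μ μ
  have hH : Measurable fun z => ∫⁻ w, l (z, w) ∂μ := hl.lintegral_prod_right'
  set A : Set ℂ := {z | ∫⁻ w, l (z, w) ∂μ < J} with hA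
  have hAm : MeasurableSet A := measurableSet_lt hH measurable_const
  have hA0 : μ' A = 0 := by
    by_contra hne
    have hfin : μ' A ≠ ⊤ := measure_ne_top _ _
    -- The part of `μ'` on the set where the potential is below `J` is normalized and used as a
    -- competitor; its finite energy is inherited from `μ'` because the kernel is nonnegative.
    have hp : IsProbabilityMeasure ((μ' A)⁻¹ • μ'.restrict A) := by
      constructor; simp [ENNReal.inv_mul_cancel hne hfin]
    have hcomm := mutualEnergy_comm hl hsymm
    have hr : mutualEnergy l (μ'.restrict A) (μ'.restrict A) ≠ ⊤ :=
      ne_top_of_le_ne_top hμ'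
        (mutualEnergy_mono_measure l Measure.restrict_le_self Measure.restrict_le_self)
    have h1 : J ≤ mutualEnergy l ((μ' A)⁻¹ • μ'.restrict A) μ := by
      refine mutualEnergy_self_le_of_minimal hl hsymm hμD hμ hmin _ ?_ ?_
      · rw [Measure.smul_apply, smul_eq_mul, le_antisymm ((Measure.restrict_apply_le A Dᶜ).trans
          hμD'.le) bot_le, mul_zero]
      · rw [mutualEnergy_smul_left, hcomm, mutualEnergy_smul_left]
        have := ENNReal.inv_ne_top.2 hne
        finiteness
    rw [mutualEnergy_smul_left, mutualEnergy] at h1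
    have h2 : ∫⁻ z in A, ∫⁻ w, l (z, w) ∂μ ∂μ' < ∫⁻ _ in A, J ∂μ' := by
      refine setLIntegral_strict_mono hAm hne measurable_const ?_
        (Eventually.of_forall fun z hz => hz)
      refine ne_top_of_le_ne_top (b := ∫⁻ _ in A, J ∂μ') ?_
        (setLIntegral_mono measurable_const fun z hz => le_of_lt hz)
      simp only [lintegral_const, Measure.restrict_apply MeasurableSet.univ, Set.univ_inter]
      finiteness
    have h3 : (μ' A)⁻¹ * ∫⁻ _ in A, J ∂μ' = J := by
      simp only [lintegral_const, Measure.restrict_apply MeasurableSet.univ, Set.univ_inter]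
      rw [mul_comm J, ← mul_assoc, ENNReal.inv_mul_cancel hne hfin, one_mul]
    have h4 := ENNReal.mul_lt_mul_right (ENNReal.inv_ne_zero.2 hfin) (ENNReal.inv_ne_top.2 hne) h2
    rw [h3] at h4
    exact absurd h1 (not_le.2 h4)
  rw [ae_iff]
  simpa [hA] using hA0

/-- The measure `μ` is its own competitor, and a function that is at least `J` almost everywhere and
has mean `J` is equal to `J` almost everywhere. -/
theorem ae_eq_of_minimal {l : ℂ × ℂ → ℝ≥0∞} (hl : Measurable l)
    (hsymm : ∀ z w, l (z, w) = l (w, z)) {D : Set ℂ} {μ : Measure ℂ} [IsProbabilityMeasure μ]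
    (hμD : μ Dᶜ = 0) (hμ : mutualEnergy l μ μ ≠ ⊤)
    (hmin : ∀ μ' : Measure ℂ, IsProbabilityMeasure μ' → μ' Dᶜ = 0 →
      mutualEnergy l μ μ ≤ mutualEnergy l μ' μ') :
    ∀ᵐ z ∂μ, ∫⁻ w, l (z, w) ∂μ = mutualEnergy l μ μ := by
  have h := ae_le_of_minimal hl hsymm hμD hμ hmin μ hμD hμ
  have := ae_eq_of_ae_le_of_lintegral_le h (by simpa using hμ) hl.lintegral_prod_right'.aemeasurable
    (by simp [mutualEnergy])
  filter_upwards [this] with z hz using hz.symm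

/-! ### Euler–Lagrange conditions on the disk -/

/-- The shifted half of the potential `V`, as an extended nonnegative function. -/
noncomputable def halfPotential (N : ℝ) (V : ℂ → EReal) (z : ℂ) : ℝ≥0∞ :=
  (((1 / 2 : ℝ) : EReal) * V z + ((N / 2 : ℝ) : EReal)).toENNReal

theorem coe_halfPotential {N : ℝ} {V : ℂ → EReal} {z : ℂ} (h : ((-N : ℝ) : EReal) ≤ V z) :
    (halfPotential N V z : EReal) = ((1 / 2 : ℝ) : EReal) * V z + ((N / 2 : ℝ) : EReal) := by
  rw [halfPotential, EReal.coe_toENNReal]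
  generalize V z = x at h
  induction x with
  | bot => simp at h
  | top =>
    rw [EReal.coe_mul_top_of_pos (by norm_num)]
    simp
  | coe x =>
    have h' : -N ≤ x := by exact_mod_cast h
    rw [← EReal.coe_mul, ← EReal.coe_add]
    exact_mod_cast (by linarith : 0 ≤ 1 / 2 * x + N / 2)

theorem measurable_halfPotential (N : ℝ) {V : ℂ → EReal} (hV : Measurable V) :
    Measurable (halfPotential N V) := by
  unfold halfPotential
  exact (EReal.continuous_toENNReal.measurable).comp ((hV.const_mul _).add_const _)

theorem coe_truncKernel {M : ℝ} (hM : 0 < M) {z w : ℂ} (h : ‖z - w‖ ≤ M) :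
    (truncKernel M z w : EReal) = logKernel z w + (Real.log M : EReal) := by
  rcases eq_or_ne z w with rfl | hne
  · simp [truncKernel_self hM, logKernel]
  have h' : 0 < ‖z - w‖ := norm_pos_iff.2 (sub_ne_zero.2 hne)
  rw [truncKernel_of_ne hM hne, logKernel, edist_dist, dist_eq_norm, ENNReal.log_ofReal_of_pos h',
    EReal.coe_ennreal_ofReal, max_eq_left (Real.log_nonneg ((one_le_div h').2 h)),
    Real.log_div hM.ne' h'.ne', ← EReal.coe_neg, ← EReal.coe_add]
  congr 1
  ring

/-- The energy of a measure on a disk, in terms of a nonnegative kernel. -/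
theorem energy_eq {ρ N : ℝ} (hρ : 0 < ρ) (hN : 0 ≤ Real.log (2 * ρ) + N) {V : ℂ → EReal}
    (hV : Measurable V) (hVN : ∀ z ∈ Metric.closedBall (0 : ℂ) ρ, ((-N : ℝ) : EReal) ≤ V z)
    {μ : Measure ℂ} [IsProbabilityMeasure μ] (hμ : μ (Metric.closedBall 0 ρ)ᶜ = 0) :
    energy V μ = (mutualEnergy (fun p => truncKernel (2 * ρ) p.1 p.2 +
      (halfPotential N V p.1 + halfPotential N V p.2)) μ μ : EReal) -
        ((Real.log (2 * ρ) + N : ℝ) : EReal) := by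
  have hm : Measurable (fun p : ℂ × ℂ => truncKernel (2 * ρ) p.1 p.2 +
      (halfPotential N V p.1 + halfPotential N V p.2)) := by
    have := measurable_halfPotential N hV
    exact (measurable_truncKernel _).add
      ((this.comp measurable_fst).add (this.comp measurable_snd))
  unfold energy mutualEnergy
  rw [eintegral_of_ae_eq_coe_sub hm hN, lintegral_prod _ hm.aemeasurable]
  have hae : ∀ᵐ z ∂μ, z ∈ Metric.closedBall (0 : ℂ) ρ := by rw [ae_iff]; exact hμ
  have h1 : ∀ᵐ p ∂μ.prod μ, p.1 ∈ Metric.closedBall (0 : ℂ) ρ :=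
    Measure.quasiMeasurePreserving_fst.ae hae
  have h2 : ∀ᵐ p ∂μ.prod μ, p.2 ∈ Metric.closedBall (0 : ℂ) ρ :=
    Measure.quasiMeasurePreserving_snd.ae hae
  filter_upwards [h1, h2] with p hp1 hp2
  have hd : ‖p.1 - p.2‖ ≤ 2 * ρ := by
    rw [mem_closedBall_zero_iff] at hp1 hp2
    linarith [norm_sub_le p.1 p.2]
  rw [EReal.coe_ennreal_add, EReal.coe_ennreal_add, coe_truncKernel (by positivity) hd,
    coe_halfPotential (hVN _ hp1), coe_halfPotential (hVN _ hp2)]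
  have hb : logKernel p.1 p.2 ≠ ⊥ := by
    simp [logKernel, edist_ne_top]
  have hb1 : ((1 / 2 : ℝ) : EReal) * V p.1 ≠ ⊥ := fun h => by
    have := coe_halfPotential (hVN _ hp1)
    rw [h] at this
    simp at this
  have hb2 : ((1 / 2 : ℝ) : EReal) * V p.2 ≠ ⊥ := fun h => by
    have := coe_halfPotential (hVN _ hp2)
    rw [h] at this
    simp at this
  generalize logKernel p.1 p.2 = a at *
  generalize ((1 / 2 : ℝ) : EReal) * V p.1 = b at *
  generalize ((1 / 2 : ℝ) : EReal) * V p.2 = c at *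
  have e : a + (Real.log (2 * ρ) : EReal) + (b + ((N / 2 : ℝ) : EReal) + (c + ((N / 2 : ℝ) : EReal)))
      = a + (b + c) + ((Real.log (2 * ρ) + N : ℝ) : EReal) := by
    have : ((Real.log (2 * ρ) + N : ℝ) : EReal) =
        (Real.log (2 * ρ) : EReal) + (((N / 2 : ℝ) : EReal) + ((N / 2 : ℝ) : EReal)) := by
      rw [← EReal.coe_add, ← EReal.coe_add, add_halves]
    rw [this]
    abel
  rw [e, EReal.add_sub_cancel_right]

/-- The Euler–Lagrange conditions of an equilibrium measure on a disk. -/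
structure IsVariational (M : ℝ) (D : Set ℂ) (v : ℂ → ℝ≥0∞) (μ : Measure ℂ) (F : ℝ≥0∞) : Prop where
  ne_top : F ≠ ⊤
  lintegral_potential_ne_top : ∫⁻ z, truncPotential M μ z ∂μ ≠ ⊤
  lintegral_ne_top : ∫⁻ z, v z ∂μ ≠ ⊤
  ae_eq : ∀ᵐ z ∂μ, truncPotential M μ z + v z = F
  -- Testing with all measures of finite energy expresses "outside a set of capacity zero" without
  -- capacities.
  ae_le : ∀ μ' : Measure ℂ, IsFiniteMeasure μ' → μ' Dᶜ = 0 →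
    ∫⁻ z, truncPotential M μ' z ∂μ' ≠ ⊤ → ∫⁻ z, v z ∂μ' ≠ ⊤ →
    ∀ᵐ z ∂μ', F ≤ truncPotential M μ z + v z

/-- The external field is absorbed into the symmetric kernel `truncKernel + (v z + v w)`, to which
the first variation applies. The measure `μ₀` only serves to show that the minimal energy is finite.
-/
theorem IsEquilibriumMeasure.exists_isVariational {ρ N : ℝ} (hρ : 0 < ρ)
    (hN : 0 ≤ Real.log (2 * ρ) + N) {V : ℂ → EReal}
    (hV : Measurable V) (hVN : ∀ z ∈ Metric.closedBall (0 : ℂ) ρ, ((-N : ℝ) : EReal) ≤ V z)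
    {μ : Measure ℂ} (h : IsEquilibriumMeasure V μ) (hμD : μ (Metric.closedBall 0 ρ)ᶜ = 0)
    (hD : Metric.closedBall 0 ρ ⊆ domainClosure V)
    {μ₀ : Measure ℂ} [IsProbabilityMeasure μ₀] (hμ₀ : μ₀ (Metric.closedBall 0 ρ)ᶜ = 0)
    (hμ₀e : ∫⁻ z, truncPotential (2 * ρ) μ₀ z ∂μ₀ ≠ ⊤)
    (hμ₀v : ∫⁻ z, halfPotential N V z ∂μ₀ ≠ ⊤) :
    ∃ F, IsVariational (2 * ρ) (Metric.closedBall 0 ρ) (halfPotential N V) μ F := by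
  have hp := h.isProbabilityMeasure
  set v := halfPotential N V with hv
  have hvm : Measurable v := measurable_halfPotential N hV
  set l : ℂ × ℂ → ℝ≥0∞ := fun p => truncKernel (2 * ρ) p.1 p.2 + (v p.1 + v p.2) with hl
  have hlm : Measurable l := (measurable_truncKernel _).add
      ((hvm.comp measurable_fst).add (hvm.comp measurable_snd))
  have hsymm : ∀ z w, l (z, w) = l (w, z) := fun z w => by
    simp only [hl]; rw [truncKernel_comm, add_comm (v z)]
  have hmin : ∀ μ' : Measure ℂ, IsProbabilityMeasure μ' → μ' (Metric.closedBall 0 ρ)ᶜ = 0 →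
      mutualEnergy l μ μ ≤ mutualEnergy l μ' μ' := by
    intro μ' hp' hμ'
    have := h.energy_le μ' hp'
      (measure_mono_null (Set.compl_subset_compl.2 hD) hμ')
    rw [energy_eq hρ hN hV hVN hμD, energy_eq hρ hN hV hVN hμ'] at this
    have h2 := add_le_add_left this ((Real.log (2 * ρ) + N : ℝ) : EReal)
    rw [EReal.sub_add_cancel, EReal.sub_add_cancel] at h2
    exact EReal.coe_ennreal_le_coe_ennreal_iff.1 h2
  have hpot : ∀ (μ' : Measure ℂ) z, ∫⁻ w, l (z, w) ∂μ' =
      truncPotential (2 * ρ) μ' z + (v z * μ' Set.univ + ∫⁻ w, v w ∂μ') := by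
    intro μ' z
    simp only [hl]
    rw [lintegral_add_left (continuous_truncKernel_right _ z).measurable, lintegral_add_left
      measurable_const, lintegral_const]
    rfl
  have henergy : ∀ (μ' : Measure ℂ) [IsFiniteMeasure μ'], mutualEnergy l μ' μ' =
      ∫⁻ z, truncPotential (2 * ρ) μ' z ∂μ' + ((∫⁻ z, v z ∂μ') * μ' Set.univ +
        (∫⁻ z, v z ∂μ') * μ' Set.univ) := by
    intro μ' _
    unfold mutualEnergy
    simp_rw [hpot]
    rw [lintegral_add_left (measurable_truncPotential _ _), lintegral_add_left
      (hvm.mul_const _), lintegral_const, lintegral_mul_const _ hvm]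
  have hfin : ∀ (μ' : Measure ℂ) [IsFiniteMeasure μ'],
      ∫⁻ z, truncPotential (2 * ρ) μ' z ∂μ' ≠ ⊤ → ∫⁻ z, v z ∂μ' ≠ ⊤ →
      mutualEnergy l μ' μ' ≠ ⊤ := by
    intro μ' _ h1 h2
    rw [henergy]
    finiteness
  have hJ : mutualEnergy l μ μ ≠ ⊤ :=
    ne_top_of_le_ne_top (hfin μ₀ hμ₀e hμ₀v) (hmin μ₀ inferInstance hμ₀)
  have hJ' := hJ
  rw [henergy μ] at hJ'
  simp only [measure_univ, mul_one] at hJ'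
  obtain ⟨h1, h2⟩ := ENNReal.add_ne_top.1 hJ'
  have h3 := (ENNReal.add_ne_top.1 h2).1
  set S := ∫⁻ z, v z ∂μ
  have hJS : ∫⁻ z, truncPotential (2 * ρ) μ z ∂μ + S + S = mutualEnergy l μ μ := by
    rw [henergy μ, measure_univ, mul_one, add_assoc]
  -- The potential for the full kernel is `U + v + S`, and the energy is the self-energy of `μ` plus
  -- `2 S`; cancelling the finite `S` leaves this constant.
  refine ⟨∫⁻ z, truncPotential (2 * ρ) μ z ∂μ + S, ?_, h1, h3, ?_, ?_⟩
  · finiteness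
  · filter_upwards [ae_eq_of_minimal hlm hsymm hμD hJ hmin] with z hz
    rw [hpot, measure_univ, mul_one, ← hJS, ← add_assoc] at hz
    exact (ENNReal.add_left_inj h3).1 hz
  · intro μ' _ hμ' h4 h5
    filter_upwards [ae_le_of_minimal hlm hsymm hμD hJ hmin μ' hμ' (hfin μ' h4 h5)] with z hz
    rw [hpot, measure_univ, mul_one, ← hJS, ← add_assoc] at hz
    exact (ENNReal.add_le_add_iff_right h3).1 hz

/-- The equilibrium condition holds at all points of the support where the potential is lower
semicontinuous. -/
theorem IsVariational.le_of_mem_support {M : ℝ} {D : Set ℂ} {v : ℂ → ℝ≥0∞} {μ : Measure ℂ}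
    {F : ℝ≥0∞} (h : IsVariational M D v μ F) (hv : LowerSemicontinuous v) {z : ℂ}
    (hz : z ∈ μ.support) : truncPotential M μ z + v z ≤ F := by
  by_contra! hlt
  -- The set where the sum exceeds `F` is a neighbourhood of `z`, yet it is null by the almost
  -- everywhere equality.
  have hU := ((lowerSemicontinuous_truncPotential M μ).add hv) z F hlt
  have hpos := (Measure.mem_support_iff_forall z).1 hz _ hU
  refine hpos.ne' (measure_mono_null (fun x hx => ?_) (ae_iff.1 h.ae_eq))
  exact (ne_of_lt hx).symm

theorem truncPotential_circleMeasure_le {z x : ℂ} {r M : ℝ} (hr : 0 < r) (hM : 0 < M)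
    (h : ∀ y ∈ Metric.sphere z r, ‖y - x‖ ≤ M) :
    truncPotential M (circleMeasure z r) x ≤ ENNReal.ofReal (Real.log M - Real.log r) := by
  unfold truncPotential
  simp_rw [truncKernel_comm M x]
  rw [lintegral_truncKernel_circleMeasure hr hM h]
  gcongr
  exact le_max_right _ _

/-- This makes circle measures admissible test measures in `IsVariational.ae_le`. -/
theorem lintegral_truncPotential_circleMeasure_ne_top {ρ : ℝ} {z : ℂ} {r : ℝ} (hr : 0 < r)
    (hρ : 0 < ρ) (h : Metric.closedBall z r ⊆ Metric.closedBall 0 ρ) :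
    ∫⁻ x, truncPotential (2 * ρ) (circleMeasure z r) x ∂circleMeasure z r ≠ ⊤ := by
  refine ne_top_of_le_ne_top (b := ENNReal.ofReal (Real.log (2 * ρ) - Real.log r))
    ENNReal.ofReal_ne_top ?_
  calc _ ≤ ∫⁻ _, ENNReal.ofReal (Real.log (2 * ρ) - Real.log r) ∂circleMeasure z r := by
        refine lintegral_mono_ae ?_
        filter_upwards [ae_circleMeasure_mem_sphere z hr.le] with x hx
        refine truncPotential_circleMeasure_le hr (by positivity) fun y hy => ?_
        have h1 := h (Metric.sphere_subset_closedBall hx)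
        have h2 := h (Metric.sphere_subset_closedBall hy)
        rw [mem_closedBall_zero_iff] at h1 h2
        linarith [norm_sub_le y x]
    _ = _ := by simp

theorem lintegral_truncPotential_circleMeasure_of_subset {ρ r : ℝ} {μ : Measure ℂ} [SFinite μ] {z : ℂ}
    (hr : 0 < r) (hμD : μ (Metric.closedBall 0 ρ)ᶜ = 0)
    (hsub : Metric.closedBall z r ⊆ Metric.closedBall 0 ρ) :
    ∫⁻ x, truncPotential (2 * ρ) μ x ∂circleMeasure z r + truncPotential r μ z =
      truncPotential (2 * ρ) μ z := by
  -- Opposite points `z + r` and `z - r` of the small circle both lie in the large disk.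
  have hrρ : r ≤ 2 * ρ := by
    have h5 := hsub (show z + r ∈ Metric.closedBall z r by simp [abs_of_pos hr])
    have h6 := hsub (show z - r ∈ Metric.closedBall z r by simp [abs_of_pos hr])
    rw [mem_closedBall_zero_iff] at h5 h6
    have h7 := norm_sub_le (z + r) (z - r)
    have h8 : ‖(z + r) - (z - r)‖ = 2 * r := by
      rw [show (z + r) - (z - r) = ((2 * r : ℝ) : ℂ) by push_cast; ring, Complex.norm_real,
        Real.norm_of_nonneg (by positivity)]
    linarith
  refine lintegral_truncPotential_circleMeasure hr hrρ ?_
  have hae : ∀ᵐ w ∂μ, w ∈ Metric.closedBall (0 : ℂ) ρ := by rw [ae_iff]; exact hμD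
  filter_upwards [hae] with w hw
  rw [mem_closedBall_zero_iff] at hw
  refine ⟨?_, fun x hx => ?_⟩
  · have := hsub (Metric.mem_closedBall_self hr.le)
    rw [mem_closedBall_zero_iff] at this
    linarith [norm_sub_le z w]
  · have := hsub (Metric.sphere_subset_closedBall hx)
    rw [mem_closedBall_zero_iff] at this
    linarith [norm_sub_le x w]

/-- The lower equilibrium condition holds at all interior points where the potential is
continuous. -/
theorem IsVariational.le_of_continuousAt {ρ : ℝ} (hρ : 0 < ρ) {v : ℂ → ℝ≥0∞} {μ : Measure ℂ}
    [SFinite μ] {F : ℝ≥0∞} (h : IsVariational (2 * ρ) (Metric.closedBall 0 ρ) v μ F)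
    (hμD : μ (Metric.closedBall 0 ρ)ᶜ = 0) {z : ℂ} (hz : z ∈ Metric.ball 0 ρ)
    (hv : ContinuousAt v z) (hvz : v z ≠ ⊤) : F ≤ truncPotential (2 * ρ) μ z + v z := by
  refine ENNReal.le_of_forall_pos_le_add fun ε hε _ => ?_
  have h1 : ∀ᶠ x in 𝓝 z, v x < v z + ε :=
    hv.eventually (gt_mem_nhds (ENNReal.lt_add_right hvz (by simpa using hε.ne')))
  obtain ⟨r, hr, hrsub⟩ := Metric.nhds_basis_closedBall.mem_iff.1
    (h1.and (Metric.isOpen_ball.mem_nhds hz))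
  have hsub : Metric.closedBall z r ⊆ Metric.closedBall 0 ρ := fun x hx =>
    Metric.ball_subset_closedBall (hrsub hx).2
  have hsph := ae_circleMeasure_mem_sphere z hr.le
  have hv2 : ∫⁻ x, v x ∂circleMeasure z r ≤ v z + ε := by
    calc _ ≤ ∫⁻ _, (v z + ε) ∂circleMeasure z r := by
          refine lintegral_mono_ae ?_
          filter_upwards [hsph] with x hx
          exact (hrsub (Metric.sphere_subset_closedBall hx)).1.le
      _ = _ := by simp
  have h2 := h.ae_le (circleMeasure z r) inferInstance
    (measure_mono_null (Set.compl_subset_compl.2 (Metric.sphere_subset_closedBall.trans hsub))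
      (circleMeasure_compl_sphere z hr.le))
    (lintegral_truncPotential_circleMeasure_ne_top hr hρ hsub)
    (ne_top_of_le_ne_top (by finiteness) hv2)
  -- Averaging the quasi-everywhere inequality over a small circle makes it pointwise: the potential
  -- is superharmonic and `v` is almost constant there.
  have key := lintegral_truncPotential_circleMeasure_of_subset (μ := μ) hr hμD hsub
  calc F = ∫⁻ _, F ∂circleMeasure z r := by simp
    _ ≤ ∫⁻ x, (truncPotential (2 * ρ) μ x + v x) ∂circleMeasure z r := lintegral_mono_ae h2
    _ = ∫⁻ x, truncPotential (2 * ρ) μ x ∂circleMeasure z r + ∫⁻ x, v x ∂circleMeasure z r :=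
      lintegral_add_left (measurable_truncPotential _ _) _
    _ ≤ truncPotential (2 * ρ) μ z + (v z + ε) :=
      add_le_add (by rw [← key]; exact le_self_add) hv2
    _ = _ := by rw [add_assoc]

/-! ### A maximum principle and regularized potentials -/

theorem integral_circleMeasure {f : ℂ → ℝ} (hf : Measurable f) (z : ℂ) (r : ℝ) :
    ∫ x, f x ∂circleMeasure z r = Real.circleAverage f z r := by
  rw [circleMeasure, integral_smul_measure, integral_map
    (continuous_circleMap z r).measurable.aemeasurable hf.aestronglyMeasurable,
    Real.circleAverage_def, intervalIntegral.integral_of_le (by positivity),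
    ENNReal.toReal_ofReal (by positivity)]

/-- A continuous function tending to `-∞` at infinity attains its supremum on a set off which every
point satisfies a strict or an averaged form of subharmonicity. -/
theorem le_of_submean {u : ℂ → ℝ} (hu : Continuous u) (htop : Tendsto u (cocompact ℂ) atBot)
    {K : Set ℂ} {c : ℝ} (hK : ∀ z ∈ K, u z ≤ c)
    (h : ∀ p ∉ K, (∃ r > 0, u p ≤ Real.circleAverage u p r) ∨ ∃ p₁ p₂, 2 * u p < u p₁ + u p₂)
    (z : ℂ) : u z ≤ c := by
  by_contra! hz
  obtain ⟨p₀, hp₀⟩ := hu.exists_forall_ge htop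
  set S : Set ℂ := {x | u x = u p₀} with hS
  have hSc : IsClosed S := isClosed_eq hu continuous_const
  have hScomp : IsCompact S := by
    have h1 : ∀ᶠ x in cocompact ℂ, u x < u p₀ := htop.eventually (eventually_lt_atBot _)
    obtain ⟨t, ht, hts⟩ := mem_cocompact.1 h1
    refine ht.of_isClosed_subset hSc fun x hx => ?_
    by_contra hxt
    exact (hts hxt : u x < u p₀).ne hx
  -- Among the maximum points, the one with largest real part is taken. Then `p + r` is not a
  -- maximum point, so every circle average about `p` is strictly below `u p`.
  obtain ⟨p, hpS, hpmax⟩ := hScomp.exists_isMaxOn ⟨p₀, rfl⟩ Complex.continuous_re.continuousOn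
  have hpe : u p = u p₀ := hpS
  have hpK : p ∉ K := fun hpK => by linarith [hK p hpK, hp₀ z]
  rcases h p hpK with ⟨r, hr, hav⟩ | ⟨p₁, p₂, h12⟩
  · have hlt : u (p + r) < u p₀ := by
      refine lt_of_le_of_ne (hp₀ _) fun he => ?_
      have : (p + r).re ≤ p.re := hpmax he
      simp at this
      linarith
    have hcont : Continuous fun θ => u p₀ - u (circleMap p r θ) :=
      continuous_const.sub (hu.comp (continuous_circleMap p r))
    have hpos : 0 < ∫ θ in (0 : ℝ)..2 * Real.pi, (u p₀ - u (circleMap p r θ)) := by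
      refine intervalIntegral.integral_pos (by positivity) hcont.continuousOn
        (fun θ _ => sub_nonneg.2 (hp₀ _)) ⟨0, ⟨le_rfl, by positivity⟩, ?_⟩
      simpa [circleMap] using hlt
    have hci : IntervalIntegrable (fun θ => u (circleMap p r θ)) volume 0 (2 * Real.pi) :=
      (hu.comp (continuous_circleMap p r)).intervalIntegrable _ _
    rw [intervalIntegral.integral_sub intervalIntegrable_const hci] at hpos
    rw [Real.circleAverage_def, smul_eq_mul, inv_mul_eq_div, le_div_iff₀ (by positivity), hpe] at hav
    rw [intervalIntegral.integral_const, smul_eq_mul] at hpos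
    linarith
  · linarith [hp₀ p₁, hp₀ p₂]

/-- The logarithmic potential with kernel truncated at distance `δ`. -/
noncomputable def regPotential (δ : ℝ) (μ : Measure ℂ) (z : ℂ) : ℝ :=
  ∫ w, -Real.log (max ‖z - w‖ δ) ∂μ

theorem continuous_log_max {δ : ℝ} (hδ : 0 < δ) :
    Continuous fun p : ℂ × ℂ => Real.log (max ‖p.1 - p.2‖ δ) :=
  Continuous.log (by fun_prop) fun p => (hδ.trans_le (le_max_right _ _)).ne'

theorem continuous_log_max_left {δ : ℝ} (hδ : 0 < δ) (w : ℂ) :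
    Continuous fun z : ℂ => Real.log (max ‖z - w‖ δ) :=
  Continuous.log (by fun_prop) fun p => (hδ.trans_le (le_max_right _ _)).ne'

theorem continuous_log_max_right {δ : ℝ} (hδ : 0 < δ) (z : ℂ) :
    Continuous fun w : ℂ => Real.log (max ‖z - w‖ δ) :=
  Continuous.log (by fun_prop) fun p => (hδ.trans_le (le_max_right _ _)).ne'

theorem abs_log_max_le {δ : ℝ} (hδ : 0 < δ) {x B : ℝ} (hx : x ≤ B) :
    |Real.log (max x δ)| ≤ |Real.log δ| + |Real.log (max B δ)| := by
  have h1 : Real.log δ ≤ Real.log (max x δ) := Real.log_le_log hδ (le_max_right _ _)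
  have h2 : Real.log (max x δ) ≤ Real.log (max B δ) :=
    Real.log_le_log (hδ.trans_le (le_max_right _ _)) (max_le_max_right _ hx)
  rw [abs_le]
  constructor
  · linarith [neg_abs_le (Real.log δ), abs_nonneg (Real.log (max B δ))]
  · linarith [le_abs_self (Real.log (max B δ)), abs_nonneg (Real.log δ)]

theorem ae_norm_le {ρ : ℝ} {μ : Measure ℂ} (hμ : μ (Metric.closedBall 0 ρ)ᶜ = 0) :
    ∀ᵐ w ∂μ, ‖w‖ ≤ ρ := by
  rw [ae_iff]
  convert hμ using 2
  ext w; simp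

section RegPotential

variable {ρ δ : ℝ} {μ : Measure ℂ} [IsFiniteMeasure μ]

theorem integrable_log_max (hμ : μ (Metric.closedBall 0 ρ)ᶜ = 0) (hδ : 0 < δ) (z : ℂ) :
    Integrable (fun w => -Real.log (max ‖z - w‖ δ)) μ := by
  refine Integrable.of_bound (continuous_log_max_right hδ z).neg.aestronglyMeasurable
    (|Real.log δ| + |Real.log (max (‖z‖ + ρ) δ)|) ?_
  filter_upwards [ae_norm_le hμ] with w hw
  rw [norm_neg, Real.norm_eq_abs]
  exact abs_log_max_le hδ (by linarith [norm_sub_le z w])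

theorem log_max_sub_le (hδ : 0 < δ) (a b : ℝ) :
    Real.log (max a δ) - Real.log (max b δ) ≤ |a - b| / δ := by
  have ha : 0 < max a δ := hδ.trans_le (le_max_right _ _)
  have hb : 0 < max b δ := hδ.trans_le (le_max_right _ _)
  rw [← Real.log_div ha.ne' hb.ne']
  calc _ ≤ max a δ / max b δ - 1 := Real.log_le_sub_one_of_pos (by positivity)
    _ = (max a δ - max b δ) / max b δ := by field_simp
    _ ≤ |a - b| / max b δ := by
      gcongr
      exact (le_abs_self _).trans (abs_max_sub_max_le_abs a b δ)
    _ ≤ |a - b| / δ := by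
      gcongr
      exact le_max_right _ _

theorem continuous_regPotential (hμ : μ (Metric.closedBall 0 ρ)ᶜ = 0) (hδ : 0 < δ) :
    Continuous (regPotential δ μ) := by
  have hle : ∀ x y, regPotential δ μ x ≤ regPotential δ μ y + (μ.real Set.univ / δ) * dist x y := by
    intro x y
    have : (μ.real Set.univ / δ) * dist x y = ∫ _, dist x y / δ ∂μ := by
      rw [integral_const, smul_eq_mul]; ring
    rw [this, regPotential, regPotential, ← integral_add (integrable_log_max hμ hδ y)
      (integrable_const _)]
    refine integral_mono (integrable_log_max hμ hδ x)
      ((integrable_log_max hμ hδ y).add (integrable_const _)) fun w => ?_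
    have h1 := log_max_sub_le hδ ‖y - w‖ ‖x - w‖
    have h2 : |‖y - w‖ - ‖x - w‖| / δ ≤ dist x y / δ := by
      gcongr
      refine (abs_norm_sub_norm_le _ _).trans ?_
      rw [dist_comm, dist_eq_norm]
      simp
    dsimp only
    linarith
  exact (LipschitzWith.of_le_add_mul (⟨μ.real Set.univ / δ, by positivity⟩ : NNReal) hle).continuous

theorem circleAverage_regPotential (hμ : μ (Metric.closedBall 0 ρ)ᶜ = 0) (hδ : 0 < δ) (z : ℂ)
    {r : ℝ} (hr : 0 < r) : Real.circleAverage (regPotential δ μ) z r =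
      ∫ w, -Real.circleAverage (fun x => Real.log (max ‖x - w‖ δ)) z r ∂μ := by
  rw [← integral_circleMeasure (continuous_regPotential hμ hδ).measurable]
  unfold regPotential
  rw [integral_integral_swap]
  · refine integral_congr_ae (Eventually.of_forall fun w => ?_)
    dsimp only
    rw [integral_neg, integral_circleMeasure (continuous_log_max_left hδ w).measurable]
  · refine Integrable.of_bound (continuous_log_max hδ).neg.aestronglyMeasurable
      (|Real.log δ| + |Real.log (max (‖z‖ + r + ρ) δ)|) ?_
    have h1 := Measure.quasiMeasurePreserving_fst (μ := circleMeasure z r) (ν := μ) |>.ae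
      (ae_circleMeasure_mem_sphere z hr.le)
    have h2 := Measure.quasiMeasurePreserving_snd (μ := circleMeasure z r) (ν := μ) |>.ae
      (ae_norm_le hμ)
    filter_upwards [h1, h2] with p hp1 hp2
    rw [Function.uncurry_def]
    dsimp only
    rw [norm_neg, Real.norm_eq_abs]
    refine abs_log_max_le hδ ?_
    rw [mem_sphere_iff_norm] at hp1
    have := norm_sub_le p.1 p.2
    have h3 : ‖p.1‖ ≤ ‖p.1 - z‖ + ‖z‖ := by simpa using norm_add_le (p.1 - z) z
    linarith

/-- The maximum of the subharmonic function `log ‖x - w‖` and the constant `log δ` is subharmonic;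
each of the two is compared separately. -/
theorem le_circleAverage_log_max (hδ : 0 < δ) (z w : ℂ) {r : ℝ} (hr : 0 < r) :
    Real.log (max ‖z - w‖ δ) ≤ Real.circleAverage (fun x => Real.log (max ‖x - w‖ δ)) z r := by
  have hc := continuous_log_max_left hδ w
  have hci : CircleIntegrable (fun x => Real.log (max ‖x - w‖ δ)) z r :=
    hc.continuousOn.circleIntegrable hr.le
  have h1 : Real.log δ ≤ Real.circleAverage (fun x => Real.log (max ‖x - w‖ δ)) z r := by
    rw [← Real.circleAverage_const (Real.log δ) z r]
    exact Real.circleAverage_mono (circleIntegrable_const _ _ _) hci fun x _ =>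
      Real.log_le_log hδ (le_max_right _ _)
  have h2 : Real.log (max ‖z - w‖ r) ≤
      Real.circleAverage (fun x => Real.log (max ‖x - w‖ δ)) z r := by
    rw [← circleAverage_log_norm_sub z w hr, Real.circleAverage_def, Real.circleAverage_def,
      smul_eq_mul, smul_eq_mul]
    refine mul_le_mul_of_nonneg_left ?_ (by positivity)
    refine intervalIntegral.integral_mono_ae (by positivity)
      (circleIntegrable_log_norm_sub_const (a := w) (c := z) r) hci ?_
    filter_upwards [ae_circleMap_ne z hr.ne' w] with θ hθ
    exact Real.log_le_log (norm_pos_iff.2 (sub_ne_zero.2 hθ)) (le_max_left _ _)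
  rcases max_cases ‖z - w‖ δ with ⟨h, h'⟩ | ⟨h, _⟩
  · rw [h]
    rcases eq_or_ne z w with rfl | hne
    · simp at h'
      exact absurd h' (not_le.2 hδ)
    · exact (Real.log_le_log (norm_pos_iff.2 (sub_ne_zero.2 hne)) (le_max_left _ _)).trans h2
  · rwa [h]

theorem integrable_circleAverage_log_max (hμ : μ (Metric.closedBall 0 ρ)ᶜ = 0) (hδ : 0 < δ) (z : ℂ)
    {r : ℝ} (hr : 0 < r) :
    Integrable (fun w => -Real.circleAverage (fun x => Real.log (max ‖x - w‖ δ)) z r) μ := by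
  have hm : StronglyMeasurable fun w =>
      ∫ x, Real.log (max ‖x - w‖ δ) ∂circleMeasure z r := by
    have : StronglyMeasurable fun p : ℂ × ℂ => Real.log (max ‖p.2 - p.1‖ δ) :=
      ((continuous_log_max hδ).comp continuous_swap).stronglyMeasurable
    exact this.integral_prod_right'
  simp_rw [fun w => integral_circleMeasure (continuous_log_max_left hδ w).measurable z r] at hm
  refine Integrable.of_bound hm.neg.aestronglyMeasurable
    (|Real.log δ| + |Real.log (max (‖z‖ + r + ρ) δ)|) ?_
  filter_upwards [ae_norm_le hμ] with w hw
  rw [norm_neg, Real.norm_eq_abs]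
  refine Real.abs_circleAverage_le_circleAverage_abs.trans ?_
  refine Real.circleAverage_mono_on_of_le_circle ?_ fun x hx => ?_
  · exact (continuous_log_max_left hδ w).abs.continuousOn.circleIntegrable hr.le
  · refine abs_log_max_le hδ ?_
    rw [abs_of_pos hr, mem_sphere_iff_norm] at hx
    have := norm_sub_le x w
    have h3 : ‖x‖ ≤ ‖x - z‖ + ‖z‖ := by simpa using norm_add_le (x - z) z
    linarith

theorem circleAverage_regPotential_le (hμ : μ (Metric.closedBall 0 ρ)ᶜ = 0) (hδ : 0 < δ) (z : ℂ)
    {r : ℝ} (hr : 0 < r) : Real.circleAverage (regPotential δ μ) z r ≤ regPotential δ μ z := by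
  rw [circleAverage_regPotential hμ hδ z hr]
  exact integral_mono (integrable_circleAverage_log_max hμ hδ z hr) (integrable_log_max hμ hδ z)
    fun w => neg_le_neg (le_circleAverage_log_max hδ z w hr)

/-- The margin `r + δ` keeps the circle at distance at least `δ` from the charge, where the cutoff
is inactive and the kernel is harmonic. -/
theorem circleAverage_regPotential_eq (hμ : μ (Metric.closedBall 0 ρ)ᶜ = 0) (hδ : 0 < δ) (z : ℂ)
    {r : ℝ} (hr : 0 < r) (h : ∀ᵐ w ∂μ, r + δ ≤ ‖z - w‖) :
    Real.circleAverage (regPotential δ μ) z r = regPotential δ μ z := by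
  rw [circleAverage_regPotential hμ hδ z hr]
  refine integral_congr_ae ?_
  filter_upwards [h] with w hw
  have h1 : Real.circleAverage (fun x => Real.log (max ‖x - w‖ δ)) z r =
      Real.circleAverage (fun x => Real.log ‖x - w‖) z r := by
    refine Real.circleAverage_congr_sphere fun x hx => ?_
    rw [abs_of_pos hr, mem_sphere_iff_norm] at hx
    have h3 : ‖z - w‖ ≤ ‖x - z‖ + ‖x - w‖ := by
      have := norm_sub_le (x - w) (x - z)
      simp only [sub_sub_sub_cancel_left] at this
      linarith
    rw [max_eq_left (by linarith)]
  rw [h1, circleAverage_log_norm_sub z w hr, max_eq_left (by linarith), max_eq_left (by linarith)]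

/-- Second differences of a truncated potential are bounded above quadratically. -/
theorem regPotential_add_le (hμ : μ (Metric.closedBall 0 ρ)ᶜ = 0) (hδ : 0 < δ) (z e : ℂ)
    (he : ‖e‖ ≤ δ / 2) : regPotential δ μ (z + e) + regPotential δ μ (z - e) ≤
      2 * regPotential δ μ z + 2 * ‖e‖ ^ 2 / δ ^ 2 * μ.real Set.univ := by
  have hc : 2 * ‖e‖ ^ 2 / δ ^ 2 * μ.real Set.univ = ∫ _, 2 * ‖e‖ ^ 2 / δ ^ 2 ∂μ := by
    rw [integral_const, smul_eq_mul]; ring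
  unfold regPotential
  rw [hc, ← integral_const_mul, ← integral_add (integrable_log_max hμ hδ _)
    (integrable_log_max hμ hδ _), ← integral_add ((integrable_log_max hμ hδ _).const_mul _)
    (integrable_const _)]
  refine integral_mono ((integrable_log_max hμ hδ _).add (integrable_log_max hμ hδ _))
    (((integrable_log_max hμ hδ _).const_mul _).add (integrable_const _)) fun w => ?_
  dsimp only
  have hp : 0 < max ‖z + e - w‖ δ := hδ.trans_le (le_max_right _ _)
  have hm : 0 < max ‖z - e - w‖ δ := hδ.trans_le (le_max_right _ _)
  have hz : 0 < max ‖z - w‖ δ := hδ.trans_le (le_max_right _ _)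
  have ht : 2 * ‖e‖ ^ 2 / δ ^ 2 ≤ 1 / 2 := by
    rw [div_le_iff₀ (by positivity)]
    nlinarith [norm_nonneg e]
  -- This rests on $(z+e-w)(z-e-w)=(z-w)^2-e^2$: at distances at least `δ` the relative loss is at
  -- most `‖e‖ ^ 2 / δ ^ 2`, and at smaller ones the cutoff leaves no loss at all.
  have key : (max ‖z - w‖ δ) ^ 2 * (1 - ‖e‖ ^ 2 / δ ^ 2) ≤
      max ‖z + e - w‖ δ * max ‖z - e - w‖ δ := by
    rcases le_total ‖z - w‖ δ with h | h
    · rw [max_eq_right h]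
      calc _ ≤ δ ^ 2 * 1 := by
            gcongr
            linarith [show 0 ≤ ‖e‖ ^ 2 / δ ^ 2 by positivity]
        _ = δ * δ := by ring
        _ ≤ _ := by gcongr <;> exact le_max_right _ _
    · rw [max_eq_left h]
      have h1 : ‖z - w‖ ^ 2 - ‖e‖ ^ 2 ≤ ‖z + e - w‖ * ‖z - e - w‖ := by
        rw [← norm_mul, ← norm_pow, ← norm_pow,
          show (z + e - w) * (z - e - w) = (z - w) ^ 2 - e ^ 2 by ring]
        exact norm_sub_norm_le _ _
      have h2 : ‖e‖ ^ 2 ≤ ‖z - w‖ ^ 2 * (‖e‖ ^ 2 / δ ^ 2) := by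
        rw [mul_div_assoc', le_div_iff₀ (by positivity), mul_comm]
        gcongr
      calc _ ≤ ‖z - w‖ ^ 2 - ‖e‖ ^ 2 := by linarith
        _ ≤ _ := h1
        _ ≤ _ := by gcongr <;> exact le_max_left _ _
  have hpos : 0 < 1 - ‖e‖ ^ 2 / δ ^ 2 := by
    have : 2 * (‖e‖ ^ 2 / δ ^ 2) ≤ 1 / 2 := by rw [← mul_div_assoc]; exact ht
    linarith
  have h3 := Real.log_le_log (by positivity) key
  rw [Real.log_mul (by positivity) hpos.ne', Real.log_mul hp.ne' hm.ne', Real.log_pow] at h3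
  have h4 : -(2 * ‖e‖ ^ 2 / δ ^ 2) ≤ Real.log (1 - ‖e‖ ^ 2 / δ ^ 2) := by
    set t := ‖e‖ ^ 2 / δ ^ 2 with ht'
    have ht2 : 2 * ‖e‖ ^ 2 / δ ^ 2 = 2 * t := by rw [ht', mul_div_assoc]
    rw [ht2] at ht ⊢
    have ht0 : 0 ≤ t := by positivity
    have := Real.one_sub_inv_le_log_of_pos hpos
    have h5 : (1 - t)⁻¹ ≤ 1 + 2 * t := by
      rw [inv_le_iff_one_le_mul₀ hpos]
      nlinarith
    linarith
  push_cast at h3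
  linarith

/-- Second differences of a truncated potential away from the measure are bounded below
quadratically. -/
theorem le_regPotential_add (hμ : μ (Metric.closedBall 0 ρ)ᶜ = 0) (hδ : 0 < δ) (z e : ℂ)
    (he : ‖e‖ ≤ δ) (h : ∀ᵐ w ∂μ, 2 * δ ≤ ‖z - w‖) :
    2 * regPotential δ μ z - ‖e‖ ^ 2 / δ ^ 2 * μ.real Set.univ ≤
      regPotential δ μ (z + e) + regPotential δ μ (z - e) := by
  have hc : ‖e‖ ^ 2 / δ ^ 2 * μ.real Set.univ = ∫ _, ‖e‖ ^ 2 / δ ^ 2 ∂μ := by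
    rw [integral_const, smul_eq_mul]; ring
  unfold regPotential
  rw [hc, ← integral_const_mul, ← integral_add (integrable_log_max hμ hδ _)
    (integrable_log_max hμ hδ _), ← integral_sub ((integrable_log_max hμ hδ _).const_mul _)
    (integrable_const _)]
  refine integral_mono_ae (((integrable_log_max hμ hδ _).const_mul _).sub (integrable_const _))
    ((integrable_log_max hμ hδ _).add (integrable_log_max hμ hδ _)) ?_
  filter_upwards [h] with w hw
  have hp : δ ≤ ‖z + e - w‖ := by
    have := norm_sub_le (z + e - w) e
    rw [show z + e - w - e = z - w by ring] at this
    linarith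
  have hm : δ ≤ ‖z - e - w‖ := by
    have := norm_add_le (z - e - w) e
    rw [show z - e - w + e = z - w by ring] at this
    linarith
  rw [max_eq_left hp, max_eq_left hm, max_eq_left (by linarith)]
  have hz0 : 0 < ‖z - w‖ := by linarith
  have h1 : ‖z + e - w‖ * ‖z - e - w‖ ≤ ‖z - w‖ ^ 2 * (1 + ‖e‖ ^ 2 / δ ^ 2) := by
    have h2 : ‖e‖ ^ 2 ≤ ‖z - w‖ ^ 2 * (‖e‖ ^ 2 / δ ^ 2) := by
      rw [mul_div_assoc', le_div_iff₀ (by positivity), mul_comm]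
      gcongr
      linarith
    calc _ ≤ ‖z - w‖ ^ 2 + ‖e‖ ^ 2 := by
          rw [← norm_mul, ← norm_pow, ← norm_pow,
            show (z + e - w) * (z - e - w) = (z - w) ^ 2 - e ^ 2 by ring]
          exact norm_sub_le _ _
      _ ≤ _ := by linarith
  have h3 := Real.log_le_log (mul_pos (hδ.trans_le hp) (hδ.trans_le hm)) h1
  rw [Real.log_mul (hδ.trans_le hp).ne' (hδ.trans_le hm).ne',
    Real.log_mul (by positivity) (by positivity), Real.log_pow] at h3
  have h4 : Real.log (1 + ‖e‖ ^ 2 / δ ^ 2) ≤ ‖e‖ ^ 2 / δ ^ 2 := by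
    have := Real.log_le_sub_one_of_pos (show 0 < 1 + ‖e‖ ^ 2 / δ ^ 2 by positivity)
    linarith
  push_cast at h3
  linarith

end RegPotential

/-- Taking the maximum with `s` in place of a bound on the distance makes the splitting of
`truncKernel_add` valid on the whole plane. -/
theorem truncKernel_eq_add {r s : ℝ} (hr : 0 < r) (hrs : r ≤ s) (z w : ℂ) :
    truncKernel s z w =
      ENNReal.ofReal (Real.log (max ‖z - w‖ s) - Real.log (max ‖z - w‖ r)) + truncKernel r z w := by
  rcases le_total ‖z - w‖ s with h | h
  · rw [truncKernel_add hr hrs h, max_eq_right h]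
  · rw [truncKernel_eq_zero (hr.trans_le hrs) h, truncKernel_eq_zero hr (hrs.trans h),
      max_eq_left h, max_eq_left (hrs.trans h)]
    simp

/-- No two points of the disk are further apart than `2 * ρ`, so at this scale the regular part is
constant. This translates `truncPotential (2 * ρ)` into the true potential, which also makes sense
outside the disk. -/
theorem regPotential_two_mul {ρ : ℝ} {μ : Measure ℂ} (hμ : μ (Metric.closedBall 0 ρ)ᶜ = 0) {z : ℂ}
    (hz : z ∈ Metric.closedBall (0 : ℂ) ρ) :
    regPotential (2 * ρ) μ z = -Real.log (2 * ρ) * μ.real Set.univ := by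
  rw [mem_closedBall_zero_iff] at hz
  unfold regPotential
  rw [integral_congr_ae (g := fun _ => -Real.log (2 * ρ)), integral_const, smul_eq_mul, mul_comm]
  filter_upwards [ae_norm_le hμ] with w hw
  rw [max_eq_right]
  linarith [norm_sub_le z w]

theorem truncPotential_eq_zero {μ : Measure ℂ} {s : ℝ} (hs : 0 < s) {z : ℂ} (h : ∀ᵐ w ∂μ, s ≤ ‖z - w‖) :
    truncPotential s μ z = 0 := by
  unfold truncPotential
  rw [lintegral_congr_ae (g := fun _ => 0), lintegral_zero]
  filter_upwards [h] with w hw using truncKernel_eq_zero hs hw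

/-- A truncated potential of a measure on a compact set is controlled by its values on that set. -/
theorem truncPotential_restrict_le {μ : Measure ℂ} {K : Set ℂ} (hK : IsCompact K) {s : ℝ}
    (hs : 0 < s) {B : ℝ≥0∞} (hB : ∀ z ∈ K, truncPotential (2 * s) μ z ≤ B) (z : ℂ) :
    truncPotential s (μ.restrict K) z ≤ B := by
  rcases K.eq_empty_or_nonempty with rfl | hne
  · simp [truncPotential]
  -- Replacing `z` by a nearest point `z'` of `K` at most doubles the distances to points of `K`,
  -- which the scale `2 * s` compensates.
  obtain ⟨z', hz', hd⟩ := hK.exists_infDist_eq_dist hne z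
  refine le_trans ?_ ((truncPotential_mono_measure _ (Measure.restrict_le_self (s := K)) z').trans (hB z' hz'))
  refine setLIntegral_mono (continuous_truncKernel_right _ _).measurable fun w hw => ?_
  have h1 : ‖z' - w‖ ≤ 2 * ‖z - w‖ := by
    have h2 : dist z z' ≤ dist z w := by rw [← hd]; exact Metric.infDist_le_dist_of_mem hw
    rw [dist_eq_norm, dist_eq_norm] at h2
    have h3 := norm_sub_le (z - w) (z - z')
    simp only [sub_sub_sub_cancel_left] at h3
    linarith
  rcases eq_or_ne z' w with rfl | hne'
  · rw [truncKernel_self (by positivity)]; exact le_top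
  have h' : 0 < ‖z' - w‖ := norm_pos_iff.2 (sub_ne_zero.2 hne')
  have h'' : 0 < ‖z - w‖ := by linarith
  rw [truncKernel_of_ne (by positivity) hne',
    truncKernel_of_ne hs (sub_ne_zero.1 (norm_pos_iff.1 h''))]
  refine ENNReal.ofReal_le_ofReal (Real.log_le_log (by positivity) ?_)
  rw [div_le_div_iff₀ h'' h']
  nlinarith

section

variable {ρ : ℝ} {μ : Measure ℂ} [IsFiniteMeasure μ]

theorem truncPotential_eq_add (hμ : μ (Metric.closedBall 0 ρ)ᶜ = 0) {r s : ℝ} (hr : 0 < r)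
    (hrs : r ≤ s) (z : ℂ) : truncPotential s μ z =
      ENNReal.ofReal (regPotential r μ z - regPotential s μ z) + truncPotential r μ z := by
  have hs := hr.trans_le hrs
  unfold truncPotential regPotential
  simp_rw [truncKernel_eq_add hr hrs z]
  rw [lintegral_add_right _ (continuous_truncKernel_right r z).measurable,
    ← integral_sub (integrable_log_max hμ hr z) (integrable_log_max hμ hs z),
    ofReal_integral_eq_lintegral_ofReal (f := fun w => -Real.log (max ‖z - w‖ r) -
      -Real.log (max ‖z - w‖ s)) ((integrable_log_max hμ hr z).sub (integrable_log_max hμ hs z))]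
  · congr 1
    refine lintegral_congr fun w => ?_
    congr 1
    ring
  · refine Eventually.of_forall fun w => ?_
    have := Real.log_le_log (hr.trans_le (le_max_right ‖z - w‖ r)) (max_le_max_left ‖z - w‖ hrs)
    simp only [Pi.zero_apply]
    linarith

theorem regPotential_anti (hμ : μ (Metric.closedBall 0 ρ)ᶜ = 0) {r s : ℝ} (hr : 0 < r)
    (hrs : r ≤ s) (z : ℂ) : regPotential s μ z ≤ regPotential r μ z :=
  integral_mono (integrable_log_max hμ (hr.trans_le hrs) z) (integrable_log_max hμ hr z)
    fun w => neg_le_neg (Real.log_le_log (hr.trans_le (le_max_right ‖z - w‖ r))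
      (max_le_max_left ‖z - w‖ hrs))

/-- The value of the logarithmic potential does not depend on the scale at which the singular part
is split off. -/
theorem regPotential_add_truncPotential (hμ : μ (Metric.closedBall 0 ρ)ᶜ = 0) {r s : ℝ}
    (hr : 0 < r) (hrs : r ≤ s) {z : ℂ} (h : truncPotential s μ z ≠ ⊤) :
    regPotential s μ z + (truncPotential s μ z).toReal =
      regPotential r μ z + (truncPotential r μ z).toReal := by
  have h' : truncPotential r μ z ≠ ⊤ := ne_top_of_le_ne_top h (truncPotential_mono hr hrs μ z)
  rw [truncPotential_eq_add hμ hr hrs, ENNReal.toReal_add ENNReal.ofReal_ne_top h',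
    ENNReal.toReal_ofReal (sub_nonneg.2 (regPotential_anti hμ hr hrs z))]
  ring

/-- Away from a logarithmic singularity set, growth of potentials at infinity. -/
theorem regPotential_le_of_norm_ge (hμ : μ (Metric.closedBall 0 ρ)ᶜ = 0) (hρ : 0 < ρ) {δ : ℝ}
    (hδ : 0 < δ) {z : ℂ} (hz : 2 * ρ ≤ ‖z‖) :
    regPotential δ μ z ≤ -(Real.log ‖z‖ - Real.log 2) * μ.real Set.univ := by
  have hz0 : 0 < ‖z‖ := by linarith
  have : -(Real.log ‖z‖ - Real.log 2) * μ.real Set.univ =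
      ∫ _, -(Real.log ‖z‖ - Real.log 2) ∂μ := by
    rw [integral_const, smul_eq_mul]; ring
  rw [this]
  refine integral_mono_ae (integrable_log_max hμ hδ z) (integrable_const _) ?_
  filter_upwards [ae_norm_le hμ] with w hw
  rw [← Real.log_div hz0.ne' two_ne_zero]
  refine neg_le_neg (Real.log_le_log (by positivity) (le_max_of_le_left ?_))
  linarith [norm_sub_norm_le z w]

theorem le_regPotential_of_norm_ge (hμ : μ (Metric.closedBall 0 ρ)ᶜ = 0) (hρ : 0 < ρ) {δ : ℝ}
    (hδ : 0 < δ) (hδρ : δ ≤ 2 * ρ) {z : ℂ} (hz : 2 * ρ ≤ ‖z‖) :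
    -(Real.log ‖z‖ + Real.log 2) * μ.real Set.univ ≤ regPotential δ μ z := by
  have hz0 : 0 < ‖z‖ := by linarith
  have : -(Real.log ‖z‖ + Real.log 2) * μ.real Set.univ =
      ∫ _, -(Real.log ‖z‖ + Real.log 2) ∂μ := by
    rw [integral_const, smul_eq_mul]; ring
  rw [this]
  refine integral_mono_ae (integrable_const _) (integrable_log_max hμ hδ z) ?_
  filter_upwards [ae_norm_le hμ] with w hw
  rw [← Real.log_mul hz0.ne' two_ne_zero]
  refine neg_le_neg (Real.log_le_log (hδ.trans_le (le_max_right _ _)) (max_le ?_ ?_))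
  · linarith [norm_sub_le z w]
  · linarith

end

/-! ### The domination principle -/

/-- A continuous function on the plane that is subharmonic off a circle, with a convex kink along
the circle, and of at most logarithmic growth. -/
structure IsKinkedSubharmonic (ρ g : ℝ) (q : ℂ → ℝ) : Prop where
  continuous : Continuous q
  le_circleAverage : ∀ p : ℂ, ‖p‖ ≠ ρ → ∃ r₀ > 0, ∀ r, 0 < r → r < r₀ →
    q p ≤ Real.circleAverage q p r
  -- The gain is linear in `ε`, so it beats the quadratic second differences of the potentials in
  -- `domination`.
  kink : ∀ p : ℂ, ‖p‖ = ρ → ∃ n : ℂ, ‖n‖ = 1 ∧ ∃ a > 0, ∀ᶠ ε : ℝ in 𝓝[>] 0,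
    2 * q p + a * ε ≤ q (p + ε * n) + q (p - ε * n)
  growth : ∃ C, ∀ z : ℂ, 2 * ρ ≤ ‖z‖ → q z ≤ C + g * Real.log ‖z‖

theorem tendsto_atBot_of_growth {ρ a C : ℝ} (ha : a < 0) {u : ℂ → ℝ}
    (h : ∀ z : ℂ, 2 * ρ ≤ ‖z‖ → u z ≤ C + a * Real.log ‖z‖) : Tendsto u (cocompact ℂ) atBot := by
  have h1 : Tendsto (fun z : ℂ => C + a * Real.log ‖z‖) (cocompact ℂ) atBot :=
    tendsto_atBot_add_const_left _ _
      ((Real.tendsto_log_atTop.comp tendsto_norm_cocompact_atTop).const_mul_atTop_of_neg ha)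
  refine tendsto_atBot_mono' _ ?_ h1
  filter_upwards [tendsto_norm_cocompact_atTop.eventually_ge_atTop (2 * ρ)] with z hz using h z hz

/-- Egorov's theorem makes the pointwise decay of the singular parts uniform off a set of measure `ε
/ 2`; inner regularity yields the compact set at the cost of another `ε / 2`. -/
theorem exists_isCompact_uniform {ρ : ℝ} (hρ : 0 < ρ) {μ τ : Measure ℂ} [IsFiniteMeasure μ]
    [IsFiniteMeasure τ] (hμD : μ (Metric.closedBall 0 ρ)ᶜ = 0)
    (h1 : ∀ᵐ z ∂μ, truncPotential (2 * ρ) μ z ≠ ⊤) (h2 : ∀ᵐ z ∂μ, truncPotential (2 * ρ) τ z ≠ ⊤)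
    {A : ℂ → Prop} (hA : ∀ᵐ z ∂μ, A z) {ε : ℝ} (hε : 0 < ε) :
    ∃ K : Set ℂ, IsCompact K ∧ K ⊆ Metric.closedBall 0 ρ ∧ μ Kᶜ ≤ ENNReal.ofReal ε ∧
      (∀ z ∈ K, A z ∧ truncPotential (2 * ρ) τ z ≠ ⊤) ∧
      ∀ η : ℝ, 0 < η → ∃ s, 0 < s ∧ s ≤ 2 * ρ ∧ ∀ z ∈ K,
        truncPotential s μ z ≤ ENNReal.ofReal η ∧ truncPotential s τ z ≤ ENNReal.ofReal η := by
  set f : ℕ → ℂ → ℝ := fun n z => (truncPotential (2 * ρ / (n + 1)) μ z).toReal +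
    (truncPotential (2 * ρ / (n + 1)) τ z).toReal with hf
  have hfm : ∀ n, StronglyMeasurable (f n) := fun n =>
    ((measurable_truncPotential _ μ).ennreal_toReal.add
      (measurable_truncPotential _ τ).ennreal_toReal).stronglyMeasurable
  have hlim : ∀ᵐ z ∂μ, Tendsto (fun n => f n z) atTop (𝓝 0) := by
    filter_upwards [h1, h2] with z hz1 hz2
    have e1 := (ENNReal.tendsto_toReal ENNReal.zero_ne_top).comp
      (tendsto_truncPotential_zero (by positivity) hz1)
    have e2 := (ENNReal.tendsto_toReal ENNReal.zero_ne_top).comp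
      (tendsto_truncPotential_zero (by positivity) hz2)
    simpa using e1.add e2
  obtain ⟨t, htm, ht, htu⟩ := tendstoUniformlyOn_of_ae_tendsto' hfm stronglyMeasurable_zero hlim
    (half_pos hε)
  have hgood : ∀ᵐ z ∂μ, z ∈ Metric.closedBall (0 : ℂ) ρ ∧ A z ∧ truncPotential (2 * ρ) μ z ≠ ⊤ ∧
      truncPotential (2 * ρ) τ z ≠ ⊤ := by
    filter_upwards [h1, h2, hA, ae_norm_le hμD] with z a1 a2 a3 a4
    exact ⟨by simpa using a4, a3, a1, a2⟩
  rw [ae_iff] at hgood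
  set T := toMeasurable μ {z | ¬(z ∈ Metric.closedBall (0 : ℂ) ρ ∧ A z ∧
    truncPotential (2 * ρ) μ z ≠ ⊤ ∧ truncPotential (2 * ρ) τ z ≠ ⊤)} with hT
  have hTm : MeasurableSet T := measurableSet_toMeasurable _ _
  have hT0 : μ T = 0 := by rw [hT, measure_toMeasurable, hgood]
  have hTg : ∀ z ∉ T, z ∈ Metric.closedBall (0 : ℂ) ρ ∧ A z ∧ truncPotential (2 * ρ) μ z ≠ ⊤ ∧
      truncPotential (2 * ρ) τ z ≠ ⊤ := fun z hz => by
    by_contra hcon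
    exact hz (subset_toMeasurable μ _ hcon)
  obtain ⟨K, hKs, hK, hKμ⟩ := (htm.union hTm).compl.exists_isCompact_sdiff_lt
    (measure_ne_top μ _) (ε := ENNReal.ofReal (ε / 2)) (by simpa using hε)
  have hKt : ∀ z ∈ K, z ∉ t ∧ z ∉ T := fun z hz => by simpa using hKs hz
  refine ⟨K, hK, fun z hz => (hTg z (hKt z hz).2).1, ?_, fun z hz =>
    ⟨(hTg z (hKt z hz).2).2.1, (hTg z (hKt z hz).2).2.2.2⟩, fun η hη => ?_⟩
  · have : Kᶜ ⊆ ((t ∪ T)ᶜ \ K) ∪ t ∪ T := fun z hz => by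
      by_cases h3 : z ∈ T
      · exact Or.inr h3
      by_cases h4 : z ∈ t
      · exact Or.inl (Or.inr h4)
      · exact Or.inl (Or.inl ⟨fun h5 => h5.elim h4 h3, hz⟩)
    calc μ Kᶜ ≤ μ ((t ∪ T)ᶜ \ K) + μ t + μ T :=
          (measure_mono this).trans ((measure_union_le _ _).trans
            (by gcongr; exact measure_union_le _ _))
      _ ≤ ENNReal.ofReal (ε / 2) + ENNReal.ofReal (ε / 2) + 0 := by
          gcongr
          exact hT0.le
      _ = ENNReal.ofReal ε := by
          rw [add_zero, ← ENNReal.ofReal_add (by positivity) (by positivity), add_halves]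
  · obtain ⟨n, hn⟩ := (Metric.tendstoUniformlyOn_iff.1 htu η hη).exists
    have hnpos : (0 : ℝ) < n + 1 := by positivity
    have hs : 2 * ρ / (n + 1) ≤ 2 * ρ :=
      div_le_self (by positivity) (by linarith [n.cast_nonneg (α := ℝ)])
    refine ⟨2 * ρ / (n + 1), by positivity, hs, fun z hz => ?_⟩
    have h3 := hn z (hKt z hz).1
    have hg := hTg z (hKt z hz).2
    have p0 := ENNReal.toReal_nonneg (a := truncPotential (2 * ρ / (n + 1)) μ z)
    have p1 := ENNReal.toReal_nonneg (a := truncPotential (2 * ρ / (n + 1)) τ z)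
    rw [Real.dist_eq, hf] at h3
    simp only [Pi.zero_apply, zero_sub, abs_neg] at h3
    rw [abs_of_nonneg (by positivity)] at h3
    have f1 := ne_top_of_le_ne_top hg.2.2.1 (truncPotential_mono (by positivity) hs μ z)
    have f2 := ne_top_of_le_ne_top hg.2.2.2 (truncPotential_mono (by positivity) hs τ z)
    exact ⟨(ENNReal.le_ofReal_iff_toReal_le f1 hη.le).2 (by linarith),
      (ENNReal.le_ofReal_iff_toReal_le f2 hη.le).2 (by linarith)⟩

/-- The logarithmic potential of a measure is continuous on the plane if its singular part is
uniformly small on a compact carrier. -/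
theorem continuous_of_uniform {ρ : ℝ} {μ : Measure ℂ} [IsFiniteMeasure μ] {K : Set ℂ}
    (hK : IsCompact K) (hKD : K ⊆ Metric.closedBall 0 ρ)
    (hu : ∀ η : ℝ, 0 < η → ∃ s, 0 < s ∧ s ≤ 2 * ρ ∧ ∀ z ∈ K,
      truncPotential s μ z ≤ ENNReal.ofReal η) :
    (∀ z, truncPotential (2 * ρ) (μ.restrict K) z ≠ ⊤) ∧
    Continuous fun z => regPotential (2 * ρ) (μ.restrict K) z +
      (truncPotential (2 * ρ) (μ.restrict K) z).toReal := by
  have hD : μ.restrict K (Metric.closedBall 0 ρ)ᶜ = 0 :=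
    measure_mono_null (Set.compl_subset_compl.2 hKD)
      (by rw [Measure.restrict_apply hK.measurableSet.compl]; simp)
  -- By `truncPotential_restrict_le`, uniform smallness on `K` extends to the whole plane at half
  -- the scale.
  have hu' : ∀ η : ℝ, 0 < η → ∃ s, 0 < s ∧ s ≤ 2 * ρ ∧ ∀ z,
      truncPotential s (μ.restrict K) z ≤ ENNReal.ofReal η := by
    intro η hη
    obtain ⟨s, hs, hsρ, hsK⟩ := hu η hη
    refine ⟨s / 2, by positivity, by linarith, truncPotential_restrict_le hK (by positivity) ?_⟩
    rwa [mul_div_cancel₀ _ two_ne_zero]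
  have hfin : ∀ z, truncPotential (2 * ρ) (μ.restrict K) z ≠ ⊤ := by
    intro z
    obtain ⟨s, hs, hsρ, hsK⟩ := hu' 1 one_pos
    rw [truncPotential_eq_add hD hs hsρ]
    exact ENNReal.add_ne_top.2 ⟨ENNReal.ofReal_ne_top,
      ne_top_of_le_ne_top ENNReal.ofReal_ne_top (hsK z)⟩
  refine ⟨hfin, ?_⟩
  choose! s hs0 hsρ hs using hu'
  -- The potential is thus a uniform limit of continuous regularized potentials.
  have hlim : TendstoUniformly (fun (n : ℕ) => regPotential (s (1 / ((n : ℝ) + 1))) (μ.restrict K))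
      (fun z => regPotential (2 * ρ) (μ.restrict K) z +
        (truncPotential (2 * ρ) (μ.restrict K) z).toReal) atTop := by
    rw [Metric.tendstoUniformly_iff]
    intro ε hε
    filter_upwards [tendsto_one_div_add_atTop_nhds_zero_nat.eventually (gt_mem_nhds hε)] with n hn z
    have hη : (0 : ℝ) < 1 / ((n : ℝ) + 1) := by positivity
    rw [regPotential_add_truncPotential hD (hs0 _ hη) (hsρ _ hη) (hfin z), Real.dist_eq,
      add_sub_cancel_left, abs_of_nonneg ENNReal.toReal_nonneg]
    exact (ENNReal.toReal_le_of_le_ofReal hη.le (hs _ hη z)).trans_lt hn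
  exact hlim.continuous (Frequently.of_forall fun n =>
    continuous_regPotential hD (hs0 _ (by positivity)))

/-- **Domination principle** on a disk, with a subharmonic perturbation. -/
theorem domination {ρ g c : ℝ} (hρ : 0 < ρ) {μ τ : Measure ℂ} [IsFiniteMeasure μ]
    [IsFiniteMeasure τ] (hμD : μ (Metric.closedBall 0 ρ)ᶜ = 0)
    (hτD : τ (Metric.closedBall 0 ρ)ᶜ = 0) {q : ℂ → ℝ} (hq : IsKinkedSubharmonic ρ g q)
    (hmass : g + τ.real Set.univ < μ.real Set.univ)
    (h : ∀ᵐ z ∂μ, truncPotential (2 * ρ) μ z ≠ ⊤ ∧ truncPotential (2 * ρ) τ z ≠ ⊤ ∧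
      (truncPotential (2 * ρ) μ z).toReal + q z ≤ (truncPotential (2 * ρ) τ z).toReal + c)
    {z₀ : ℂ} (hz₀ : z₀ ∈ Metric.closedBall (0 : ℂ) ρ) (hz₀' : z₀ ∉ μ.support)
    (hτz₀ : truncPotential (2 * ρ) τ z₀ ≠ ⊤) :
    (truncPotential (2 * ρ) μ z₀).toReal + q z₀ ≤
      (truncPotential (2 * ρ) τ z₀).toReal + c := by
  set a := μ.real Set.univ - τ.real Set.univ - g with ha
  have ha0 : 0 < a := by linarith
  obtain ⟨d, hd, hdμ⟩ : ∃ d > 0, μ (Metric.ball z₀ d) = 0 := by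
    obtain ⟨U, hU, hμU⟩ := Measure.notMem_support_iff_exists.1 hz₀'
    obtain ⟨d, hd, hdU⟩ := Metric.mem_nhds_iff.1 hU
    exact ⟨d, hd, measure_mono_null hdU hμU⟩
  -- The maximum principle needs continuous functions, so `μ` is cut down to a compact set and `τ`
  -- is regularized. The bound `ε < a` preserves the strict mass inequality, and the total error is
  -- a fixed multiple of `ε`.
  have key : ∀ ε, 0 < ε → ε < a → (truncPotential (2 * ρ) μ z₀).toReal + q z₀ ≤
      (truncPotential (2 * ρ) τ z₀).toReal + c + ε * (1 + max 0 (Real.log (2 * ρ / d))) := by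
    intro ε hε hεa
    obtain ⟨K, hK, hKD, hKμ, hKh, hKu⟩ := exists_isCompact_uniform hρ hμD
      (h.mono fun z hz => hz.1) (h.mono fun z hz => hz.2.1)
      (A := fun z => truncPotential (2 * ρ) μ z ≠ ⊤ ∧ (truncPotential (2 * ρ) μ z).toReal + q z ≤
        (truncPotential (2 * ρ) τ z).toReal + c) (h.mono fun z hz => ⟨hz.1, hz.2.2⟩) hε
    obtain ⟨hfin, hcont⟩ := continuous_of_uniform hK hKD fun η hη => by
      obtain ⟨s, h1, h2, h3⟩ := hKu η hη
      exact ⟨s, h1, h2, fun z hz => (h3 z hz).1⟩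
    obtain ⟨δ, hδ, hδρ, hδK⟩ := hKu ε hε
    have hKres : μ.restrict K (Metric.closedBall 0 ρ)ᶜ = 0 :=
      measure_mono_null (Set.compl_subset_compl.2 hKD)
        (by rw [Measure.restrict_apply hK.measurableSet.compl]; simp)
    have hKmem : ∀ᵐ w ∂μ.restrict K, w ∈ K := ae_restrict_mem hK.measurableSet
    set m := (μ.restrict K).real Set.univ with hm
    have hm1 : μ.real Set.univ - ε ≤ m := by
      have h1 : μ.real Kᶜ ≤ ε := ENNReal.toReal_le_of_le_ofReal hε.le hKμ
      have h2 := measureReal_add_measureReal_compl (μ := μ) hK.measurableSet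
      have h3 : m = μ.real K := by simp [hm]
      linarith
    set G : ℂ → ℝ := fun z => regPotential (2 * ρ) (μ.restrict K) z +
      (truncPotential (2 * ρ) (μ.restrict K) z).toReal with hG
    have hGreg : ∀ s, 0 < s → s ≤ 2 * ρ → ∀ z, (∀ w ∈ K, s ≤ ‖z - w‖) →
        G z = regPotential s (μ.restrict K) z := by
      intro s hs hsρ z hz
      rw [hG]
      dsimp only
      rw [regPotential_add_truncPotential hKres hs hsρ (hfin z),
        truncPotential_eq_zero hs (hKmem.mono hz)]
      simp
    have hGD : ∀ z ∈ Metric.closedBall (0 : ℂ) ρ, G z =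
        (truncPotential (2 * ρ) (μ.restrict K) z).toReal - Real.log (2 * ρ) * m := by
      intro z hz
      rw [hG]
      dsimp only
      rw [regPotential_two_mul hKres hz]
      ring
    have hregD : ∀ z ∈ Metric.closedBall (0 : ℂ) ρ, truncPotential (2 * ρ) τ z ≠ ⊤ →
        regPotential δ τ z = (truncPotential (2 * ρ) τ z).toReal -
          Real.log (2 * ρ) * τ.real Set.univ - (truncPotential δ τ z).toReal := by
      intro z hz hzf
      have := regPotential_add_truncPotential hτD hδ hδρ hzf
      rw [regPotential_two_mul hτD hz] at this
      linarith
    set u : ℂ → ℝ := fun z => G z + q z - regPotential δ τ z with hu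
    have hucont : Continuous u :=
      (hcont.add hq.continuous).sub (continuous_regPotential hτD hδ)
    obtain ⟨C, hC⟩ := hq.growth
    have hutop : Tendsto u (cocompact ℂ) atBot := by
      -- The coefficient of the logarithm is negative because `m` still exceeds `g` plus the mass of
      -- `τ`.
      refine tendsto_atBot_of_growth (ρ := 2 * ρ) (a := g + τ.real Set.univ - m)
        (C := C + Real.log 2 * m + Real.log 2 * τ.real Set.univ) (by linarith) fun z hz => ?_
      have hz2 : 2 * ρ ≤ ‖z‖ := by linarith
      have h1 := hC z hz2
      have h2 := hGreg ρ hρ (by linarith) z fun w hw => by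
        have := hKD hw
        rw [mem_closedBall_zero_iff] at this
        linarith [norm_sub_norm_le z w]
      have h3 := regPotential_le_of_norm_ge hKres hρ hρ hz2
      have h4 := le_regPotential_of_norm_ge hτD hρ hδ hδρ hz2
      simp only [hu]
      rw [h2]
      linarith
    have huK : ∀ z ∈ K, u z ≤ c + Real.log (2 * ρ) * (τ.real Set.univ - m) + ε := by
      intro z hz
      obtain ⟨⟨hz1, hz2⟩, hz3⟩ := hKh z hz
      have h1 : (truncPotential (2 * ρ) (μ.restrict K) z).toReal ≤
          (truncPotential (2 * ρ) μ z).toReal :=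
        ENNReal.toReal_mono hz1 (truncPotential_mono_measure _ Measure.restrict_le_self z)
      have h2 : (truncPotential δ τ z).toReal ≤ ε :=
        ENNReal.toReal_le_of_le_ofReal hε.le (hδK z hz).2
      simp only [hu]
      rw [hGD z (hKD hz), hregD z (hKD hz) hz3]
      linarith
    have hsub : ∀ p ∉ K, (∃ r > 0, u p ≤ Real.circleAverage u p r) ∨
        ∃ p₁ p₂, 2 * u p < u p₁ + u p₂ := by
      intro p hp
      obtain ⟨s₀, hs₀, hs₀K⟩ : ∃ s₀ > 0, ∀ w ∈ K, s₀ ≤ ‖p - w‖ := by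
        obtain ⟨s₀, hs₀, hsub⟩ := Metric.isOpen_iff.1 hK.isClosed.isOpen_compl p hp
        refine ⟨s₀, hs₀, fun w hw => ?_⟩
        by_contra! hlt
        refine hsub ?_ hw
        rw [Metric.mem_ball, dist_comm, dist_eq_norm]
        exact hlt
      -- Half of the distance to `K`, so that points within `s` of `p` stay `s` away from `K` and
      -- the potential there agrees with its regularization at scale `s`.
      set s := min (s₀ / 2) (2 * ρ) with hs
      have hspos : 0 < s := by positivity
      have hs1 : 2 * s ≤ s₀ := by linarith [min_le_left (s₀ / 2) (2 * ρ)]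
      have hs2 : s ≤ 2 * ρ := min_le_right _ _
      have hGp : ∀ x, ‖x - p‖ ≤ s → G x = regPotential s (μ.restrict K) x := by
        intro x hx
        refine hGreg s hspos hs2 x fun w hw => ?_
        have h1 := hs₀K w hw
        have h2 : ‖p - w‖ ≤ ‖x - w‖ + ‖x - p‖ := by
          have := norm_sub_le (x - w) (x - p)
          simpa only [sub_sub_sub_cancel_left] using this
        linarith
      by_cases hpρ : ‖p‖ = ρ
      · right
        obtain ⟨n, hn, a', ha', hev⟩ := hq.kink p hpρ
        -- The constant `B` collects the quadratic errors of both potentials; for `ε' < a' / (B +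
        -- 1)` the kink of `q` dominates them.
        set B := 1 / s ^ 2 * m + 2 / δ ^ 2 * τ.real Set.univ with hB
        have hB0 : 0 ≤ B := by positivity
        have hsmall : ∀ᶠ ε' : ℝ in 𝓝[>] 0, 0 < ε' ∧ ε' < min (min s (δ / 2)) (a' / (B + 1)) := by
          exact Ioo_mem_nhdsGT (by positivity)
        obtain ⟨ε', hε', hε'0, hε'1⟩ := (hev.and hsmall).exists
        have e1 : ε' ≤ s := hε'1.le.trans ((min_le_left _ _).trans (min_le_left _ _))
        have e2 : ε' ≤ δ / 2 := hε'1.le.trans ((min_le_left _ _).trans (min_le_right _ _))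
        have e3 : ε' * (B + 1) < a' := (lt_div_iff₀ (by positivity)).1
          (hε'1.trans_le (min_le_right _ _))
        have hnorm : ‖(ε' : ℂ) * n‖ = ε' := by
          rw [norm_mul, hn, mul_one, Complex.norm_real, Real.norm_of_nonneg hε'0.le]
        refine ⟨p + ε' * n, p - ε' * n, ?_⟩
        have h1 := le_regPotential_add hKres hspos p (ε' * n) (by rw [hnorm]; exact e1)
          (hKmem.mono fun w hw => hs1.trans (hs₀K w hw))
        have h2 := regPotential_add_le hτD hδ p (ε' * n) (by rw [hnorm]; exact e2)
        rw [hnorm] at h1 h2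
        simp only [hu]
        rw [hGp p (by simpa using hspos.le), hGp (p + ε' * n) (by rwa [add_sub_cancel_left, hnorm]),
          hGp (p - ε' * n) (by rwa [sub_sub_cancel_left, norm_neg, hnorm])]
        have h3 : ε' ^ 2 / s ^ 2 * m + 2 * ε' ^ 2 / δ ^ 2 * τ.real Set.univ < a' * ε' := by
          calc _ = ε' * (ε' * B) := by rw [hB]; ring
            _ < ε' * a' := by
              refine mul_lt_mul_of_pos_left ?_ hε'0
              nlinarith
            _ = _ := mul_comm _ _
        linarith
      · left
        obtain ⟨r₀, hr₀, hq'⟩ := hq.le_circleAverage p hpρ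
        obtain ⟨r, hr, hr1⟩ := exists_between (lt_min hr₀ hspos)
        refine ⟨r, hr, ?_⟩
        have c1 : CircleIntegrable G p r := hcont.continuousOn.circleIntegrable hr.le
        have c2 : CircleIntegrable q p r := hq.continuous.continuousOn.circleIntegrable hr.le
        have c3 : CircleIntegrable (regPotential δ τ) p r :=
          (continuous_regPotential hτD hδ).continuousOn.circleIntegrable hr.le
        -- Away from the circle all three terms of `u` behave well: the potential `G` is harmonic
        -- off `K`, while `q` and `-regPotential δ τ` satisfy the sub-mean value inequality.
        have h1 : Real.circleAverage G p r = G p := by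
          rw [hGp p (by simpa using hspos.le), ← circleAverage_regPotential_eq hKres hspos p hr
            (hKmem.mono fun w hw => ?_)]
          · refine Real.circleAverage_congr_sphere fun x hx => hGp x ?_
            rw [abs_of_pos hr, mem_sphere_iff_norm] at hx
            rw [hx]
            exact (hr1.trans_le (min_le_right _ _)).le
          · linarith [hs₀K w hw, hr1.trans_le (min_le_right r₀ s)]
        have h2 := hq' r hr (hr1.trans_le (min_le_left _ _))
        have h3 := circleAverage_regPotential_le hτD hδ p hr
        have h4 : Real.circleAverage u p r = Real.circleAverage G p r + Real.circleAverage q p r -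
            Real.circleAverage (regPotential δ τ) p r := by
          rw [← Real.circleAverage_add c1 c2, ← Real.circleAverage_sub (c1.add c2) c3]
          rfl
        rw [h4, h1]
        simp only [hu]
        linarith
    have hfinal := le_of_submean hucont hutop huK hsub z₀
    -- The discarded charge has mass at most `ε` and lies at distance at least `d` from `z₀`.
    have hloss : (truncPotential (2 * ρ) μ z₀).toReal ≤
        (truncPotential (2 * ρ) (μ.restrict K) z₀).toReal +
          ε * max 0 (Real.log (2 * ρ / d)) := by
      have h1 : truncPotential (2 * ρ) μ z₀ = truncPotential (2 * ρ) (μ.restrict K) z₀ +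
          ∫⁻ w in Kᶜ, truncKernel (2 * ρ) z₀ w ∂μ :=
        (lintegral_add_compl _ hK.measurableSet).symm
      have h2 : ∫⁻ w in Kᶜ, truncKernel (2 * ρ) z₀ w ∂μ ≤
          ENNReal.ofReal (ε * max 0 (Real.log (2 * ρ / d))) := by
        calc _ ≤ ∫⁻ _ in Kᶜ, ENNReal.ofReal (max 0 (Real.log (2 * ρ / d))) ∂μ := by
              have hae : ∀ᵐ w ∂μ, w ∉ Metric.ball z₀ d := measure_eq_zero_iff_ae_notMem.1 hdμ
              refine lintegral_mono_ae (ae_restrict_of_ae ?_)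
              filter_upwards [hae] with w hw
              have hw' : d ≤ ‖z₀ - w‖ := by
                rw [Metric.mem_ball, dist_comm, dist_eq_norm] at hw
                exact not_lt.1 hw
              rw [truncKernel_of_ne (by positivity)
                (sub_ne_zero.1 (norm_pos_iff.1 (hd.trans_le hw')))]
              refine ENNReal.ofReal_le_ofReal (le_max_of_le_right ?_)
              refine Real.log_le_log (div_pos (by positivity) (hd.trans_le hw')) ?_
              gcongr
          _ = ENNReal.ofReal (max 0 (Real.log (2 * ρ / d))) * μ Kᶜ := by
              rw [setLIntegral_const]
          _ ≤ ENNReal.ofReal (max 0 (Real.log (2 * ρ / d))) * ENNReal.ofReal ε := by gcongr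
          _ = _ := by rw [← ENNReal.ofReal_mul (by positivity), mul_comm]
      rw [h1]
      refine (ENNReal.toReal_mono (ENNReal.add_ne_top.2 ⟨hfin z₀, ENNReal.ofReal_ne_top⟩)
        (add_le_add le_rfl h2)).trans ?_
      rw [ENNReal.toReal_add (hfin z₀) ENNReal.ofReal_ne_top,
        ENNReal.toReal_ofReal (by positivity)]
    simp only [hu] at hfinal
    rw [hGD z₀ hz₀, hregD z₀ hz₀ hτz₀] at hfinal
    have h5 := ENNReal.toReal_nonneg (a := truncPotential δ τ z₀)
    linarith
  refine le_of_forall_pos_le_add fun η hη => ?_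
  set B := 1 + max 0 (Real.log (2 * ρ / d)) with hB
  have hB0 : 0 < B := by positivity
  have h1 := key (min (a / 2) (η / B)) (by positivity)
    ((min_le_left _ _).trans_lt (by linarith))
  have h2 : min (a / 2) (η / B) * B ≤ η := by
    calc _ ≤ η / B * B := by gcongr; exact min_le_right _ _
      _ = η := by field_simp
  linarith

/-! ### Subharmonic extension by reflection -/

/-- The extension of a function from a disk to the plane by reflection in the boundary circle,
with an additional logarithm outside the disk. -/
noncomputable def reflectExtend (ρ g : ℝ) (R : ℂ → ℝ) (z : ℂ) : ℝ :=
  open Classical in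
  if ‖z‖ ≤ ρ then R z else
    R ((ρ : ℂ) ^ 2 / (starRingEnd ℂ) z) + g * (Real.log ‖z‖ - Real.log ρ)

section

variable {ρ g : ℝ} {R : ℂ → ℝ} (hρ : 0 < ρ)

theorem norm_reflect {z : ℂ} : ‖(ρ : ℂ) ^ 2 / (starRingEnd ℂ) z‖ = ρ ^ 2 / ‖z‖ := by
  simp

theorem reflectExtend_of_le {z : ℂ} (hz : ‖z‖ ≤ ρ) : reflectExtend ρ g R z = R z := by
  rw [reflectExtend, if_pos hz]

theorem reflectExtend_of_lt {z : ℂ} (hz : ρ < ‖z‖) : reflectExtend ρ g R z =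
    R ((ρ : ℂ) ^ 2 / (starRingEnd ℂ) z) + g * (Real.log ‖z‖ - Real.log ρ) := by
  rw [reflectExtend, if_neg (not_le.2 hz)]

theorem norm_reflect_le (hρ : 0 < ρ) {z : ℂ} (hz : ρ ≤ ‖z‖) :
    ‖(ρ : ℂ) ^ 2 / (starRingEnd ℂ) z‖ ≤ ρ := by
  rw [norm_reflect, div_le_iff₀ (hρ.trans_le hz)]
  nlinarith

theorem norm_reflect_lt (hρ : 0 < ρ) {z : ℂ} (hz : ρ < ‖z‖) :
    ‖(ρ : ℂ) ^ 2 / (starRingEnd ℂ) z‖ < ρ := by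
  rw [norm_reflect, div_lt_iff₀ (hρ.trans hz)]
  nlinarith

theorem continuous_reflectExtend (hρ : 0 < ρ) (hR : ContinuousOn R (Metric.closedBall (0 : ℂ) ρ)) :
    Continuous (reflectExtend ρ g R) := by
  unfold reflectExtend
  refine continuous_if_le continuous_norm continuous_const (hR.mono fun z hz => ?_) ?_ ?_
  · simpa using hz
  · have hne : ∀ z ∈ {z : ℂ | ρ ≤ ‖z‖}, z ≠ 0 := fun z hz => norm_pos_iff.1 (hρ.trans_le hz)
    refine ContinuousOn.add (hR.comp ?_ fun z hz => ?_) ?_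
    · refine continuousOn_const.div Complex.continuous_conj.continuousOn fun z hz => ?_
      simpa using hne z hz
    · rw [mem_closedBall_zero_iff]
      exact norm_reflect_le hρ hz
    · refine continuousOn_const.mul (ContinuousOn.sub ?_ continuousOn_const)
      exact continuous_norm.continuousOn.log fun z hz => norm_ne_zero_iff.2 (hne z hz)
  · intro z hz
    have hne : z ≠ 0 := norm_pos_iff.1 (hz ▸ hρ)
    have : (ρ : ℂ) ^ 2 / (starRingEnd ℂ) z = z := by
      rw [div_eq_iff (by simpa using hne), Complex.mul_conj, Complex.normSq_eq_norm_sq, hz]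
      push_cast; rfl
    rw [this, hz]
    ring

/-- With `R = Re F` for a holomorphic `F`, the reflected function is the real part of the conjugate
of `F` at the conjugate of $\rho^2/z$, which is again holomorphic. -/
theorem harmonicOnNhd_reflect (hρ : 0 < ρ)
    (hR : InnerProductSpace.HarmonicOnNhd R (Metric.ball (0 : ℂ) ρ)) :
    InnerProductSpace.HarmonicOnNhd (fun z => R ((ρ : ℂ) ^ 2 / (starRingEnd ℂ) z) +
      g * (Real.log ‖z‖ - Real.log ρ)) {z : ℂ | ρ < ‖z‖} := by
  obtain ⟨F, hF, hFR⟩ := hR.exists_analyticOnNhd_ball_re_eq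
  have hopen : IsOpen {z : ℂ | ρ < ‖z‖} := isOpen_lt continuous_const continuous_norm
  intro z hz
  have hz' : ρ < ‖z‖ := hz
  have hne : z ≠ 0 := norm_pos_iff.1 (hρ.trans hz')
  have hlog : InnerProductSpace.HarmonicAt (fun z : ℂ => Real.log ‖z‖) z :=
    analyticAt_id.harmonicAt_log_norm hne
  have h2 : InnerProductSpace.HarmonicAt (fun z : ℂ => g * (Real.log ‖z‖ - Real.log ρ)) z :=
    (hlog.sub (InnerProductSpace.harmonicAt_const _)).const_smul
  refine InnerProductSpace.HarmonicAt.add ?_ h2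
  set S : ℂ → ℂ := fun z => (starRingEnd ℂ) (F ((starRingEnd ℂ) ((ρ : ℂ) ^ 2 / z))) with hS
  have hSa : AnalyticAt ℂ S z := by
    refine DifferentiableOn.analyticAt (s := {z : ℂ | ρ < ‖z‖}) (fun y hy => ?_) (hopen.mem_nhds hz)
    have hy' : ρ < ‖y‖ := hy
    have hy0 : y ≠ 0 := norm_pos_iff.1 (hρ.trans hy')
    have hmem : (starRingEnd ℂ) ((ρ : ℂ) ^ 2 / y) ∈ Metric.ball (0 : ℂ) ρ := by
      rw [mem_ball_zero_iff, map_div₀, map_pow, Complex.conj_ofReal]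
      exact norm_reflect_lt hρ hy'
    have hd : DifferentiableAt ℂ (fun x => (starRingEnd ℂ) (F ((starRingEnd ℂ) x)))
        ((ρ : ℂ) ^ 2 / y) := by
      have := (hF _ hmem).differentiableAt.conj_conj
      simpa [Function.comp_def] using this
    have hd2 : DifferentiableAt ℂ (fun x : ℂ => (ρ : ℂ) ^ 2 / x) y :=
      (differentiableAt_const _).div differentiableAt_id hy0
    exact (hd.comp y hd2).differentiableWithinAt
  refine (InnerProductSpace.harmonicAt_congr_nhds ?_).1 hSa.harmonicAt_re
  filter_upwards [hopen.mem_nhds hz] with y hy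
  have hmem : (ρ : ℂ) ^ 2 / (starRingEnd ℂ) y ∈ Metric.ball (0 : ℂ) ρ := by
    rw [mem_ball_zero_iff]
    exact norm_reflect_lt hρ hy
  rw [← hFR hmem]
  simp [hS]

/-- Reflection reverses the normal derivative and the logarithm `2 * C * ρ * log (‖z‖ / ρ)` has
slope `2 * C` on the circle. The outer slope minus the inner one is then $2(C-\partial_n^-R)>0$, a
convex kink. -/
theorem isKinkedSubharmonic_reflectExtend {C₁ C : ℝ} (hρ : 0 < ρ) (hC : C₁ < C) (hC0 : 0 ≤ C)
    (hRc : ContinuousOn R (Metric.closedBall (0 : ℂ) ρ))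
    (hR : InnerProductSpace.HarmonicOnNhd R (Metric.ball (0 : ℂ) ρ)) {dR : ℂ → ℝ}
    (hdR : ∀ z ∈ Metric.sphere (0 : ℂ) ρ, HasInnerNormalDeriv R z (dR z))
    (hdRC : ∀ z ∈ Metric.sphere (0 : ℂ) ρ, dR z ≤ C₁) :
    IsKinkedSubharmonic ρ (2 * C * ρ) (reflectExtend ρ (2 * C * ρ) R) := by
  refine ⟨continuous_reflectExtend hρ hRc, fun p hp => ?_, fun p hp => ?_, ?_⟩
  · rcases lt_or_gt_of_ne hp with hlt | hgt
    · refine ⟨ρ - ‖p‖, by linarith, fun r hr hr1 => ?_⟩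
      have hsub : Metric.closedBall p |r| ⊆ Metric.ball 0 ρ := by
        rw [abs_of_pos hr]
        refine Metric.closedBall_subset_ball' ?_
        rw [dist_zero_right]; linarith
      have h1 := (hR.mono hsub).circleAverage_eq
      rw [reflectExtend_of_le hlt.le, ← h1]
      refine (Real.circleAverage_congr_sphere fun x hx => ?_).le
      have := hsub (Metric.sphere_subset_closedBall hx)
      rw [mem_ball_zero_iff] at this
      exact (reflectExtend_of_le this.le).symm
    · refine ⟨‖p‖ - ρ, by linarith, fun r hr hr1 => ?_⟩
      have hsub : Metric.closedBall p |r| ⊆ {z : ℂ | ρ < ‖z‖} := by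
        intro x hx
        rw [abs_of_pos hr, mem_closedBall_iff_norm] at hx
        have h3 := norm_sub_norm_le p x
        rw [norm_sub_rev] at h3
        simp only [Set.mem_ofPred_eq]
        linarith
      have h1 := ((harmonicOnNhd_reflect (g := 2 * C * ρ) hρ hR).mono hsub).circleAverage_eq
      rw [reflectExtend_of_lt hgt, ← h1]
      refine (Real.circleAverage_congr_sphere fun x hx => ?_).le
      exact (reflectExtend_of_lt (hsub (Metric.sphere_subset_closedBall hx))).symm
  · have hps : p ∈ Metric.sphere (0 : ℂ) ρ := by simpa using hp
    set n : ℂ := p / (‖p‖ : ℂ) with hn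
    have hρ' : (ρ : ℂ) ≠ 0 := by exact_mod_cast hρ.ne'
    have hn1 : ‖n‖ = 1 := by
      rw [hn, norm_div, Complex.norm_real, Real.norm_of_nonneg (norm_nonneg _), hp,
        div_self hρ.ne']
    have hpn : p = ρ * n := by
      rw [hn, hp, mul_div_cancel₀ _ hρ']
    -- A slope strictly between the normal derivative and `C` absorbs the error of the difference
    -- quotient and still leaves a kink of size `a`.
    set C₂ := (C₁ + C) / 2 with hC₂
    set a := C - C₂ with ha
    have ha0 : 0 < a := by rw [ha, hC₂]; linarith
    have hd := hdR p hps
    rw [HasInnerNormalDeriv] at hd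
    have hev := hd.eventually (gt_mem_nhds (show dR p < C₂ by
      rw [hC₂]; linarith [hdRC p hps]))
    obtain ⟨ε₀, hε₀, hsub⟩ := mem_nhdsGT_iff_exists_Ioo_subset.1 hev
    have hε₀' : 0 < ε₀ := hε₀
    have hlow : ∀ ε : ℝ, 0 < ε → ε < ε₀ → R p - C₂ * ε ≤ R (p - ε * n) := by
      intro ε h0 h1
      have h2 : (R p - R (p - ε * n)) / ε < C₂ := hsub ⟨h0, h1⟩
      rw [div_lt_iff₀ h0] at h2
      linarith
    refine ⟨n, hn1, a, ha0, ?_⟩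
    have hI : Set.Ioo 0 (min (min ε₀ ρ) (a * ρ / (C + 1))) ∈ 𝓝[>] (0 : ℝ) :=
      Ioo_mem_nhdsGT (by positivity)
    filter_upwards [hI] with ε hε
    obtain ⟨h0, h1⟩ := hε
    have e1 : ε < ε₀ := h1.trans_le ((min_le_left _ _).trans (min_le_left _ _))
    have e2 : ε < ρ := h1.trans_le ((min_le_left _ _).trans (min_le_right _ _))
    have e3 : ε * (C + 1) < a * ρ :=
      (lt_div_iff₀ (by positivity)).1 (h1.trans_le (min_le_right _ _))
    have hplus : p + ε * n = ((ρ + ε : ℝ) : ℂ) * n := by rw [hpn]; push_cast; ring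
    have hminus : p - ε * n = ((ρ - ε : ℝ) : ℂ) * n := by rw [hpn]; push_cast; ring
    have nplus : ‖p + ε * n‖ = ρ + ε := by
      rw [hplus, norm_mul, hn1, mul_one, Complex.norm_real, Real.norm_of_nonneg (by linarith)]
    have nminus : ‖p - ε * n‖ = ρ - ε := by
      rw [hminus, norm_mul, hn1, mul_one, Complex.norm_real, Real.norm_of_nonneg (by linarith)]
    -- The reflection of radius `ρ + ε` is $\rho^2/(\rho+\varepsilon)=\rho-\varepsilon'$.
    set ε' := ρ * ε / (ρ + ε) with hε'
    have hε'0 : 0 < ε' := by positivity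
    have hε'le : ε' ≤ ε := by
      rw [hε', div_le_iff₀ (by positivity)]; nlinarith
    have hrefl : (ρ : ℂ) ^ 2 / (starRingEnd ℂ) (p + ε * n) = p - ε' * n := by
      have hnn : n * (starRingEnd ℂ) n = 1 := by
        rw [Complex.mul_conj, Complex.normSq_eq_norm_sq, hn1]; simp
      have hn0 : (starRingEnd ℂ) n ≠ 0 := right_ne_zero_of_mul_eq_one hnn
      have hρε : ((ρ : ℂ) + ε) ≠ 0 := by exact_mod_cast (by positivity : ρ + ε ≠ 0)
      rw [hplus, map_mul, Complex.conj_ofReal, div_eq_iff (mul_ne_zero (by exact_mod_cast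
        (by positivity : ρ + ε ≠ 0)) hn0), hpn, hε']
      push_cast
      calc (ρ : ℂ) ^ 2 = ρ ^ 2 * (n * (starRingEnd ℂ) n) := by rw [hnn, mul_one]
        _ = _ := by field_simp; ring
    rw [reflectExtend_of_le hp.le, reflectExtend_of_lt (by rw [nplus]; linarith),
      reflectExtend_of_le (by rw [nminus]; linarith), hrefl, nplus]
    have l1 := hlow ε h0 e1
    have l2 := hlow ε' hε'0 (hε'le.trans_lt e1)
    have l3 : ε' / ρ ≤ Real.log (ρ + ε) - Real.log ρ := by
      rw [← Real.log_div (by positivity) hρ.ne']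
      have := Real.one_sub_inv_le_log_of_pos (show 0 < (ρ + ε) / ρ by positivity)
      refine le_trans (le_of_eq ?_) this
      rw [hε']
      field_simp
      ring
    have l4 : 2 * C * ε' ≤ 2 * C * ρ * (Real.log (ρ + ε) - Real.log ρ) := by
      calc 2 * C * ε' = 2 * C * ρ * (ε' / ρ) := by field_simp
        _ ≤ _ := by gcongr
    -- This reduces to `C * ε ≤ a * ρ`, the reason for the restriction `ε < a * ρ / (C + 1)`.
    have l5 : C * ε ≤ (C + a) * ε' := by
      rw [hε', mul_div_assoc', le_div_iff₀ (by positivity)]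
      have : C * (ρ + ε) ≤ (C + a) * ρ := by nlinarith
      nlinarith
    have l6 : (C + a) = 2 * C - C₂ := by rw [ha]; ring
    rw [l6] at l5
    have l7 : a * ε = C * ε - C₂ * ε := by rw [ha]; ring
    nlinarith
  · obtain ⟨B, hB⟩ := ((isCompact_closedBall (0 : ℂ) ρ).image_of_continuousOn hRc).bddAbove
    refine ⟨B - 2 * C * ρ * Real.log ρ, fun z hz => ?_⟩
    have hz' : ρ < ‖z‖ := by linarith
    rw [reflectExtend_of_lt hz']
    have := hB (Set.mem_image_of_mem R (show (ρ : ℂ) ^ 2 / (starRingEnd ℂ) z ∈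
      Metric.closedBall (0 : ℂ) ρ by
        rw [mem_closedBall_zero_iff]; exact norm_reflect_le hρ hz'.le))
    linarith

end

/-! ### From the Laplacian to a lower bound on the density -/

theorem setLIntegral_Ioo_circleMap (c : ℝ) (f : ℂ → ℝ≥0∞) :
    ∫⁻ θ in Set.Ioo (-Real.pi) Real.pi, f (circleMap 0 c θ) =
      ∫⁻ θ in Set.Ioc 0 (2 * Real.pi), f (circleMap 0 c θ) := by
  rw [setLIntegral_congr (Ioo_ae_eq_Ioc (μ := volume))]
  have hT : 0 < 2 * Real.pi := Real.two_pi_pos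
  have h1 := isAddFundamentalDomain_Ioc hT (-Real.pi) volume
  have h2 := isAddFundamentalDomain_Ioc hT 0 volume
  have e1 : -Real.pi + 2 * Real.pi = Real.pi := by ring
  rw [e1] at h1
  rw [zero_add] at h2
  refine h1.setLIntegral_eq h2 _ fun g x => ?_
  obtain ⟨g, k, rfl⟩ := g
  have := ((periodic_circleMap 0 c).int_mul k) x
  simp only [AddSubgroup.vadd_def, vadd_eq_add, zsmul_eq_mul]
  rw [add_comm, this]

/-- Integration in polar coordinates, in terms of the uniform measures on circles. -/
theorem lintegral_eq_lintegral_circleMeasure {f : ℂ → ℝ≥0∞} (hf : Measurable f) :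
    ∫⁻ z, f z = ∫⁻ c in Set.Ioi (0 : ℝ), ENNReal.ofReal (2 * Real.pi * c) *
      ∫⁻ z, f z ∂circleMeasure 0 c := by
  have hcm : Measurable fun p : ℝ × ℝ => circleMap 0 p.1 p.2 := by
    unfold circleMap; fun_prop
  rw [← Complex.lintegral_comp_polarCoord_symm, polarCoord_target, Measure.volume_eq_prod,
    ← Measure.prod_restrict]
  have e : ∀ p : ℝ × ℝ, Complex.polarCoord.symm p = circleMap 0 p.1 p.2 := fun p => by
    rw [Complex.polarCoord_symm_apply, circleMap, Complex.exp_mul_I]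
    simp
  simp_rw [e]
  rw [lintegral_prod]
  · refine setLIntegral_congr_fun measurableSet_Ioi fun c hc => ?_
    simp only [smul_eq_mul]
    rw [lintegral_const_mul, setLIntegral_Ioo_circleMap, lintegral_circleMeasure _ _ hf, ← mul_assoc,
      ← ENNReal.ofReal_mul (mul_nonneg Real.two_pi_pos.le (Set.mem_Ioi.1 hc).le)]
    · congr 2
      field_simp
    · exact hf.comp (continuous_circleMap 0 c).measurable
  · exact ((measurable_fst.ennreal_ofReal).mul (hf.comp hcm)).aemeasurable

theorem integral_mul_log_sub {r : ℝ} (hr : 0 < r) :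
    IntervalIntegrable (fun c => 2 * Real.pi * c * (Real.log r - Real.log c)) volume 0 r ∧
    ∫ c in 0..r, 2 * Real.pi * c * (Real.log r - Real.log c) = Real.pi * r ^ 2 / 2 := by
  have hcl := Real.continuous_mul_log
  have e1 : (fun c => 2 * Real.pi * c * (Real.log r - Real.log c)) =
      fun c => 2 * Real.pi * Real.log r * c - 2 * Real.pi * (c * Real.log c) := by
    ext c; ring
  have hint : IntervalIntegrable (fun c => 2 * Real.pi * c * (Real.log r - Real.log c)) volume 0 r := by
    rw [e1]
    exact Continuous.intervalIntegrable (by fun_prop) _ _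
  refine ⟨hint, ?_⟩
  have hc : Continuous fun c : ℝ => Real.pi * Real.log r * c ^ 2 - Real.pi * c * (c * Real.log c) +
      Real.pi * c ^ 2 / 2 := by fun_prop
  rw [intervalIntegral.integral_eq_sub_of_hasDerivAt_of_le hr.le hc.continuousOn _ hint]
  · ring
  · intro x hx
    have h := (((hasDerivAt_pow 2 x).const_mul (Real.pi * Real.log r)).sub
      (((hasDerivAt_id x).const_mul Real.pi).mul
        ((hasDerivAt_id x).mul (Real.hasDerivAt_log hx.1.ne')))).add
      (((hasDerivAt_pow 2 x).const_mul Real.pi).div_const 2)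
    refine h.congr_deriv ?_
    have := hx.1.ne'
    simp
    field_simp
    ring

/-- This area integral normalizes the truncated kernel as an approximate identity when `r` tends to
zero. -/
theorem lintegral_truncKernel {r : ℝ} (hr : 0 < r) (w : ℂ) :
    ∫⁻ z, truncKernel r z w = ENNReal.ofReal (Real.pi * r ^ 2 / 2) := by
  have e : ∀ z, truncKernel r z w = truncKernel r (z - w) 0 := fun z => by
    simp [truncKernel, edist_dist, dist_eq_norm]
  simp_rw [e]
  rw [lintegral_sub_right_eq_self (fun z => truncKernel r z 0) w,
    lintegral_eq_lintegral_circleMeasure (continuous_truncKernel_left r 0).measurable]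
  have h1 : ∀ c ∈ Set.Ioi (0 : ℝ), ENNReal.ofReal (2 * Real.pi * c) *
      ∫⁻ z, truncKernel r z 0 ∂circleMeasure 0 c =
      (Set.Ioc 0 r).indicator
        (fun c => ENNReal.ofReal (2 * Real.pi * c * (Real.log r - Real.log c))) c := by
    intro c hc
    have hc' : 0 < c := hc
    have h2 : ∫⁻ z, truncKernel r z 0 ∂circleMeasure 0 c =
        ENNReal.ofReal (Real.log r - Real.log c) := by
      calc _ = ∫⁻ _, ENNReal.ofReal (Real.log r - Real.log c) ∂circleMeasure 0 c := by
            refine lintegral_congr_ae ?_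
            filter_upwards [ae_circleMeasure_mem_sphere 0 hc'.le] with z hz
            rw [mem_sphere_zero_iff_norm] at hz
            rw [truncKernel_of_ne hr (norm_pos_iff.1 (hz ▸ hc')), sub_zero, hz,
              Real.log_div hr.ne' hc'.ne']
        _ = _ := by simp
    rw [h2]
    by_cases hcr : c ≤ r
    · rw [Set.indicator_of_mem (show c ∈ Set.Ioc 0 r from ⟨hc', hcr⟩), ← ENNReal.ofReal_mul (by positivity)]
    · rw [Set.indicator_of_notMem fun h => hcr h.2, ENNReal.ofReal_of_nonpos (p := _ - _), mul_zero]
      exact sub_nonpos.2 (Real.log_le_log hr (not_le.1 hcr).le)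
  rw [setLIntegral_congr_fun measurableSet_Ioi h1, lintegral_indicator measurableSet_Ioc,
    Measure.restrict_restrict measurableSet_Ioc,
    Set.inter_eq_left.2 (show Set.Ioc 0 r ⊆ Set.Ioi 0 from Set.Ioc_subset_Ioi_self)]
  obtain ⟨h2, h3⟩ := integral_mul_log_sub hr
  rw [← ofReal_integral_eq_lintegral_ofReal, ← intervalIntegral.integral_of_le hr.le, h3]
  · exact (intervalIntegrable_iff_integrableOn_Ioc_of_le hr.le).1 h2
  · refine (ae_restrict_iff' measurableSet_Ioc).2 (Eventually.of_forall fun c hc => ?_)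
    have := hc.1
    exact mul_nonneg (by positivity) (sub_nonneg.2 (Real.log_le_log hc.1 hc.2))

/-- The mean value inequality is applied to the Taylor remainder along the segment, so an expansion
of the derivative at the single point `z` suffices and no continuity of second derivatives enters.
-/
theorem norm_sub_taylor_two_le {g : ℂ → ℝ} {z h : ℂ} {ε : ℝ} {A : ℂ →L[ℝ] ℂ →L[ℝ] ℝ}
    (hg : ∀ s ∈ Set.Icc (0 : ℝ) 1, DifferentiableAt ℝ g (z + s • h))
    (hA : ∀ s ∈ Set.Icc (0 : ℝ) 1,
      ‖fderiv ℝ g (z + s • h) - fderiv ℝ g z - A (s • h)‖ ≤ ε * ‖h‖) :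
    ‖g (z + h) - g z - (fderiv ℝ g z h + 1 / 2 * A h h)‖ ≤ ε * ‖h‖ ^ 2 := by
  have hφ : ∀ s ∈ Set.Icc (0 : ℝ) 1, HasDerivWithinAt
      (fun s : ℝ => g (z + s • h) - (s * fderiv ℝ g z h + s ^ 2 / 2 * A h h))
      ((fderiv ℝ g (z + s • h) - fderiv ℝ g z - A (s • h)) h) (Set.Icc 0 1) s := by
    intro s hs
    have h1 : HasDerivAt (fun s : ℝ => z + s • h) h s := by
      simpa using ((hasDerivAt_id s).smul_const h).const_add z
    have h2 := (hg s hs).hasFDerivAt.comp_hasDerivAt s h1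
    have h3 := h2.sub (((hasDerivAt_id s).mul_const (fderiv ℝ g z h)).add
      (((hasDerivAt_pow 2 s).div_const 2).mul_const (A h h)))
    refine (h3.congr_deriv ?_).hasDerivWithinAt
    simp only [map_smul, sub_apply, smul_apply, smul_eq_mul]
    norm_num
    ring
  have := norm_image_sub_le_of_norm_deriv_le_segment_01' hφ (C := ε * ‖h‖ ^ 2) fun s hs => by
    refine (ContinuousLinearMap.le_opNorm _ _).trans ?_
    have := hA s ⟨hs.1, hs.2.le⟩
    calc _ ≤ ε * ‖h‖ * ‖h‖ := by gcongr
      _ = _ := by ring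
  rw [one_smul, zero_smul, add_zero] at this
  exact le_of_eq_of_le (congrArg norm (by ring)) this

theorem circleAverage_quadratic (L : ℂ →L[ℝ] ℝ) (A : ℂ →L[ℝ] ℂ →L[ℝ] ℝ) (z : ℂ) (r : ℝ) :
    Real.circleAverage (fun x => L (x - z) + 1 / 2 * A (x - z) (x - z)) z r =
      r ^ 2 / 4 * (A 1 1 + A Complex.I Complex.I) := by
  have e : ∀ θ : ℝ, circleMap z r θ - z = (r * Real.cos θ) • (1 : ℂ) + (r * Real.sin θ) • Complex.I := by
    intro θ
    simp only [circleMap, Complex.exp_mul_I, Complex.real_smul]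
    push_cast
    ring
  rw [Real.circleAverage_def]
  simp_rw [e]
  simp only [map_add, map_smul, add_apply, smul_apply,
    smul_eq_mul]
  have e2 : ∀ θ : ℝ, r * Real.cos θ * L 1 + r * Real.sin θ * L Complex.I +
      1 / 2 * (r * Real.cos θ * (r * Real.cos θ * A 1 1 + r * Real.sin θ * A 1 Complex.I) +
        r * Real.sin θ * (r * Real.cos θ * A Complex.I 1 + r * Real.sin θ * A Complex.I Complex.I)) =
      (r * L 1) * Real.cos θ + (r * L Complex.I) * Real.sin θ +
      (r ^ 2 / 2 * A 1 1) * Real.cos θ ^ 2 +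
      (r ^ 2 / 2 * (A 1 Complex.I + A Complex.I 1)) * (Real.sin θ * Real.cos θ) +
      (r ^ 2 / 2 * A Complex.I Complex.I) * Real.sin θ ^ 2 := fun θ => by ring
  have e3 : ∫ θ in 0..2 * Real.pi, ((r * L 1) * Real.cos θ + (r * L Complex.I) * Real.sin θ +
      (r ^ 2 / 2 * A 1 1) * Real.cos θ ^ 2 +
      (r ^ 2 / 2 * (A 1 Complex.I + A Complex.I 1)) * (Real.sin θ * Real.cos θ) +
      (r ^ 2 / 2 * A Complex.I Complex.I) * Real.sin θ ^ 2) =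
      r ^ 2 / 2 * (A 1 1 + A Complex.I Complex.I) * Real.pi := by
    rw [intervalIntegral.integral_add, intervalIntegral.integral_add, intervalIntegral.integral_add,
      intervalIntegral.integral_add]
    · simp only [intervalIntegral.integral_const_mul, integral_cos, integral_sin, integral_cos_sq,
        integral_sin_sq, integral_sin_mul_cos₁]
      simp
      ring
    all_goals exact Continuous.intervalIntegrable (by fun_prop) _ _
  calc _ = (2 * Real.pi)⁻¹ * (r ^ 2 / 2 * (A 1 1 + A Complex.I Complex.I) * Real.pi) := by
        rw [← e3]
        congr 1
        refine intervalIntegral.integral_congr fun θ _ => ?_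
        rw [← e2 θ]
        ring
    _ = _ := by
        have := Real.pi_ne_zero
        field_simp
        ring

/-- A lower bound for the circle averages of a twice differentiable function. -/
theorem eventually_le_circleAverage {g : ℂ → ℝ} {z : ℂ} {L : ℝ}
    (hg : ∀ᶠ x in 𝓝 z, DifferentiableAt ℝ g x) (hg2 : DifferentiableAt ℝ (fderiv ℝ g) z)
    (hL : L < Laplacian.laplacian g z) :
    ∀ᶠ r in 𝓝[>] (0 : ℝ), g z + r ^ 2 / 4 * L ≤ Real.circleAverage g z r := by
  set A := fderiv ℝ (fderiv ℝ g) z with hA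
  have hlap : Laplacian.laplacian g z = A 1 1 + A Complex.I Complex.I := by
    rw [InnerProductSpace.laplacian_eq_iteratedFDeriv_complexPlane]
    simp [iteratedFDeriv_two_apply, hA]
  -- The Taylor error `ε * r ^ 2` then uses up exactly the gap $\frac{r^2}{4}(\Delta g-L)$.
  set ε := (Laplacian.laplacian g z - L) / 4 with hε
  have hε0 : 0 < ε := by rw [hε]; linarith
  have h1 := (hasFDerivAt_iff_isLittleO_nhds_zero.1 hg2.hasFDerivAt).def hε0
  obtain ⟨δ, hδ, hsub⟩ := Metric.nhds_basis_ball.mem_iff.1 h1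
  obtain ⟨δ', hδ', hsub'⟩ := Metric.nhds_basis_ball.mem_iff.1 hg
  filter_upwards [Ioo_mem_nhdsGT (lt_min hδ hδ')] with r hr
  obtain ⟨hr0, hr1⟩ := hr
  have hbd : ∀ x ∈ Metric.sphere z |r|, (g z - ε * r ^ 2) + (fderiv ℝ g z (x - z) +
      1 / 2 * A (x - z) (x - z)) ≤ g x := by
    intro x hx
    rw [abs_of_pos hr0, mem_sphere_iff_norm] at hx
    have hs : ∀ s ∈ Set.Icc (0 : ℝ) 1, ‖s • (x - z)‖ ≤ r := fun s hs => by
      rw [norm_smul, Real.norm_of_nonneg hs.1, hx]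
      exact mul_le_of_le_one_left hr0.le hs.2
    have := norm_sub_taylor_two_le (g := g) (z := z) (h := x - z) (ε := ε) (A := A)
      (fun s hs' => hsub' (by
        rw [mem_ball_iff_norm, add_sub_cancel_left]
        exact (hs s hs').trans_lt (hr1.trans_le (min_le_right _ _))))
      (fun s hs' => by
        have h2 := hsub (show s • (x - z) ∈ Metric.ball 0 δ by
          rw [mem_ball_zero_iff]
          exact (hs s hs').trans_lt (hr1.trans_le (min_le_left _ _)))
        refine le_trans h2 ?_
        rw [hx]
        exact mul_le_mul_of_nonneg_left (hs s hs') hε0.le)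
    rw [hx, add_sub_cancel] at this
    have := (abs_le.1 this).1
    linarith
  have hcont : ContinuousOn g (Metric.sphere z |r|) := fun x hx => by
    rw [abs_of_pos hr0] at hx
    refine (hsub' ?_).continuousAt.continuousWithinAt
    rw [Metric.mem_ball, Metric.mem_sphere.1 hx]
    exact hr1.trans_le (min_le_right _ _)
  have hq : Continuous fun x : ℂ => fderiv ℝ g z (x - z) + 1 / 2 * A (x - z) (x - z) := by
    have : Continuous fun x : ℂ => A (x - z) (x - z) := by fun_prop
    fun_prop
  have hq1 : CircleIntegrable (fun x : ℂ => fderiv ℝ g z (x - z) + 1 / 2 * A (x - z) (x - z)) z r :=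
    hq.continuousOn.circleIntegrable'
  have h5 := Real.circleAverage_mono (c := z) (R := r)
    (f₁ := fun x => (g z - ε * r ^ 2) + (fderiv ℝ g z (x - z) + 1 / 2 * A (x - z) (x - z)))
    ((circleIntegrable_const _ _ _).add hq1)
    hcont.circleIntegrable' hbd
  rw [Real.circleAverage_fun_add (circleIntegrable_const _ _ _) hq1,
    Real.circleAverage_const, circleAverage_quadratic, ← hlap] at h5
  have : r ^ 2 / 4 * Laplacian.laplacian g z - ε * r ^ 2 = r ^ 2 / 4 * L := by rw [hε]; ring
  linarith

/-- At a point where `fderiv ℝ g` is not differentiable, its derivative is `0` by convention, and so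
is the Laplacian. A positive lower bound therefore entails second differentiability. -/
theorem differentiableAt_fderiv_of_laplacian_ne_zero {g : ℂ → ℝ} {z : ℂ}
    (h : Laplacian.laplacian g z ≠ 0) : DifferentiableAt ℝ (fderiv ℝ g) z := by
  by_contra hn
  apply h
  rw [InnerProductSpace.laplacian_eq_iteratedFDeriv_complexPlane]
  simp [iteratedFDeriv_two_apply, fderiv_zero_of_not_differentiableAt hn]

/-- The mean value defect of the potential of `μ` over a circle is the truncated potential, and this
potential is `F - g`. -/
theorem toReal_truncPotential_eq {ρ r F : ℝ} {μ : Measure ℂ} [SFinite μ] {g : ℂ → ℝ} {z : ℂ}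
    (hμD : μ (Metric.closedBall 0 ρ)ᶜ = 0) (hr : 0 < r)
    (hsub : Metric.closedBall z r ⊆ Metric.ball 0 ρ) (hg : ContinuousOn g (Metric.ball 0 ρ))
    (h : ∀ x ∈ Metric.ball (0 : ℂ) ρ, truncPotential (2 * ρ) μ x ≠ ⊤ ∧
      (truncPotential (2 * ρ) μ x).toReal = F - g x) :
    (truncPotential r μ z).toReal = Real.circleAverage g z r - g z := by
  have key := lintegral_truncPotential_circleMeasure_of_subset (μ := μ) hr hμD
    (hsub.trans Metric.ball_subset_closedBall)
  have hsph : Metric.sphere z r ⊆ Metric.ball 0 ρ := Metric.sphere_subset_closedBall.trans hsub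
  obtain ⟨h1, h2⟩ := h z (hsub (Metric.mem_closedBall_self hr.le))
  have hci : CircleIntegrable g z r :=
    (hg.mono hsph).circleIntegrable hr.le
  have h3 : ∫⁻ x, truncPotential (2 * ρ) μ x ∂circleMeasure z r =
      ENNReal.ofReal (F - Real.circleAverage g z r) := by
    have hci2 : CircleIntegrable (fun x => F - g x) z r := (circleIntegrable_const _ _ _).sub hci
    have e : F - Real.circleAverage g z r =
        Real.circleAverage (fun x => (truncPotential (2 * ρ) μ x).toReal) z r := by
      rw [Real.circleAverage_congr_sphere (f₁ := fun x => (truncPotential (2 * ρ) μ x).toReal)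
        (f₂ := fun x => F - g x),
        Real.circleAverage_fun_sub (circleIntegrable_const _ _ _) hci, Real.circleAverage_const]
      intro x hx
      rw [abs_of_pos hr] at hx
      exact (h x (hsph hx)).2
    rw [e, ← lintegral_ofReal_circleMeasure hr.le
      (measurable_truncPotential _ _).ennreal_toReal]
    · refine lintegral_congr_ae ?_
      filter_upwards [ae_circleMeasure_mem_sphere z hr.le] with x hx
      rw [ENNReal.ofReal_toReal (h x (hsph hx)).1]
    · refine hci2.congr_codiscreteWithin ?_
      refine mem_of_superset (self_mem_codiscreteWithin _) fun x hx => ?_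
      rw [abs_of_pos hr] at hx
      exact (h x (hsph hx)).2.symm
    · exact fun x _ => ENNReal.toReal_nonneg
  have h4 : 0 ≤ F - Real.circleAverage g z r := by
    have : F - Real.circleAverage g z r =
        Real.circleAverage (fun x => F - g x) z r := by
      rw [Real.circleAverage_fun_sub (circleIntegrable_const _ _ _) hci, Real.circleAverage_const]
    rw [this]
    refine Real.circleAverage_nonneg_of_nonneg fun x hx => ?_
    rw [abs_of_pos hr] at hx
    rw [← (h x (hsph hx)).2]
    exact ENNReal.toReal_nonneg
  have h5 : truncPotential r μ z ≠ ⊤ := ne_top_of_le_ne_top h1 (key ▸ le_add_self)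
  rw [h3] at key
  have h6 := congrArg ENNReal.toReal key
  rw [ENNReal.toReal_add ENNReal.ofReal_ne_top h5, ENNReal.toReal_ofReal h4, h2] at h6
  linarith

/-- By Tonelli each charge contributes at most the area integral of its kernel, and nothing if it is
further than `r` from `K`. -/
theorem setLIntegral_truncPotential_le {r : ℝ} (hr : 0 < r) {K U : Set ℂ} (hK : MeasurableSet K)
    (hU : MeasurableSet U) (h : Metric.thickening r K ⊆ U) (μ : Measure ℂ) [SFinite μ] :
    ∫⁻ z in K, truncPotential r μ z ≤ ENNReal.ofReal (Real.pi * r ^ 2 / 2) * μ U := by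
  unfold truncPotential
  rw [lintegral_lintegral_swap (measurable_truncKernel r).aemeasurable]
  calc _ ≤ ∫⁻ w, U.indicator (fun _ => ENNReal.ofReal (Real.pi * r ^ 2 / 2)) w ∂μ := by
        refine lintegral_mono fun w => ?_
        by_cases hw : w ∈ U
        · rw [Set.indicator_of_mem hw, ← lintegral_truncKernel hr w]
          exact setLIntegral_le_lintegral _ _
        · rw [Set.indicator_of_notMem hw, nonpos_iff_eq_zero,
            setLIntegral_congr_fun hK (g := fun _ => 0), lintegral_zero]
          intro z hz
          refine truncKernel_eq_zero hr ?_
          by_contra! hlt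
          refine hw (h (Metric.mem_thickening_iff.2 ⟨z, hz, ?_⟩))
          rwa [dist_eq_norm, norm_sub_rev]
    _ = _ := by rw [lintegral_indicator hU, setLIntegral_const]

/-- A measure whose potential decays at the rate of the area measure dominates the latter. -/
theorem smul_volume_restrict_le {a : ℝ} {μ : Measure ℂ} [IsFiniteMeasure μ] {B : Set ℂ}
    (hB : MeasurableSet B)
    (h : ∀ᵐ z ∂volume.restrict B, ∀ᶠ r in 𝓝[>] (0 : ℝ),
      ENNReal.ofReal a * ENNReal.ofReal (Real.pi * r ^ 2 / 2) ≤ truncPotential r μ z) :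
    ENNReal.ofReal a • volume.restrict B ≤ μ := by
  have hKU : ∀ K U : Set ℂ, IsCompact K → IsOpen U → K ⊆ U → K ⊆ B →
      ENNReal.ofReal a * volume K ≤ μ U := by
    intro K U hK hU hKU hKB
    obtain ⟨δ, hδ, hsub⟩ := hK.exists_thickening_subset_open hU hKU
    set r : ℕ → ℝ := fun n => δ / (n + 1) with hr
    have hr0 : ∀ n, 0 < r n := fun n => by positivity
    have hrδ : ∀ n, r n ≤ δ := fun n => div_le_self hδ.le (by linarith [n.cast_nonneg (α := ℝ)])
    have hrt : Tendsto r atTop (𝓝[>] 0) := by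
      refine tendsto_nhdsWithin_iff.2 ⟨?_, Eventually.of_forall hr0⟩
      exact tendsto_const_nhds.div_atTop
        (tendsto_atTop_add_const_right _ _ tendsto_natCast_atTop_atTop)
    set k : ℕ → ℝ≥0∞ := fun n => ENNReal.ofReal (Real.pi * r n ^ 2 / 2) with hk
    have hk0 : ∀ n, k n ≠ 0 := fun n => by
      have := hr0 n
      simp only [hk, ne_eq, ENNReal.ofReal_eq_zero, not_le]
      positivity
    have h1 : ∀ n, (k n)⁻¹ * ∫⁻ z in K, truncPotential (r n) μ z ≤ μ U := fun n => by
      rw [ENNReal.inv_mul_le_iff (hk0 n) ENNReal.ofReal_ne_top]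
      exact setLIntegral_truncPotential_le (hr0 n) hK.measurableSet hU.measurableSet
        ((Metric.thickening_mono (hrδ n) K).trans hsub) μ
    calc ENNReal.ofReal a * volume K = ∫⁻ _ in K, ENNReal.ofReal a := by rw [setLIntegral_const]
      -- The lower bound on the potentials holds only eventually, at a rate depending on the point;
      -- Fatou's lemma exchanges limit and integral.
      _ ≤ ∫⁻ z in K, liminf (fun n => (k n)⁻¹ * truncPotential (r n) μ z) atTop := by
          refine lintegral_mono_ae ?_
          filter_upwards [ae_restrict_of_ae_restrict_of_subset hKB h] with z hz
          refine le_liminf_of_le (by isBoundedDefault) ?_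
          filter_upwards [hrt.eventually hz] with n hn
          rw [← ENNReal.div_eq_inv_mul, ENNReal.le_div_iff_mul_le (Or.inl (hk0 n))
            (Or.inl ENNReal.ofReal_ne_top)]
          exact hn
      _ ≤ liminf (fun n => ∫⁻ z in K, (k n)⁻¹ * truncPotential (r n) μ z) atTop :=
          lintegral_liminf_le fun n => (measurable_truncPotential _ _).const_mul _
      _ ≤ μ U := by
          refine liminf_le_of_le (by isBoundedDefault) fun b hb => ?_
          obtain ⟨n, hn⟩ := hb.exists
          refine hn.trans ?_
          rw [lintegral_const_mul _ (measurable_truncPotential _ _)]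
          exact h1 n
  refine Measure.le_iff.2 fun s hs => ?_
  rw [Measure.smul_apply, Measure.restrict_apply hs, smul_eq_mul]
  refine le_trans ?_ (measure_mono (Set.inter_subset_left (s := s) (t := B)))
  rw [(hs.inter hB).measure_eq_iSup_isCompact, ENNReal.mul_iSup]
  refine iSup_le fun K => ?_
  simp only [ENNReal.mul_iSup]
  refine iSup₂_le fun hKs hK => ?_
  rw [Set.measure_eq_iInf_isOpen (s ∩ B) μ]
  exact le_iInf₂ fun U hU => le_iInf fun hUo =>
    hKU K U hK hUo (hKs.trans hU) (hKs.trans Set.inter_subset_right)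

/-- The Laplacian of a potential is a lower bound for the density of the measure. -/
theorem smul_volume_restrict_ball_le {ρ α F : ℝ} (hα : 0 < α) {μ : Measure ℂ} [IsFiniteMeasure μ]
    {g : ℂ → ℝ} (hμD : μ (Metric.closedBall 0 ρ)ᶜ = 0)
    (hg : DifferentiableOn ℝ g (Metric.ball 0 ρ))
    (hlap : ∀ᵐ z ∂volume.restrict (Metric.ball (0 : ℂ) ρ),
      α ≤ 1 / (4 * Real.pi) * Laplacian.laplacian g z)
    (h : ∀ x ∈ Metric.ball (0 : ℂ) ρ, truncPotential (2 * ρ) μ x ≠ ⊤ ∧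
      (truncPotential (2 * ρ) μ x).toReal = F - g x / 2) :
    ENNReal.ofReal α • volume.restrict (Metric.ball 0 ρ) ≤ μ := by
  -- A strictly smaller `a` is needed since `eventually_le_circleAverage` asks for strict
  -- inequality; letting `a` increase to `α` finishes.
  have hmain : ∀ a, 0 < a → a < α → ENNReal.ofReal a • volume.restrict (Metric.ball 0 ρ) ≤ μ := by
    intro a ha0 ha
    refine smul_volume_restrict_le Metric.isOpen_ball.measurableSet ?_
    filter_upwards [hlap, ae_restrict_mem Metric.isOpen_ball.measurableSet] with z hz hzb
    have hpi := Real.pi_pos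
    have hlt : 4 * Real.pi * a < Laplacian.laplacian g z := by
      have := ha.trans_le hz
      rw [div_mul_eq_mul_div, one_mul, lt_div_iff₀ (by positivity)] at this
      linarith
    have h1 := eventually_le_circleAverage
      (Filter.eventually_of_mem (Metric.isOpen_ball.mem_nhds hzb) fun x hx =>
        hg.differentiableAt (Metric.isOpen_ball.mem_nhds hx))
      (differentiableAt_fderiv_of_laplacian_ne_zero (ne_of_gt (lt_trans (by positivity) hlt))) hlt
    obtain ⟨δ, hδ, hsub⟩ := Metric.nhds_basis_closedBall.mem_iff.1 (Metric.isOpen_ball.mem_nhds hzb)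
    filter_upwards [h1, Ioo_mem_nhdsGT hδ] with r hr1 hr2
    have hr0 := hr2.1
    have hsub' := (Metric.closedBall_subset_closedBall hr2.2.le).trans hsub
    -- The potential of `μ` is `F - g / 2`, so its defect is at least
    -- $\frac12\cdot\frac{r^2}{4}\cdot4\pi a=a\,\pi r^2/2$, the area integral of the kernel times
    -- `a`.
    have h2 := toReal_truncPotential_eq (g := fun x => g x / 2) hμD hr0 hsub'
      (hg.continuousOn.div_const 2) h
    have h3 : Real.circleAverage (fun x => g x / 2) z r = Real.circleAverage g z r / 2 := by
      simp only [div_eq_inv_mul]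
      exact Real.circleAverage_fun_smul (a := (2 : ℝ)⁻¹)
    rw [← ENNReal.ofReal_mul ha0.le]
    refine ENNReal.ofReal_le_of_le_toReal ?_
    rw [h2, h3]
    linarith
  refine Measure.le_iff.2 fun s hs => ?_
  refine le_of_tendsto (f := fun a => (ENNReal.ofReal a • volume.restrict (Metric.ball 0 ρ)) s)
    (x := 𝓝[<] α) ?_ ?_
  · simp only [Measure.smul_apply, smul_eq_mul]
    refine ENNReal.Tendsto.mul_const ?_ (Or.inl (by simpa using hα))
    exact ENNReal.tendsto_ofReal (tendsto_nhdsWithin_of_tendsto_nhds tendsto_id)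
  · filter_upwards [Ioo_mem_nhdsLT hα] with a ha using Measure.le_iff.1 (hmain a ha.1 ha.2) s hs

/-! ### Balayage of exterior charges onto an annulus -/

/-- The Poisson kernel of the exterior of a circle centred at the origin, with pole `w`, as a function
of the point `ζ` of the circle. -/
noncomputable def sweepKernel (w ζ : ℂ) : ℝ := (‖w‖ ^ 2 - ‖ζ‖ ^ 2) / ‖w - ζ‖ ^ 2

theorem measurable_sweepKernel : Measurable fun p : ℂ × ℂ => sweepKernel p.1 p.2 := by
  unfold sweepKernel; fun_prop

theorem sweepKernel_nonneg {w ζ : ℂ} (h : ‖ζ‖ ≤ ‖w‖) : 0 ≤ sweepKernel w ζ :=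
  div_nonneg (sub_nonneg.2 (by gcongr)) (by positivity)

theorem sweepKernel_le {ρ : ℝ} {w ζ : ℂ} (hw : ρ ≤ ‖w‖) (hζ : ‖ζ‖ < ρ) :
    sweepKernel w ζ ≤ (ρ + ‖ζ‖) / (ρ - ‖ζ‖) := by
  have h1 : ‖w‖ - ‖ζ‖ ≤ ‖w - ζ‖ := norm_sub_norm_le w ζ
  have h2 : 0 < ‖w‖ - ‖ζ‖ := by linarith
  have h0 := norm_nonneg ζ
  calc sweepKernel w ζ ≤ (‖w‖ ^ 2 - ‖ζ‖ ^ 2) / (‖w‖ - ‖ζ‖) ^ 2 := by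
        unfold sweepKernel
        have : 0 ≤ ‖w‖ ^ 2 - ‖ζ‖ ^ 2 := by nlinarith
        gcongr
    _ = (‖w‖ + ‖ζ‖) / (‖w‖ - ‖ζ‖) := by
        field_simp
        ring
    _ ≤ _ := by
        rw [div_le_div_iff₀ h2 (by linarith)]
        nlinarith

/-- The reflection of `w` in the circle of radius `c` about the origin. -/
noncomputable def circleReflection (c : ℝ) (w : ℂ) : ℂ := ((c / ‖w‖) ^ 2 : ℝ) * w

theorem norm_circleReflection {c : ℝ} {w : ℂ} (hw : w ≠ 0) :
    ‖circleReflection c w‖ = c ^ 2 / ‖w‖ := by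
  have := norm_ne_zero_iff.2 hw
  rw [circleReflection, norm_mul, Complex.norm_real, Real.norm_of_nonneg (by positivity)]
  field_simp

theorem norm_sub_circleReflection_sq {c : ℝ} (z : ℂ) {w : ℂ} (hw : w ≠ 0) :
    ‖z - circleReflection c w‖ ^ 2 =
      (c / ‖w‖) ^ 2 * ‖z - w‖ ^ 2 + (‖z‖ ^ 2 - c ^ 2) * (1 - (c / ‖w‖) ^ 2) := by
  have h := norm_pos_iff.2 hw
  have e : ∀ z : ℂ, ‖z‖ ^ 2 = z.re * z.re + z.im * z.im := fun z => by
    rw [← Complex.normSq_eq_norm_sq, Complex.normSq_apply]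
  have h1 : (c / ‖w‖) ^ 2 * ‖w‖ ^ 2 = c ^ 2 := by field_simp
  rw [← h1]
  simp only [e, circleReflection, Complex.sub_re, Complex.sub_im, Complex.re_ofReal_mul,
    Complex.im_ofReal_mul]
  ring

theorem sweepKernel_eq_poissonKernel {c : ℝ} (hc : 0 < c) {w ζ : ℂ} (hw : w ≠ 0) (hζ : ‖ζ‖ = c) :
    sweepKernel w ζ = poissonKernel 0 (circleReflection c w) ζ := by
  have h := norm_pos_iff.2 hw
  rw [sweepKernel, poissonKernel_def, sub_zero, sub_zero, norm_sub_circleReflection_sq ζ hw,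
    norm_circleReflection hw, hζ, sub_self, zero_mul, add_zero, norm_sub_rev w ζ]
  field_simp

/-- On the circle the exterior Poisson kernel with pole `w` equals the interior one with pole at the
reflected point, so Poisson's formula applies. -/
theorem circleAverage_sweepKernel_mul {c : ℝ} {w : ℂ} (hc : 0 < c) (hw : c < ‖w‖) {f : ℂ → ℝ}
    (hf : InnerProductSpace.HarmonicOnNhd f (Metric.closedBall 0 c)) :
    Real.circleAverage (fun ζ => sweepKernel w ζ * f ζ) 0 c = f (circleReflection c w) := by
  have hw0 : w ≠ 0 := norm_pos_iff.1 (hc.trans hw)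
  rw [← hf.circleAverage_poissonKernel_smul (w := circleReflection c w)]
  · refine Real.circleAverage_congr_sphere fun ζ hζ => ?_
    rw [abs_of_pos hc, mem_sphere_zero_iff_norm] at hζ
    simp [sweepKernel_eq_poissonKernel hc hw0 hζ]
  · rw [mem_ball_zero_iff, norm_circleReflection hw0, div_lt_iff₀ (hc.trans hw)]
    nlinarith

theorem circleIntegrable_sweepKernel_mul {c : ℝ} {w : ℂ} (hc : 0 < c) (hw : c < ‖w‖) {f : ℂ → ℝ}
    (hf : ContinuousOn f (Metric.sphere 0 c)) :
    CircleIntegrable (fun ζ => sweepKernel w ζ * f ζ) 0 c := by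
  refine ContinuousOn.circleIntegrable hc.le (ContinuousOn.mul ?_ hf)
  unfold sweepKernel
  refine ContinuousOn.div (by fun_prop) (by fun_prop) fun ζ hζ => ?_
  rw [mem_sphere_zero_iff_norm] at hζ
  refine pow_ne_zero _ (norm_ne_zero_iff.2 (sub_ne_zero.2 ?_))
  rintro rfl
  exact hw.ne' hζ

theorem lintegral_sweepKernel {c : ℝ} {w : ℂ} (hc : 0 < c) (hw : c < ‖w‖) :
    ∫⁻ ζ, ENNReal.ofReal (sweepKernel w ζ) ∂circleMeasure 0 c = 1 := by
  have h1 := circleAverage_sweepKernel_mul hc hw (f := fun _ => 1)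
    fun x _ => InnerProductSpace.harmonicAt_const _
  have h2 := circleIntegrable_sweepKernel_mul hc hw (f := fun _ => 1) continuousOn_const
  simp only [mul_one] at h1 h2
  rw [lintegral_ofReal_circleMeasure hc.le (measurable_sweepKernel.of_uncurry_left) h2, h1,
    ENNReal.ofReal_one]
  intro ζ hζ
  rw [mem_sphere_zero_iff_norm] at hζ
  exact sweepKernel_nonneg (hζ.trans_le hw.le)

/-- For `‖z‖ < c` the affine function of `ζ` on the right has no zero in the closed disk; its
logarithm is a harmonic function with the boundary values of `log ‖z - ζ‖`. -/
theorem norm_sub_eq_of_mem_sphere {c : ℝ} (hc : 0 < c) (z : ℂ) {ζ : ℂ} (hζ : ‖ζ‖ = c) :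
    ‖z - ζ‖ = ‖(c : ℂ) - (starRingEnd ℂ) z * ζ / c‖ := by
  have hc' : (c : ℂ) ≠ 0 := by exact_mod_cast hc.ne'
  have e : (c : ℂ) - (starRingEnd ℂ) z * ζ / c = ζ / c * (starRingEnd ℂ) (ζ - z) := by
    have : ζ * (starRingEnd ℂ) ζ = c ^ 2 := by
      rw [Complex.mul_conj, Complex.normSq_eq_norm_sq, hζ]; push_cast; rfl
    rw [map_sub]
    field_simp
    linear_combination -this
  rw [e, norm_mul, norm_div, RCLike.norm_conj, hζ, Complex.norm_real, Real.norm_of_nonneg hc.le,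
    div_self hc.ne', one_mul, norm_sub_rev]

/-- Inside the circle the swept charge has the potential of the original one up to a constant
independent of `z`: evaluating the harmonic extension at the reflection of `w` gives `log (c / ‖w‖ *
‖z - w‖)`. -/
theorem circleAverage_sweepKernel_mul_log_of_lt {c : ℝ} {z w : ℂ} (hc : 0 < c) (hw : c < ‖w‖)
    (hz : ‖z‖ < c) :
    Real.circleAverage (fun ζ => sweepKernel w ζ * (Real.log ‖z - ζ‖)) 0 c =
      Real.log ‖z - w‖ + Real.log c - Real.log ‖w‖ := by
  have hc' : (c : ℂ) ≠ 0 := by exact_mod_cast hc.ne'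
  have hw0 : w ≠ 0 := norm_pos_iff.1 (hc.trans hw)
  have hzw : z - w ≠ 0 := sub_ne_zero.2 (by rintro rfl; exact absurd hw hz.not_gt)
  have h := circleAverage_sweepKernel_mul hc hw
    (f := fun ζ => Real.log ‖(c : ℂ) - (starRingEnd ℂ) z * ζ / c‖) fun ζ hζ => by
      refine AnalyticAt.harmonicAt_log_norm (by fun_prop) fun h0 => ?_
      rw [mem_closedBall_zero_iff] at hζ
      rw [sub_eq_zero, eq_div_iff hc'] at h0
      have := congrArg norm h0
      rw [norm_mul, norm_mul, RCLike.norm_conj, Complex.norm_real, Real.norm_of_nonneg hc.le] at this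
      nlinarith [norm_nonneg z, norm_nonneg ζ]
  calc _ = Real.circleAverage
        (fun ζ => sweepKernel w ζ * Real.log ‖(c : ℂ) - (starRingEnd ℂ) z * ζ / c‖) 0 c := by
        refine Real.circleAverage_congr_sphere fun ζ hζ => ?_
        rw [abs_of_pos hc, mem_sphere_zero_iff_norm] at hζ
        simp only [norm_sub_eq_of_mem_sphere hc z hζ]
    _ = Real.log (c / ‖w‖ * ‖z - w‖) := by
        rw [h]
        congr 1
        have hww : (w : ℂ) * (starRingEnd ℂ) w = (‖w‖ : ℂ) ^ 2 := by
          rw [Complex.mul_conj, Complex.normSq_eq_norm_sq]; push_cast; rfl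
        have hcw : (starRingEnd ℂ) w ≠ 0 := by simpa using hw0
        have e : (c : ℂ) - (starRingEnd ℂ) z * circleReflection c w / c =
            c / (starRingEnd ℂ) w * (starRingEnd ℂ) (w - z) := by
          rw [circleReflection, map_sub]
          have : (((c / ‖w‖) ^ 2 : ℝ) : ℂ) = c ^ 2 / (w * (starRingEnd ℂ) w) := by
            rw [hww]; push_cast; ring
          rw [this]
          field_simp
        rw [e, norm_mul, norm_div, RCLike.norm_conj, RCLike.norm_conj, Complex.norm_real,
          Real.norm_of_nonneg hc.le, norm_sub_rev]
    _ = _ := by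
        rw [Real.log_mul (div_ne_zero hc.ne' (norm_ne_zero_iff.2 hw0)) (norm_ne_zero_iff.2 hzw),
          Real.log_div hc.ne' (norm_ne_zero_iff.2 hw0)]
        ring

/-- Outside the circle `log ‖z - ζ‖` is itself harmonic in `ζ`, and `z` is further from the
reflection of `w` than `c / ‖w‖ * ‖z - w‖` by `norm_sub_circleReflection_sq`. Sweeping thus only
lowers the normalized potential. -/
theorem le_circleAverage_sweepKernel_mul_log_of_gt {c : ℝ} {z w : ℂ} (hc : 0 < c) (hw : c < ‖w‖)
    (hz : c < ‖z‖) (hzw : z ≠ w) :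
    Real.log ‖z - w‖ + Real.log c - Real.log ‖w‖ ≤
      Real.circleAverage (fun ζ => sweepKernel w ζ * (Real.log ‖z - ζ‖)) 0 c := by
  have hw0 : w ≠ 0 := norm_pos_iff.1 (hc.trans hw)
  have hw1 := hc.trans hw
  have hzw' := norm_pos_iff.2 (sub_ne_zero.2 hzw)
  have h := circleAverage_sweepKernel_mul hc hw
    (f := fun ζ => Real.log ‖z - ζ‖) fun ζ hζ => by
      refine AnalyticAt.harmonicAt_log_norm (by fun_prop) fun h0 => ?_
      rw [mem_closedBall_zero_iff] at hζ
      rw [sub_eq_zero] at h0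
      exact absurd hζ (not_le.2 (h0 ▸ hz))
  rw [h]
  calc _ = Real.log (c / ‖w‖ * ‖z - w‖) := by
        rw [Real.log_mul (by positivity) hzw'.ne', Real.log_div hc.ne' hw1.ne']
        ring
    _ ≤ _ := by
        refine Real.log_le_log (by positivity) ?_
        refine abs_le_of_sq_le_sq' ?_ (norm_nonneg _) |>.2
        rw [norm_sub_circleReflection_sq z hw0, mul_pow]
        have h1 : (c / ‖w‖) ^ 2 ≤ 1 := by
          refine pow_le_one₀ (by positivity) ((div_le_one hw1).2 hw.le)
        have h2 : 0 ≤ ‖z‖ ^ 2 - c ^ 2 := by nlinarith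
        nlinarith [mul_nonneg h2 (sub_nonneg.2 h1)]

theorem lintegral_sweepKernel_mul_truncKernel {ρ c : ℝ} {z w : ℂ} (hc : 0 < c) (hcρ : c < ρ)
    (hw : ρ ≤ ‖w‖) (hz : ‖z‖ ≤ ρ) (hne : ‖z‖ ≠ c) :
    ∫⁻ ζ, ENNReal.ofReal (sweepKernel w ζ) * truncKernel (2 * ρ) z ζ ∂circleMeasure 0 c =
      ENNReal.ofReal (Real.log (2 * ρ) -
        Real.circleAverage (fun ζ => sweepKernel w ζ * Real.log ‖z - ζ‖) 0 c) := by
  have hρ := hc.trans hcρ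
  have hcw := hcρ.trans_le hw
  have hnes : ∀ ζ ∈ Metric.sphere (0 : ℂ) c, 0 < ‖z - ζ‖ := fun ζ hζ => by
    rw [mem_sphere_zero_iff_norm] at hζ
    exact norm_pos_iff.2 (sub_ne_zero.2 (by rintro rfl; exact hne hζ))
  have hle : ∀ ζ ∈ Metric.sphere (0 : ℂ) c, ‖z - ζ‖ ≤ 2 * ρ := fun ζ hζ => by
    rw [mem_sphere_zero_iff_norm] at hζ
    linarith [norm_sub_le z ζ]
  have hP : ∀ ζ ∈ Metric.sphere (0 : ℂ) c, 0 ≤ sweepKernel w ζ := fun ζ hζ => by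
    rw [mem_sphere_zero_iff_norm] at hζ
    exact sweepKernel_nonneg (hζ.trans_le hcw.le)
  have hcont : ContinuousOn (fun ζ => Real.log ‖z - ζ‖) (Metric.sphere 0 c) :=
    ContinuousOn.log (by fun_prop) fun ζ hζ => (hnes ζ hζ).ne'
  have hi1 := circleIntegrable_sweepKernel_mul hc hcw (f := fun _ => Real.log (2 * ρ))
    continuousOn_const
  have hi2 := circleIntegrable_sweepKernel_mul hc hcw hcont
  have h1 := circleAverage_sweepKernel_mul hc hcw (f := fun _ => Real.log (2 * ρ))
    fun x _ => InnerProductSpace.harmonicAt_const _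
  have hm : Measurable (sweepKernel w) := measurable_sweepKernel.of_uncurry_left
  have h2 : Real.log (2 * ρ) -
        Real.circleAverage (fun ζ => sweepKernel w ζ * Real.log ‖z - ζ‖) 0 c =
      Real.circleAverage (fun ζ => sweepKernel w ζ * Real.log (2 * ρ) -
        sweepKernel w ζ * Real.log ‖z - ζ‖) 0 c := by
    rw [Real.circleAverage_fun_sub hi1 hi2, h1]
  rw [h2, ← lintegral_ofReal_circleMeasure (f := fun ζ => sweepKernel w ζ * Real.log (2 * ρ) -
      sweepKernel w ζ * Real.log ‖z - ζ‖) hc.le (by fun_prop) (hi1.sub hi2)]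
  · refine lintegral_congr_ae ?_
    filter_upwards [ae_circleMeasure_mem_sphere 0 hc.le] with ζ hζ
    have h3 := hnes ζ hζ
    rw [truncKernel_of_ne (by positivity) (sub_ne_zero.1 (norm_pos_iff.1 h3)),
      ← ENNReal.ofReal_mul (hP ζ hζ), Real.log_div (by positivity) h3.ne', mul_sub]
  · intro ζ hζ
    rw [← mul_sub]
    exact mul_nonneg (hP ζ hζ) (sub_nonneg.2 (Real.log_le_log (hnes ζ hζ) (hle ζ hζ)))

/-- A scale that bounds the distances from `w` to the points of the disk of radius `ρ`. -/
noncomputable def scale (ρ : ℝ) (w : ℂ) : ℝ := (1 + ρ) * (1 + ‖w‖)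

theorem norm_sub_le_scale {ρ : ℝ} {z : ℂ} (hz : ‖z‖ ≤ ρ) (w : ℂ) : ‖z - w‖ ≤ scale ρ w := by
  have := norm_nonneg z
  have := norm_nonneg w
  unfold scale
  nlinarith [norm_sub_le z w]

theorem norm_le_scale {ρ : ℝ} (hρ : 0 < ρ) (w : ℂ) : ‖w‖ ≤ scale ρ w := by
  have := norm_nonneg w
  unfold scale
  nlinarith

theorem one_le_scale {ρ : ℝ} (hρ : 0 < ρ) (w : ℂ) : 1 ≤ scale ρ w := by
  have := norm_nonneg w
  unfold scale
  nlinarith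

theorem lintegral_sweepKernel_mul_truncKernel_of_lt {ρ c : ℝ} {z w : ℂ} (hc : 0 < c) (hcρ : c < ρ)
    (hw : ρ ≤ ‖w‖) (hz : ‖z‖ < c) :
    ∫⁻ ζ, ENNReal.ofReal (sweepKernel w ζ) * truncKernel (2 * ρ) z ζ ∂circleMeasure 0 c +
        ENNReal.ofReal (Real.log (scale ρ w / ‖w‖)) =
      truncKernel (scale ρ w) z w + ENNReal.ofReal (Real.log (2 * ρ / c)) := by
  have hρ := hc.trans hcρ
  have hcw := hcρ.trans_le hw
  have hw0 := hρ.trans_le hw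
  have hs := zero_lt_one.trans_le (one_le_scale hρ w)
  have hzw : z ≠ w := by rintro rfl; exact absurd hcw hz.not_gt
  have hzw' := norm_pos_iff.2 (sub_ne_zero.2 hzw)
  have h1 := norm_sub_le_scale (hz.le.trans hcρ.le) w
  have h2 : ‖z - w‖ * c ≤ 2 * ρ * ‖w‖ := by
    have := norm_sub_le z w
    nlinarith
  rw [lintegral_sweepKernel_mul_truncKernel hc hcρ hw (hz.trans hcρ).le hz.ne,
    circleAverage_sweepKernel_mul_log_of_lt hc hcw hz, truncKernel_of_ne hs hzw,
    ← ENNReal.ofReal_add, ← ENNReal.ofReal_add, Real.log_div, Real.log_div, Real.log_div]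
  · congr 1; ring
  any_goals positivity
  · exact Real.log_nonneg ((one_le_div hzw').2 h1)
  · exact Real.log_nonneg ((one_le_div hc).2 (by linarith))
  · have := Real.log_le_log (by positivity) h2
    rw [Real.log_mul hzw'.ne' hc.ne', Real.log_mul (by positivity) hw0.ne'] at this
    linarith
  · exact Real.log_nonneg ((one_le_div hw0).2 (norm_le_scale hρ w))

theorem lintegral_sweepKernel_mul_truncKernel_le {ρ c : ℝ} {z w : ℂ} (hc : 0 < c) (hcρ : c < ρ)
    (hw : ρ ≤ ‖w‖) (hz : ‖z‖ ≤ ρ) (hne : ‖z‖ ≠ c) :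
    ∫⁻ ζ, ENNReal.ofReal (sweepKernel w ζ) * truncKernel (2 * ρ) z ζ ∂circleMeasure 0 c +
        ENNReal.ofReal (Real.log (scale ρ w / ‖w‖)) ≤
      truncKernel (scale ρ w) z w + ENNReal.ofReal (Real.log (2 * ρ / c)) := by
  rcases hne.lt_or_gt with h | h
  · exact (lintegral_sweepKernel_mul_truncKernel_of_lt hc hcρ hw h).le
  have hρ := hc.trans hcρ
  have hcw := hcρ.trans_le hw
  have hw0 := hρ.trans_le hw
  have hs := zero_lt_one.trans_le (one_le_scale hρ w)
  rcases eq_or_ne z w with rfl | hzw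
  · simp [truncKernel_self hs]
  have hzw' := norm_pos_iff.2 (sub_ne_zero.2 hzw)
  have h1 := norm_sub_le_scale hz w
  have h2 : ‖z - w‖ * c ≤ 2 * ρ * ‖w‖ := by
    have := norm_sub_le z w
    nlinarith
  have h3 := le_circleAverage_sweepKernel_mul_log_of_gt hc hcw h hzw
  have h4 := Real.log_le_log (by positivity) h2
  rw [Real.log_mul hzw'.ne' hc.ne', Real.log_mul (by positivity) hw0.ne'] at h4
  rw [lintegral_sweepKernel_mul_truncKernel hc hcρ hw hz hne]
  calc _ ≤ ENNReal.ofReal (Real.log (2 * ρ) -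
        (Real.log ‖z - w‖ + Real.log c - Real.log ‖w‖)) +
        ENNReal.ofReal (Real.log (scale ρ w / ‖w‖)) := by gcongr
    _ = _ := by
      rw [truncKernel_of_ne hs hzw,
        ← ENNReal.ofReal_add, ← ENNReal.ofReal_add, Real.log_div, Real.log_div, Real.log_div]
      · congr 1; ring
      any_goals positivity
      · exact Real.log_nonneg ((one_le_div hzw').2 h1)
      · exact Real.log_nonneg ((one_le_div hc).2 (by linarith))
      · linarith
      · exact Real.log_nonneg ((one_le_div hw0).2 (norm_le_scale hρ w))

/-- The potential of a measure of possibly unbounded support, normalized to be nonnegative on the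
disk of radius `ρ`. -/
noncomputable def scaledPotential (ρ : ℝ) (ν : Measure ℂ) (z : ℂ) : ℝ≥0∞ :=
  ∫⁻ w, truncKernel (scale ρ w) z w ∂ν

/-- The density of the measure obtained by sweeping `ν` onto the circles of radii between `c₁` and
`c₂` and adding a uniform charge `s` on these circles. -/
noncomputable def sweepDensity (ν : Measure ℂ) (s c₁ c₂ : ℝ) : ℂ → ℝ≥0∞ :=
  {ζ | ‖ζ‖ ∈ Set.Ioo c₁ c₂}.indicator fun ζ =>
    (∫⁻ w, ENNReal.ofReal (sweepKernel w ζ) ∂ν + ENNReal.ofReal s) *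
      ENNReal.ofReal (2 * Real.pi * ‖ζ‖ * (c₂ - c₁))⁻¹

theorem measurableSet_annulus (c₁ c₂ : ℝ) : MeasurableSet {ζ : ℂ | ‖ζ‖ ∈ Set.Ioo c₁ c₂} :=
  measurable_norm measurableSet_Ioo

theorem measurable_lintegral_sweepKernel (ν : Measure ℂ) [SFinite ν] :
    Measurable fun ζ => ∫⁻ w, ENNReal.ofReal (sweepKernel w ζ) ∂ν :=
  measurable_sweepKernel.ennreal_ofReal.lintegral_prod_left'

theorem measurable_sweepDensity (ν : Measure ℂ) [SFinite ν] (s c₁ c₂ : ℝ) :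
    Measurable (sweepDensity ν s c₁ c₂) := by
  refine Measurable.indicator ?_ (measurableSet_annulus c₁ c₂)
  have := measurable_lintegral_sweepKernel ν
  fun_prop

/-- In polar coordinates the factor `1 / (2 π ‖ζ‖ (c₂ - c₁))` cancels the length of the circle, so
the swept measure is the mean over `c` of the sweepings onto single circles. -/
theorem lintegral_withDensity_sweepDensity {ν : Measure ℂ} [SFinite ν] {s c₁ c₂ : ℝ}
    (hc₁ : 0 < c₁) (hc : c₁ < c₂) {f : ℂ → ℝ≥0∞} (hf : Measurable f) :
    ∫⁻ ζ, f ζ ∂volume.withDensity (sweepDensity ν s c₁ c₂) =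
      ENNReal.ofReal (c₂ - c₁)⁻¹ * ∫⁻ c in Set.Ioo c₁ c₂,
        (∫⁻ w, ∫⁻ ζ, ENNReal.ofReal (sweepKernel w ζ) * f ζ ∂circleMeasure 0 c ∂ν +
          ENNReal.ofReal s * ∫⁻ ζ, f ζ ∂circleMeasure 0 c) := by
  have hm := measurable_sweepDensity ν s c₁ c₂
  have hk := measurable_lintegral_sweepKernel ν
  have hsk := measurable_sweepKernel
  have hkf : Measurable fun p : ℂ × ℂ => ENNReal.ofReal (sweepKernel p.1 p.2) * f p.2 :=
    hsk.ennreal_ofReal.mul (hf.comp measurable_snd)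
  rw [lintegral_withDensity_eq_lintegral_mul _ hm hf,
    lintegral_eq_lintegral_circleMeasure (hm.mul hf), ← lintegral_const_mul' _ _ ENNReal.ofReal_ne_top]
  rw [← lintegral_indicator measurableSet_Ioo, ← lintegral_indicator measurableSet_Ioi]
  refine lintegral_congr fun c => ?_
  by_cases hcc : c ∈ Set.Ioo c₁ c₂
  · have hc0 : 0 < c := hc₁.trans hcc.1
    rw [Set.indicator_of_mem hcc, Set.indicator_of_mem (Set.mem_Ioi.2 hc0)]
    have h1 : ∫⁻ ζ, (sweepDensity ν s c₁ c₂ * f) ζ ∂circleMeasure 0 c =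
        ENNReal.ofReal (2 * Real.pi * c * (c₂ - c₁))⁻¹ *
        (∫⁻ w, ∫⁻ ζ, ENNReal.ofReal (sweepKernel w ζ) * f ζ ∂circleMeasure 0 c ∂ν +
          ENNReal.ofReal s * ∫⁻ ζ, f ζ ∂circleMeasure 0 c) := by
      rw [lintegral_lintegral_swap, ← lintegral_const_mul _ hf, ← lintegral_add_left,
        ← lintegral_const_mul]
      · refine lintegral_congr_ae ?_
        filter_upwards [ae_circleMeasure_mem_sphere 0 hc0.le] with ζ hζ
        rw [mem_sphere_zero_iff_norm] at hζ
        have hζ' : ζ ∈ {ζ : ℂ | ‖ζ‖ ∈ Set.Ioo c₁ c₂} := by rw [Set.mem_ofPred_eq, hζ]; exact hcc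
        rw [Pi.mul_apply, sweepDensity, Set.indicator_of_mem hζ', hζ, lintegral_mul_const]
        · ring
        · exact hsk.of_uncurry_right.ennreal_ofReal
      · exact hkf.lintegral_prod_left'.add (hf.const_mul _)
      · exact hkf.lintegral_prod_left'
      · exact hkf.aemeasurable
    rw [h1, ← mul_assoc, ← ENNReal.ofReal_mul (by positivity)]
    congr 2
    have : c₂ - c₁ ≠ 0 := (sub_pos.2 hc).ne'
    field_simp
  · rw [Set.indicator_of_notMem hcc]
    by_cases hc0 : c ∈ Set.Ioi (0 : ℝ)
    · rw [Set.indicator_of_mem hc0]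
      have h1 : ∫⁻ ζ, (sweepDensity ν s c₁ c₂ * f) ζ ∂circleMeasure 0 c = ∫⁻ _, 0 ∂circleMeasure 0 c := by
        refine lintegral_congr_ae ?_
        filter_upwards [ae_circleMeasure_mem_sphere 0 (le_of_lt hc0)] with ζ hζ
        rw [mem_sphere_zero_iff_norm] at hζ
        have hζ' : ζ ∉ {ζ : ℂ | ‖ζ‖ ∈ Set.Ioo c₁ c₂} := by rw [Set.mem_ofPred_eq, hζ]; exact hcc
        rw [Pi.mul_apply, sweepDensity, Set.indicator_of_notMem hζ', zero_mul]
      rw [h1, lintegral_zero, mul_zero]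
    · rw [Set.indicator_of_notMem hc0]

theorem measurable_scale (ρ : ℝ) : Measurable (scale ρ) := by
  unfold scale; fun_prop

theorem average_const {c₁ c₂ : ℝ} (hc : c₁ < c₂) (k : ℝ≥0∞) :
    ENNReal.ofReal (c₂ - c₁)⁻¹ * ∫⁻ _ in Set.Ioo c₁ c₂, k = k := by
  have h := sub_pos.2 hc
  rw [setLIntegral_const, Real.volume_Ioo, mul_left_comm, ← ENNReal.ofReal_mul (by positivity),
    inv_mul_cancel₀ h.ne', ENNReal.ofReal_one, mul_one]

theorem ae_le_norm {ρ : ℝ} {ν : Measure ℂ} (hν : ν (Metric.ball 0 ρ) = 0) :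
    ∀ᵐ w ∂ν, ρ ≤ ‖w‖ := by
  rw [ae_iff]
  convert hν using 2
  ext w
  simp

theorem sweepDensity_le {ρ s c₁ c₂ a : ℝ} {ν : Measure ℂ} [IsFiniteMeasure ν] (hc₁ : 0 < c₁)
    (hc : c₁ < c₂) (hc₂ : c₂ < ρ) (hν : ν (Metric.ball 0 ρ) = 0) (hs : 0 ≤ s)
    (ha : ∀ c ∈ Set.Ioo c₁ c₂,
      (ν.real Set.univ * ((ρ + c) / (ρ - c)) + s) * (2 * Real.pi * c * (c₂ - c₁))⁻¹ ≤ a) (ζ : ℂ) :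
    sweepDensity ν s c₁ c₂ ζ ≤ (Metric.ball 0 ρ).indicator (fun _ => ENNReal.ofReal a) ζ := by
  unfold sweepDensity
  by_cases hζ : ζ ∈ {ζ : ℂ | ‖ζ‖ ∈ Set.Ioo c₁ c₂}
  · have hζ' : ‖ζ‖ ∈ Set.Ioo c₁ c₂ := hζ
    have hζρ : ‖ζ‖ < ρ := hζ'.2.trans hc₂
    have h0 := norm_nonneg ζ
    have hq : 0 ≤ (ρ + ‖ζ‖) / (ρ - ‖ζ‖) := div_nonneg (by linarith) (by linarith)
    rw [Set.indicator_of_mem hζ, Set.indicator_of_mem (mem_ball_zero_iff.2 hζρ)]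
    calc _ ≤ (∫⁻ _, ENNReal.ofReal ((ρ + ‖ζ‖) / (ρ - ‖ζ‖)) ∂ν + ENNReal.ofReal s) *
          ENNReal.ofReal (2 * Real.pi * ‖ζ‖ * (c₂ - c₁))⁻¹ := by
          gcongr (?_ + _) * _
          refine lintegral_mono_ae ?_
          filter_upwards [ae_le_norm hν] with w hw
          exact ENNReal.ofReal_le_ofReal (sweepKernel_le hw hζρ)
      _ = ENNReal.ofReal ((ν.real Set.univ * ((ρ + ‖ζ‖) / (ρ - ‖ζ‖)) + s) *
          (2 * Real.pi * ‖ζ‖ * (c₂ - c₁))⁻¹) := by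
          rw [lintegral_const, ← ofReal_measureReal, ← ENNReal.ofReal_mul hq,
            ← ENNReal.ofReal_add (by positivity) hs, ← ENNReal.ofReal_mul (by positivity), mul_comm
            (ν.real Set.univ)]
      _ ≤ _ := ENNReal.ofReal_le_ofReal (ha _ hζ')
  · rw [Set.indicator_of_notMem hζ]
    exact zero_le

/-- The estimate for one charge is integrated over `ν`; the uniform charge has potential `-log (max
‖z‖ c)`, at most `-log c`. Constants stand on the side where they are nonnegative. -/
theorem sweep_add_le {ρ s c : ℝ} {ν : Measure ℂ} {z : ℂ}
    (hc : 0 < c) (hcρ : c < ρ) (hν : ν (Metric.ball 0 ρ) = 0) (hz : ‖z‖ ≤ ρ) (hne : ‖z‖ ≠ c) :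
    ∫⁻ w, ∫⁻ ζ, ENNReal.ofReal (sweepKernel w ζ) * truncKernel (2 * ρ) z ζ ∂circleMeasure 0 c ∂ν +
          ENNReal.ofReal s * ∫⁻ ζ, truncKernel (2 * ρ) z ζ ∂circleMeasure 0 c +
        ∫⁻ w, ENNReal.ofReal (Real.log (scale ρ w / ‖w‖)) ∂ν ≤
      scaledPotential ρ ν z +
        (ν Set.univ + ENNReal.ofReal s) * ENNReal.ofReal (Real.log (2 * ρ / c)) := by
  have hm : Measurable fun w => ENNReal.ofReal (Real.log (scale ρ w / ‖w‖)) := by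
    have := measurable_scale ρ
    fun_prop
  rw [add_right_comm, ← lintegral_add_right _ hm, add_mul, ← add_assoc]
  refine add_le_add ?_ ?_
  · rw [scaledPotential, mul_comm (ν Set.univ), ← lintegral_const,
      ← lintegral_add_right _ measurable_const]
    refine lintegral_mono_ae ?_
    filter_upwards [ae_le_norm hν] with w hw
    exact lintegral_sweepKernel_mul_truncKernel_le hc hcρ hw hz hne
  · gcongr
    simp_rw [truncKernel_comm _ z]
    rw [lintegral_truncKernel_circleMeasure hc (by linarith), Real.log_div (by linarith) hc.ne']
    · gcongr
      exact le_max_right _ _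
    · intro x hx
      rw [mem_sphere_zero_iff_norm] at hx
      linarith [norm_sub_le x z]

theorem sweep_add_eq {ρ s c : ℝ} {ν : Measure ℂ} {z : ℂ}
    (hc : 0 < c) (hcρ : c < ρ) (hν : ν (Metric.ball 0 ρ) = 0) (hz : ‖z‖ < c) :
    ∫⁻ w, ∫⁻ ζ, ENNReal.ofReal (sweepKernel w ζ) * truncKernel (2 * ρ) z ζ ∂circleMeasure 0 c ∂ν +
          ENNReal.ofReal s * ∫⁻ ζ, truncKernel (2 * ρ) z ζ ∂circleMeasure 0 c +
        ∫⁻ w, ENNReal.ofReal (Real.log (scale ρ w / ‖w‖)) ∂ν =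
      scaledPotential ρ ν z +
        (ν Set.univ + ENNReal.ofReal s) * ENNReal.ofReal (Real.log (2 * ρ / c)) := by
  have hm : Measurable fun w => ENNReal.ofReal (Real.log (scale ρ w / ‖w‖)) := by
    have := measurable_scale ρ
    fun_prop
  rw [add_right_comm, ← lintegral_add_right _ hm, add_mul, ← add_assoc]
  congr 1
  · rw [scaledPotential, mul_comm (ν Set.univ), ← lintegral_const,
      ← lintegral_add_right _ measurable_const]
    refine lintegral_congr_ae ?_
    filter_upwards [ae_le_norm hν] with w hw
    exact lintegral_sweepKernel_mul_truncKernel_of_lt hc hcρ hw hz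
  · congr 1
    simp_rw [truncKernel_comm _ z]
    rw [lintegral_truncKernel_circleMeasure hc (by linarith), Real.log_div (by linarith) hc.ne',
      zero_sub, norm_neg, max_eq_right hz.le]
    intro x hx
    rw [mem_sphere_zero_iff_norm] at hx
    linarith [norm_sub_le x z]

/-- A charge `ν` outside the disk, together with a uniform charge of size `s`, is swept onto an
annulus inside the disk without changing the potential in the inner disk, up to a constant. -/
theorem exists_sweep {ρ s c₁ c₂ a : ℝ} {ν : Measure ℂ} [IsFiniteMeasure ν] (hc₁ : 0 < c₁)
    (hc : c₁ < c₂) (hc₂ : c₂ < ρ) (hν : ν (Metric.ball 0 ρ) = 0) (hs : 0 ≤ s)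
    (ha : ∀ c ∈ Set.Ioo c₁ c₂,
      (ν.real Set.univ * ((ρ + c) / (ρ - c)) + s) * (2 * Real.pi * c * (c₂ - c₁))⁻¹ ≤ a) :
    ∃ (β : Measure ℂ) (K₁ K₂ : ℝ≥0∞), β ≤ ENNReal.ofReal a • volume.restrict (Metric.ball 0 ρ) ∧
      β Set.univ = ν Set.univ + ENNReal.ofReal s ∧ β (Metric.ball 0 c₁) = 0 ∧ K₁ ≠ ⊤ ∧ K₂ ≠ ⊤ ∧
      (∀ z, ‖z‖ < c₁ → truncPotential (2 * ρ) β z + K₁ = scaledPotential ρ ν z + K₂) ∧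
      (∀ z, ‖z‖ ≤ ρ → truncPotential (2 * ρ) β z + K₁ ≤ scaledPotential ρ ν z + K₂) := by
  have hρ : 0 < ρ := hc₁.trans (hc.trans hc₂)
  set K₁ := ∫⁻ w, ENNReal.ofReal (Real.log (scale ρ w / ‖w‖)) ∂ν with hK₁
  -- The additive constant for the circle of radius `c`; its mean over `c` becomes `K₂`.
  set k : ℝ → ℝ≥0∞ := fun c =>
    (ν Set.univ + ENNReal.ofReal s) * ENNReal.ofReal (Real.log (2 * ρ / c)) with hk
  have hkm : Measurable k := by fun_prop
  have havg : ∀ z, truncPotential (2 * ρ) (volume.withDensity (sweepDensity ν s c₁ c₂)) z + K₁ =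
      ENNReal.ofReal (c₂ - c₁)⁻¹ * ∫⁻ c in Set.Ioo c₁ c₂,
        (∫⁻ w, ∫⁻ ζ, ENNReal.ofReal (sweepKernel w ζ) * truncKernel (2 * ρ) z ζ ∂circleMeasure 0 c ∂ν +
          ENNReal.ofReal s * ∫⁻ ζ, truncKernel (2 * ρ) z ζ ∂circleMeasure 0 c + K₁) := by
    intro z
    rw [lintegral_add_right _ measurable_const, mul_add, average_const hc, truncPotential,
      lintegral_withDensity_sweepDensity hc₁ hc (continuous_truncKernel_right _ z).measurable]
  have havg2 : ∀ z, scaledPotential ρ ν z + ENNReal.ofReal (c₂ - c₁)⁻¹ * ∫⁻ c in Set.Ioo c₁ c₂, k c =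
      ENNReal.ofReal (c₂ - c₁)⁻¹ * ∫⁻ c in Set.Ioo c₁ c₂, (scaledPotential ρ ν z + k c) := by
    intro z
    rw [lintegral_add_left measurable_const, mul_add, average_const hc]
  refine ⟨volume.withDensity (sweepDensity ν s c₁ c₂), K₁,
    ENNReal.ofReal (c₂ - c₁)⁻¹ * ∫⁻ c in Set.Ioo c₁ c₂, k c, ?_, ?_, ?_, ?_, ?_, fun z hz => ?_,
    fun z hz => ?_⟩
  · rw [← withDensity_const, ← withDensity_indicator Metric.isOpen_ball.measurableSet]
    exact withDensity_mono (Eventually.of_forall (sweepDensity_le hc₁ hc hc₂ hν hs ha))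
  · rw [← lintegral_one, lintegral_withDensity_sweepDensity hc₁ hc measurable_const,
      ← average_const hc (ν Set.univ + _)]
    congr 1
    refine setLIntegral_congr_fun measurableSet_Ioo fun c hcc => ?_
    simp only [mul_one, lintegral_one, measure_univ]
    congr 1
    rw [lintegral_congr_ae (g := fun _ => 1), lintegral_one]
    filter_upwards [ae_le_norm hν] with w hw
    exact lintegral_sweepKernel (hc₁.trans hcc.1) ((hcc.2.trans hc₂).trans_le hw)
  · rw [withDensity_apply _ Metric.isOpen_ball.measurableSet,
      setLIntegral_congr_fun (g := fun _ => 0) Metric.isOpen_ball.measurableSet, lintegral_zero]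
    intro ζ hζ
    rw [mem_ball_zero_iff] at hζ
    exact Set.indicator_of_notMem (fun h => hζ.not_gt h.1) _
  -- As `‖w‖ ≥ ρ`, the ratio `scale ρ w / ‖w‖` is bounded.
  · refine ne_top_of_le_ne_top (b := ∫⁻ _, ENNReal.ofReal (Real.log ((1 + ρ) * (1 + ρ⁻¹))) ∂ν)
      (by rw [lintegral_const]; finiteness) (lintegral_mono_ae ?_)
    filter_upwards [ae_le_norm hν] with w hw
    have hw0 := hρ.trans_le hw
    refine ENNReal.ofReal_le_ofReal (Real.log_le_log
      (div_pos (zero_lt_one.trans_le (one_le_scale hρ w)) hw0) ?_)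
    have e : scale ρ w / ‖w‖ = (1 + ρ) * (1 + ‖w‖⁻¹) := by
      rw [scale]
      field_simp
      ring
    rw [e]
    gcongr
  · refine ne_top_of_le_ne_top (b := (ν Set.univ + ENNReal.ofReal s) *
      ENNReal.ofReal (Real.log (2 * ρ / c₁))) (by finiteness) ?_
    rw [← average_const hc ((ν Set.univ + ENNReal.ofReal s) * _)]
    gcongr ENNReal.ofReal (c₂ - c₁)⁻¹ * ?_
    refine setLIntegral_mono measurable_const fun c hcc => ?_
    have := hc₁.trans hcc.1
    simp only [hk]
    gcongr
    exact hcc.1.le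
  · rw [havg, havg2]
    congr 1
    exact setLIntegral_congr_fun measurableSet_Ioo fun c hcc =>
      sweep_add_eq (hc₁.trans hcc.1) (hcc.2.trans hc₂) hν (hz.trans hcc.1)
  · rw [havg, havg2]
    gcongr ENNReal.ofReal (c₂ - c₁)⁻¹ * ?_
    refine lintegral_mono_ae ?_
    -- The one circle through `z`, where the kernel estimate is not available, does not matter in
    -- the mean over `c`.
    have hae : ∀ᵐ c ∂volume.restrict (Set.Ioo c₁ c₂), c ≠ ‖z‖ := by
      refine ae_restrict_of_ae ?_
      rw [ae_iff]; simp
    filter_upwards [hae, ae_restrict_mem measurableSet_Ioo] with c hcz hcc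
    exact sweep_add_le (hc₁.trans hcc.1) (hcc.2.trans hc₂) hν hz hcz.symm

/-! ### The perturbed potential on the disk -/

/-- The constant by which the scaled potential differs from the potential. -/
noncomputable def scaleMoment (ρ : ℝ) (ν : Measure ℂ) : ℝ≥0∞ :=
  ∫⁻ w, ENNReal.ofReal (Real.log (scale ρ w)) ∂ν

theorem integrable_log_scale {ρ : ℝ} (hρ : 0 < ρ) {ν : Measure ℂ} [IsFiniteMeasure ν]
    (hν : Integrable (fun w : ℂ => Real.log (1 + ‖w‖)) ν) :
    Integrable (fun w => Real.log (scale ρ w)) ν := by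
  refine ((integrable_const (Real.log (1 + ρ))).add hν).congr (Eventually.of_forall fun w => ?_)
  have := norm_nonneg w
  simp only [Pi.add_apply, scale]
  rw [Real.log_mul (by positivity) (by positivity)]

theorem scaleMoment_ne_top {ρ : ℝ} (hρ : 0 < ρ) {ν : Measure ℂ} [IsFiniteMeasure ν]
    (hν : Integrable (fun w : ℂ => Real.log (1 + ‖w‖)) ν) : scaleMoment ρ ν ≠ ⊤ :=
  (integrable_log_scale hρ hν).lintegral_lt_top.ne

theorem measurable_truncKernel_scale (ρ : ℝ) :
    Measurable fun p : ℂ × ℂ => truncKernel (scale ρ p.2) p.1 p.2 := by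
  unfold truncKernel
  refine EReal.continuous_toENNReal.measurable.comp (ENNReal.continuous_log.measurable.comp ?_)
  refine Measurable.mul ?_ (measurable_edist.inv)
  exact ((measurable_scale ρ).comp measurable_snd).ennreal_ofReal

theorem measurable_truncKernel_scale_right (ρ : ℝ) (z : ℂ) :
    Measurable fun w => truncKernel (scale ρ w) z w := by
  change Measurable ((fun p : ℂ × ℂ => truncKernel (scale ρ p.2) p.1 p.2) ∘ fun w => (z, w))
  exact (measurable_truncKernel_scale ρ).comp measurable_prodMk_left

theorem measurable_scaledPotential (ρ : ℝ) (ν : Measure ℂ) [SFinite ν] :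
    Measurable (scaledPotential ρ ν) :=
  (measurable_truncKernel_scale ρ).lintegral_prod_right'

/-- The scale grows with `‖w‖`, making the kernel nonnegative for every `z` in the disk; the price
`log (scale ρ w)` is integrable by the logarithmic moment. -/
theorem potential_eq {ρ : ℝ} (hρ : 0 < ρ) {ν : Measure ℂ} [IsFiniteMeasure ν]
    (hν : Integrable (fun w : ℂ => Real.log (1 + ‖w‖)) ν) {z : ℂ} (hz : ‖z‖ ≤ ρ) :
    potential ν z = (scaledPotential ρ ν z : EReal) - (scaleMoment ρ ν : EReal) := by
  refine eintegral_of_ae_eq_sub (measurable_truncKernel_scale_right ρ z)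
    (by have := measurable_scale ρ; fun_prop) (scaleMoment_ne_top hρ hν)
    (Eventually.of_forall fun w => ?_)
  have h1 := one_le_scale hρ w
  rw [coe_truncKernel (by linarith) (norm_sub_le_scale hz w), EReal.coe_ennreal_ofReal,
    max_eq_left (Real.log_nonneg h1), EReal.add_sub_cancel_right]

theorem truncKernel_scale_le {ρ δ : ℝ} (hρ : 0 < ρ) (hδ : 0 < δ) {z w : ℂ} (h : δ ≤ ‖z - w‖) :
    truncKernel (scale ρ w) z w ≤ ENNReal.ofReal (Real.log (scale ρ w)) +
      ENNReal.ofReal |Real.log δ| := by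
  have hs := zero_lt_one.trans_le (one_le_scale hρ w)
  have h' := hδ.trans_le h
  rw [truncKernel_of_ne hs (sub_ne_zero.1 (norm_pos_iff.1 h')), Real.log_div hs.ne' h'.ne',
    ← ENNReal.ofReal_add (Real.log_nonneg (one_le_scale hρ w)) (abs_nonneg _)]
  refine ENNReal.ofReal_le_ofReal ?_
  have := Real.log_le_log hδ h
  linarith [neg_abs_le (Real.log δ)]

theorem scaledPotential_le {ρ δ : ℝ} (hρ : 0 < ρ) (hδ : 0 < δ) {ν : Measure ℂ}
    (hν0 : ν (Metric.ball 0 ρ) = 0) {z : ℂ} (hz : ‖z‖ ≤ ρ - δ) :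
    scaledPotential ρ ν z ≤ scaleMoment ρ ν + ENNReal.ofReal |Real.log δ| * ν Set.univ := by
  rw [scaleMoment, ← lintegral_const, ← lintegral_add_right _ measurable_const]
  refine lintegral_mono_ae ?_
  filter_upwards [ae_le_norm hν0] with w hw
  exact truncKernel_scale_le hρ hδ (by linarith [norm_sub_norm_le w z, norm_sub_rev w z])

theorem scaledPotential_ne_top {ρ : ℝ} (hρ : 0 < ρ) {ν : Measure ℂ} [IsFiniteMeasure ν]
    (hν : Integrable (fun w : ℂ => Real.log (1 + ‖w‖)) ν) (hν0 : ν (Metric.ball 0 ρ) = 0) {z : ℂ}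
    (hz : ‖z‖ < ρ) : scaledPotential ρ ν z ≠ ⊤ := by
  have := scaleMoment_ne_top hρ hν
  exact ne_top_of_le_ne_top (by finiteness)
    (scaledPotential_le hρ (sub_pos.2 hz) hν0 (by linarith))

theorem continuousAt_scaledPotential {ρ : ℝ} (hρ : 0 < ρ) {ν : Measure ℂ} [IsFiniteMeasure ν]
    (hν : Integrable (fun w : ℂ => Real.log (1 + ‖w‖)) ν) (hν0 : ν (Metric.ball 0 ρ) = 0) {z : ℂ}
    (hz : ‖z‖ < ρ) : ContinuousAt (scaledPotential ρ ν) z := by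
  set δ := (ρ - ‖z‖) / 2 with hδ
  have hδ0 : 0 < δ := by rw [hδ]; linarith
  refine tendsto_lintegral_filter_of_dominated_convergence
    (fun w => ENNReal.ofReal (Real.log (scale ρ w)) + ENNReal.ofReal |Real.log δ|)
    (Eventually.of_forall fun z' => measurable_truncKernel_scale_right ρ z') ?_ ?_
    (Eventually.of_forall fun w => (continuous_truncKernel_left _ w).tendsto z)
  · filter_upwards [Metric.ball_mem_nhds z hδ0] with z' hz'
    filter_upwards [ae_le_norm hν0] with w hw
    refine truncKernel_scale_le hρ hδ0 ?_
    rw [mem_ball_iff_norm] at hz'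
    have h1 := norm_sub_norm_le w z'
    have h2 := norm_sub_norm_le z' z
    rw [norm_sub_rev w z'] at h1
    linarith
  · rw [lintegral_add_right _ measurable_const, lintegral_const]
    have := scaleMoment_ne_top hρ hν
    unfold scaleMoment at this
    finiteness

/-- The shift is the sum of those that make `V`, the potential of `ν` and `R` nonnegative
separately, so `W / 2` becomes a sum in `ℝ≥0∞`. Infinite values are checked case by case. -/
theorem half_perturbedPotential {ρ t N C : ℝ} (hρ : 0 < ρ) (ht : 0 < t) {V : ℂ → EReal}
    {ν : Measure ℂ} [IsFiniteMeasure ν] (hν : Integrable (fun w : ℂ => Real.log (1 + ‖w‖)) ν)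
    {R : ℂ → ℝ} {z : ℂ} (hz : z ∈ Metric.closedBall (0 : ℂ) ρ) (hV : ((-N : ℝ) : EReal) ≤ V z)
    (hC : 0 ≤ R z + C) :
    ((1 / 2 : ℝ) : EReal) * perturbedPotential ρ t V ν R z +
        (((2 * (scaleMoment ρ ν).toReal + t * N + 2 * C) / 2 : ℝ) : EReal) =
      ((ENNReal.ofReal t * halfPotential N V z + scaledPotential ρ ν z + ENNReal.ofReal (R z + C) :
        ℝ≥0∞) : EReal) := by
  rw [perturbedPotential, if_pos hz, potential_eq hρ hν (mem_closedBall_zero_iff.1 hz),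
    EReal.coe_ennreal_add, EReal.coe_ennreal_add, EReal.coe_ennreal_mul, coe_halfPotential hV,
    EReal.coe_ennreal_ofReal, EReal.coe_ennreal_ofReal, max_eq_left ht.le, max_eq_left hC]
  have hK := scaleMoment_ne_top hρ hν
  generalize scaleMoment ρ ν = K at *
  generalize scaledPotential ρ ν z = S at *
  generalize V z = x at *
  lift K to NNReal using hK
  have hS : (S : EReal) ≠ ⊥ := EReal.coe_ennreal_ne_bot _
  simp only [EReal.coe_nnreal_eq_coe_real, ENNReal.coe_toReal]
  generalize (K : ℝ) = k at *
  rw [show (2 : EReal) = ((2 : ℝ) : EReal) from rfl]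
  induction x with
  | bot => simp at hV
  | top =>
    generalize (S : EReal) = s at *
    induction s with
    | bot => simp at hS
    | top =>
      simp only [EReal.coe_mul_top_of_pos, ht, EReal.top_sub_coe,
        EReal.top_add_coe, EReal.top_add_top, one_half_pos, two_pos]
    | coe s =>
      simp only [EReal.coe_mul_top_of_pos, ht, ← EReal.coe_sub, ← EReal.coe_mul,
        EReal.top_add_coe, one_half_pos]
  | coe x =>
    generalize (S : EReal) = s at *
    induction s with
    | bot => simp at hS
    | top =>
      simp only [EReal.coe_mul_top_of_pos, EReal.top_sub_coe, ← EReal.coe_mul, ← EReal.coe_add,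
        EReal.top_add_coe, EReal.coe_add_top, one_half_pos, two_pos]
    | coe s =>
      norm_cast
      ring

theorem le_of_half_add_eq {N : ℝ} {x : EReal} {y : ℝ≥0∞}
    (h : ((1 / 2 : ℝ) : EReal) * x + ((N / 2 : ℝ) : EReal) = (y : EReal)) :
    ((-N : ℝ) : EReal) ≤ x := by
  have hy : (0 : EReal) ≤ y := EReal.coe_ennreal_nonneg _
  rw [← h] at hy
  induction x with
  | bot => simp [EReal.coe_mul_bot_of_pos] at hy
  | top => exact le_top
  | coe x =>
    have : 0 ≤ 1 / 2 * x + N / 2 := by exact_mod_cast hy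
    exact_mod_cast (by linarith : -N ≤ x)

theorem measurable_perturbedPotential {ρ t : ℝ} (hρ : 0 < ρ) {V : ℂ → EReal} (hV : Measurable V)
    {ν : Measure ℂ} [IsFiniteMeasure ν] (hν : Integrable (fun w : ℂ => Real.log (1 + ‖w‖)) ν)
    {R : ℂ → ℝ} (hR : ContinuousOn R (Metric.closedBall 0 ρ)) :
    Measurable (perturbedPotential ρ t V ν R) := by
  classical
  have hD : MeasurableSet (Metric.closedBall (0 : ℂ) ρ) := Metric.isClosed_closedBall.measurableSet
  have hR' : Measurable ((Metric.closedBall (0 : ℂ) ρ).piecewise R 0) :=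
    hR.measurable_piecewise continuousOn_const hD
  have e : perturbedPotential ρ t V ν R = (Metric.closedBall (0 : ℂ) ρ).piecewise
      (fun z => (t : EReal) * V z + 2 * ((scaledPotential ρ ν z : EReal) - (scaleMoment ρ ν : EReal)) +
        ((2 * (Metric.closedBall (0 : ℂ) ρ).piecewise R 0 z : ℝ) : EReal)) (fun _ => ⊤) := by
    ext z
    by_cases hz : z ∈ Metric.closedBall (0 : ℂ) ρ
    · rw [perturbedPotential, if_pos hz, Set.piecewise_eq_of_mem _ _ _ hz,
        Set.piecewise_eq_of_mem _ _ _ hz, potential_eq hρ hν (mem_closedBall_zero_iff.1 hz)]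
    · rw [perturbedPotential, if_neg hz, Set.piecewise_eq_of_notMem _ _ _ hz]
  rw [e]
  have hs := measurable_scaledPotential ρ ν
  refine Measurable.piecewise hD ?_ measurable_const
  refine ((hV.const_mul _).add (Measurable.const_mul ?_ _)).add ?_
  · simp only [sub_eq_add_neg]
    exact hs.coe_ereal_ennreal.add_const _
  · exact (hR'.const_mul 2).coe_real_ereal

theorem domainClosure_perturbedPotential_subset (ρ t : ℝ) (V : ℂ → EReal) (ν : Measure ℂ)
    (R : ℂ → ℝ) : domainClosure (perturbedPotential ρ t V ν R) ⊆ Metric.closedBall 0 ρ := by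
  refine closure_minimal (fun z hz => ?_) Metric.isClosed_closedBall
  by_contra h
  rw [Set.mem_ofPred_eq, perturbedPotential, if_neg h] at hz
  exact lt_irrefl _ hz

theorem exists_neg_le_of_lowerSemicontinuous {V : ℂ → EReal} (hV : LowerSemicontinuous V)
    (hbot : ∀ z, V z ≠ ⊥) {K : Set ℂ} (hK : IsCompact K) (b : ℝ) :
    ∃ N : ℝ, b ≤ N ∧ ∀ z ∈ K, ((-N : ℝ) : EReal) ≤ V z := by
  rcases K.eq_empty_or_nonempty with rfl | hne
  · exact ⟨b, le_rfl, by simp⟩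
  obtain ⟨z₀, -, hz₀⟩ := (hV.lowerSemicontinuousOn K).exists_isMinOn hne hK
  obtain ⟨m, hm⟩ := EReal.lt_iff_exists_real_btwn.1 (bot_lt_iff_ne_bot.2 (hbot z₀))
  refine ⟨max b (-m), le_max_left _ _, fun z hz => le_trans ?_ (hm.2.le.trans (hz₀ hz))⟩
  exact_mod_cast (by linarith [le_max_right b (-m)] : -max b (-m) ≤ m)

theorem lowerSemicontinuous_halfPotential (N : ℝ) {V : ℂ → EReal} (hV : LowerSemicontinuous V) :
    LowerSemicontinuous (halfPotential N V) := by
  have hg : Continuous fun x : EReal => ((1 / 2 : ℝ) : EReal) * x + ((N / 2 : ℝ) : EReal) := by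
    refine continuous_iff_continuousAt.2 fun x => ?_
    have h1 : ContinuousAt (fun x : EReal => ((1 / 2 : ℝ) : EReal) * x) x :=
      EReal.Tendsto.const_mul tendsto_id (Or.inl (EReal.coe_ne_bot _))
        (Or.inl (EReal.coe_ne_top _))
    exact ContinuousAt.comp (f := fun x : EReal =>
      (((1 / 2 : ℝ) : EReal) * x, ((N / 2 : ℝ) : EReal))) (EReal.continuousAt_add
      (Or.inr (EReal.coe_ne_bot _)) (Or.inr (EReal.coe_ne_top _))) (h1.prodMk continuousAt_const)
  refine (EReal.continuous_toENNReal.comp hg).comp_lowerSemicontinuous hV fun x y hxy => ?_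
  refine EReal.toENNReal_le_toENNReal (add_le_add_left (mul_le_mul_of_nonneg_left hxy ?_) _)
  exact EReal.coe_nonneg.2 one_half_pos.le

/-! ### Comparison of the two equilibrium problems -/

theorem potential_add_le_of_le {t r : ℝ} (ht : 0 < t) (hr : 0 ≤ r)
    {PW PV Pτ Pβ S v FV FW K₁ K₂ : ℝ≥0∞} (hFW : FW ≠ ⊤) (hK₂ : K₂ ≠ ⊤)
    (hPV : PV ≠ ⊤) (h1 : PW + (ENNReal.ofReal t * v + S + ENNReal.ofReal r) = FW)
    (h2 : FV ≤ PV + v) (h3 : Pβ + K₁ ≤ S + K₂) (h4 : Pτ + Pβ = ENNReal.ofReal t * PV) :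
    PW ≠ ⊤ ∧ PW.toReal + r ≤
      Pτ.toReal + (FW.toReal - t * FV.toReal - K₁.toReal + K₂.toReal) := by
  lift PV to NNReal using hPV
  lift K₂ to NNReal using hK₂
  have h5 : ENNReal.ofReal t * PV ≠ ⊤ := by finiteness
  rw [← h4] at h5
  obtain ⟨hτ, hβ⟩ := ENNReal.add_ne_top.1 h5
  lift Pτ to NNReal using hτ
  lift Pβ to NNReal using hβ
  lift FW to NNReal using hFW
  have h6 : PW + (ENNReal.ofReal t * v + S + ENNReal.ofReal r) ≠ ⊤ := by rw [h1]; simp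
  have hPW : PW ≠ ⊤ := fun h => by simp [h] at h6
  have hS : S ≠ ⊤ := fun h => by simp [h] at h6
  have hv : v ≠ ⊤ := fun h => by simp [h, ENNReal.mul_top, ht] at h6
  have hFV : FV ≠ ⊤ := ne_top_of_le_ne_top (by finiteness) h2
  have hK₁ : K₁ ≠ ⊤ := fun h => by
    rw [h, add_top, top_le_iff] at h3
    exact (ENNReal.add_ne_top.2 ⟨hS, ENNReal.coe_ne_top⟩) h3
  refine ⟨hPW, ?_⟩
  lift PW to NNReal using hPW
  lift S to NNReal using hS
  lift v to NNReal using hv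
  lift FV to NNReal using hFV
  lift K₁ to NNReal using hK₁
  lift t to NNReal using ht.le
  lift r to NNReal using hr
  simp only [ENNReal.ofReal_coe_nnreal, ENNReal.coe_toReal] at *
  norm_cast at h1 h2 h3 h4
  have e1 : (PW : ℝ) + (t * v + S + r) = FW := by exact_mod_cast h1
  have e2 : (FV : ℝ) ≤ PV + v := by exact_mod_cast h2
  have e3 : (Pβ : ℝ) + K₁ ≤ S + K₂ := by exact_mod_cast h3
  have e4 : (Pτ : ℝ) + Pβ = t * PV := by exact_mod_cast h4
  -- With all quantities finite, `t` times the inequality for `V` is subtracted from the equality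
  -- for `W`, and the sweeping inequality exchanges `S` for the potential of `β`.
  have := mul_le_mul_of_nonneg_left e2 ht.le
  linarith

theorem le_potential_add_of_le {t r : ℝ} (ht : 0 < t) (hr : 0 ≤ r)
    {PW PV Pτ Pβ S v FV FW K₁ K₂ : ℝ≥0∞} (hFV : FV ≠ ⊤) (hK₁ : K₁ ≠ ⊤) (hK₂ : K₂ ≠ ⊤) (hS : S ≠ ⊤)
    (hPW : PW ≠ ⊤) (h1 : FW ≤ PW + (ENNReal.ofReal t * v + S + ENNReal.ofReal r))
    (h2 : PV + v ≤ FV) (h3 : S + K₂ ≤ Pβ + K₁) (h4 : Pτ + Pβ = ENNReal.ofReal t * PV) :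
    Pτ.toReal + (FW.toReal - t * FV.toReal - K₁.toReal + K₂.toReal) ≤ PW.toReal + r := by
  have h5 := ne_top_of_le_ne_top hFV h2
  obtain ⟨hPV, hv⟩ := ENNReal.add_ne_top.1 h5
  lift PV to NNReal using hPV
  lift K₂ to NNReal using hK₂
  have h5 : ENNReal.ofReal t * PV ≠ ⊤ := by finiteness
  rw [← h4] at h5
  obtain ⟨hτ, hβ⟩ := ENNReal.add_ne_top.1 h5
  lift Pτ to NNReal using hτ
  lift Pβ to NNReal using hβ
  have hFW : FW ≠ ⊤ := ne_top_of_le_ne_top (by finiteness) h1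
  lift FW to NNReal using hFW
  lift PW to NNReal using hPW
  lift S to NNReal using hS
  lift v to NNReal using hv
  lift FV to NNReal using hFV
  lift K₁ to NNReal using hK₁
  lift t to NNReal using ht.le
  lift r to NNReal using hr
  simp only [ENNReal.ofReal_coe_nnreal, ENNReal.coe_toReal] at *
  norm_cast at h1 h2 h3 h4
  have e1 : (FW : ℝ) ≤ PW + (t * v + S + r) := by exact_mod_cast h1
  have e2 : (PV : ℝ) + v ≤ FV := by exact_mod_cast h2
  have e3 : (S : ℝ) + K₂ ≤ Pβ + K₁ := by exact_mod_cast h3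
  have e4 : (Pτ : ℝ) + Pβ = t * PV := by exact_mod_cast h4
  have := mul_le_mul_of_nonneg_left e2 ht.le
  linarith

theorem truncPotential_add (r : ℝ) (μ ν : Measure ℂ) (z : ℂ) :
    truncPotential r (μ + ν) z = truncPotential r μ z + truncPotential r ν z :=
  lintegral_add_measure _ _ _

theorem truncPotential_smul (r : ℝ) (a : ℝ≥0∞) (μ : Measure ℂ) (z : ℂ) :
    truncPotential r (a • μ) z = a * truncPotential r μ z :=
  lintegral_smul_measure _ _

theorem truncPotential_ne_top_of_ae {r δ : ℝ} (hr : 0 < r) (hδ : 0 < δ) {μ : Measure ℂ}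
    [IsFiniteMeasure μ] {z : ℂ} (h : ∀ᵐ w ∂μ, δ ≤ ‖z - w‖) : truncPotential r μ z ≠ ⊤ := by
  refine ne_top_of_le_ne_top (b := ∫⁻ _, ENNReal.ofReal (Real.log (r / δ)) ∂μ)
    (by rw [lintegral_const]; finiteness) (lintegral_mono_ae ?_)
  filter_upwards [h] with w hw
  have h' := hδ.trans_le hw
  rw [truncKernel_of_ne hr (sub_ne_zero.1 (norm_pos_iff.1 h'))]
  gcongr

theorem measure_ball_of_truncPotential_eq_zero {r : ℝ} {μ : Measure ℂ} {z : ℂ}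
    (h : truncPotential r μ z = 0) : μ (Metric.ball z r) = 0 := by
  rw [truncPotential, lintegral_eq_zero_iff (continuous_truncKernel_right r z).measurable] at h
  refine measure_mono_null (fun w hw => ?_) (ae_iff.1 h)
  rw [mem_ball_iff_norm, norm_sub_rev] at hw
  have hr := (norm_nonneg _).trans_lt hw
  rcases eq_or_ne z w with rfl | hne
  · simp [truncKernel_self hr]
  · have h' := norm_pos_iff.2 (sub_ne_zero.2 hne)
    simpa [truncKernel_of_ne hr hne] using Real.log_pos ((one_lt_div h').2 hw)

/-- Equal functions have equal mean value defects; `q` and `μ` contribute none, so neither does `τ`.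
-/
theorem truncPotential_eq_zero_of_eqOn {ρ r c : ℝ} {μ τ : Measure ℂ} [IsFiniteMeasure μ]
    [IsFiniteMeasure τ] (hμD : μ (Metric.closedBall 0 ρ)ᶜ = 0)
    (hτD : τ (Metric.closedBall 0 ρ)ᶜ = 0) {q : ℂ → ℝ} (hq : Measurable q) {z : ℂ} (hr : 0 < r)
    (hsub : Metric.closedBall z r ⊆ Metric.closedBall 0 ρ) (hqz : Real.circleAverage q z r = q z)
    (h : ∀ x ∈ Metric.closedBall z r, truncPotential (2 * ρ) μ x ≠ ⊤ ∧
      truncPotential (2 * ρ) τ x ≠ ⊤ ∧ (truncPotential (2 * ρ) μ x).toReal + q x =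
        (truncPotential (2 * ρ) τ x).toReal + c)
    (h0 : truncPotential r μ z = 0) : truncPotential r τ z = 0 := by
  have k1 := lintegral_truncPotential_circleMeasure_of_subset (μ := μ) hr hμD hsub
  have k2 := lintegral_truncPotential_circleMeasure_of_subset (μ := τ) hr hτD hsub
  rw [h0, add_zero] at k1
  obtain ⟨f1, f2, f3⟩ := h z (Metric.mem_closedBall_self hr.le)
  have hsph := ae_circleMeasure_mem_sphere z hr.le
  have m1 := measurable_truncPotential (2 * ρ) μ
  have m2 := measurable_truncPotential (2 * ρ) τ
  have g1 : ∫⁻ x, truncPotential (2 * ρ) μ x ∂circleMeasure z r ≠ ⊤ := by rwa [k1]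
  have g2 := ENNReal.add_ne_top.1 (k2 ▸ f2)
  have i1 := integrable_toReal_of_lintegral_ne_top m1.aemeasurable g1
  have i2 := integrable_toReal_of_lintegral_ne_top m2.aemeasurable g2.1
  have e1 := integral_toReal m1.aemeasurable (ae_lt_top m1 g1)
  have e2 := integral_toReal m2.aemeasurable (ae_lt_top m2 g2.1)
  have e3 : q z = (∫⁻ x, truncPotential (2 * ρ) τ x ∂circleMeasure z r).toReal + c -
      (∫⁻ x, truncPotential (2 * ρ) μ x ∂circleMeasure z r).toReal := by
    rw [← hqz, ← integral_circleMeasure hq, ← e1, ← e2]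
    calc _ = ∫ x, ((truncPotential (2 * ρ) τ x).toReal + c - (truncPotential (2 * ρ) μ x).toReal)
          ∂circleMeasure z r := by
          refine integral_congr_ae ?_
          filter_upwards [hsph] with x hx
          linarith [(h x (Metric.sphere_subset_closedBall hx)).2.2]
      _ = _ := by
          rw [integral_sub (f := fun x => (truncPotential (2 * ρ) τ x).toReal + c)
            (i2.add (integrable_const c)) i1, integral_add i2 (integrable_const c)]
          simp
  rw [← k1, ← k2, ENNReal.toReal_add g2.1 g2.2] at f3
  have : (truncPotential r τ z).toReal = 0 := by linarith
  rcases (ENNReal.toReal_eq_zero_iff _).1 this with h | h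
  · exact h
  · exact absurd h g2.2

/-- If the charges of the perturbation are swept onto a measure `β` that is dominated by a multiple
of the equilibrium measure `μ` of `v`, then the disk free of `β` stays in the support of the
equilibrium measure `μ'` of the perturbed potential `v'`. -/
theorem mem_support_of_sweep {ρ t g c₁ C : ℝ} (hρ : 0 < ρ) (ht : 0 < t) (hc₁ : c₁ < ρ)
    {v v' S : ℂ → ℝ≥0∞} {μ μ' β : Measure ℂ} {F F' K₁ K₂ : ℝ≥0∞} [IsProbabilityMeasure μ]
    [IsProbabilityMeasure μ'] [IsFiniteMeasure β]
    (h : IsVariational (2 * ρ) (Metric.closedBall 0 ρ) v μ F)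
    (h' : IsVariational (2 * ρ) (Metric.closedBall 0 ρ) v' μ' F')
    (hμ : μ.support = Metric.closedBall 0 ρ) (hμ' : μ' (Metric.closedBall 0 ρ)ᶜ = 0)
    (hv : LowerSemicontinuous v)
    (hv' : ∀ z ∈ Metric.ball (0 : ℂ) ρ, ContinuousAt v' z ∧ v' z ≠ ⊤)
    {q : ℂ → ℝ} (hq : IsKinkedSubharmonic ρ g q)
    (hqh : ∀ z r, 0 < r → Metric.closedBall z r ⊆ Metric.ball 0 ρ → Real.circleAverage q z r = q z)
    (hC : ∀ z ∈ Metric.closedBall (0 : ℂ) ρ, 0 ≤ q z + C)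
    (hvv' : ∀ z ∈ Metric.closedBall (0 : ℂ) ρ,
      v' z = ENNReal.ofReal t * v z + S z + ENNReal.ofReal (q z + C))
    (hβ : β ≤ ENNReal.ofReal t • μ) (hβc : β (Metric.ball 0 c₁) = 0)
    (hK₁ : K₁ ≠ ⊤) (hK₂ : K₂ ≠ ⊤)
    (hβeq : ∀ z, ‖z‖ < c₁ → truncPotential (2 * ρ) β z + K₁ = S z + K₂)
    (hβle : ∀ z, ‖z‖ ≤ ρ → truncPotential (2 * ρ) β z + K₁ ≤ S z + K₂)
    (hmass : g + t < 1 + β.real Set.univ) {z₀ : ℂ} (hz₀ : ‖z₀‖ < c₁) : z₀ ∈ μ'.support := by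
  by_contra hz₀'
  have hM : 0 < 2 * ρ := by positivity
  have hμD : μ (Metric.closedBall 0 ρ)ᶜ = 0 := hμ ▸ Measure.measure_compl_support
  have hF : ∀ z ∈ Metric.closedBall (0 : ℂ) ρ, truncPotential (2 * ρ) μ z + v z ≤ F :=
    fun z hz => h.le_of_mem_support hv (hμ ▸ hz)
  have hPV : ∀ z ∈ Metric.closedBall (0 : ℂ) ρ, truncPotential (2 * ρ) μ z ≠ ⊤ := fun z hz =>
    (ENNReal.add_ne_top.1 (ne_top_of_le_ne_top h.ne_top (hF z hz))).1
  have htμ : IsFiniteMeasure (ENNReal.ofReal t • μ) := Measure.smul_finite μ ENNReal.ofReal_ne_top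
  set τ := ENNReal.ofReal t • μ - β with hτ
  have hτβ : τ + β = ENNReal.ofReal t • μ := Measure.sub_add_cancel_of_le hβ
  have hτle : τ ≤ ENNReal.ofReal t • μ := hτβ ▸ Measure.le_add_right le_rfl
  have hτfin : IsFiniteMeasure τ := isFiniteMeasure_of_le _ hτle
  have hτD : τ (Metric.closedBall 0 ρ)ᶜ = 0 := by
    refine le_antisymm ((hτle _).trans ?_) bot_le
    simp [hμD]
  have hPτ : ∀ z, truncPotential (2 * ρ) τ z + truncPotential (2 * ρ) β z =
      ENNReal.ofReal t * truncPotential (2 * ρ) μ z := fun z => by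
    rw [← truncPotential_add, hτβ, truncPotential_smul]
  have hPτ' : ∀ z ∈ Metric.closedBall (0 : ℂ) ρ, truncPotential (2 * ρ) τ z ≠ ⊤ := fun z hz => by
    have h1 : ENNReal.ofReal t * truncPotential (2 * ρ) μ z ≠ ⊤ :=
      ENNReal.mul_ne_top ENNReal.ofReal_ne_top (hPV z hz)
    rw [← hPτ] at h1
    exact (ENNReal.add_ne_top.1 h1).1
  set c := F'.toReal - t * F.toReal - K₁.toReal + K₂.toReal with hc
  have haeD : ∀ᵐ z ∂μ', z ∈ Metric.closedBall (0 : ℂ) ρ := by rw [ae_iff]; exact hμ'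
  -- This makes `μ'` a test measure in the equilibrium condition of `μ`.
  have hvint : ∫⁻ z, v z ∂μ' ≠ ⊤ := by
    have h1 : ENNReal.ofReal t * ∫⁻ z, v z ∂μ' ≤ ∫⁻ z, v' z ∂μ' := by
      rw [← lintegral_const_mul' _ _ ENNReal.ofReal_ne_top]
      refine lintegral_mono_ae ?_
      filter_upwards [haeD] with z hz
      rw [hvv' z hz, add_assoc]
      exact le_self_add
    intro h2
    rw [h2, ENNReal.mul_top (by simpa using ht)] at h1
    exact h'.lintegral_ne_top (top_le_iff.1 h1)
  have hae : ∀ᵐ z ∂μ', truncPotential (2 * ρ) μ' z ≠ ⊤ ∧ truncPotential (2 * ρ) τ z ≠ ⊤ ∧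
      (truncPotential (2 * ρ) μ' z).toReal + q z ≤
        (truncPotential (2 * ρ) τ z).toReal + (c - C) := by
    filter_upwards [haeD, h'.ae_eq, h.ae_le μ' inferInstance hμ' h'.lintegral_potential_ne_top hvint]
      with z hz h1 h2
    rw [hvv' z hz] at h1
    obtain ⟨h3, h4⟩ := potential_add_le_of_le ht (hC z hz) h'.ne_top hK₂ (hPV z hz) h1 h2
      (hβle z (mem_closedBall_zero_iff.1 hz)) (hPτ z)
    exact ⟨h3, hPτ' z hz, by rw [← hc] at h4; linarith⟩
  -- The mass of `τ` is `t` minus that of `β`: here the auxiliary uniform charge pays for the growth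
  -- of `q`.
  have hmass' : g + τ.real Set.univ < μ'.real Set.univ := by
    have h1 : τ.real Set.univ + β.real Set.univ = t := by
      rw [← measureReal_add_apply, hτβ, measureReal_ennreal_smul_apply, probReal_univ,
        ENNReal.toReal_ofReal ht.le, mul_one]
    rw [probReal_univ (μ := μ')]
    linarith
  obtain ⟨U, hU, hμU⟩ := Measure.notMem_support_iff_exists.1 hz₀'
  obtain ⟨d, hd, hdU⟩ := Metric.mem_nhds_iff.1
    (inter_mem hU (Metric.isOpen_ball.mem_nhds (mem_ball_zero_iff.2 hz₀)))
  set r := d / 2 with hr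
  have hr0 : 0 < r := by positivity
  have hd0 : ∀ᵐ w ∂μ', d ≤ ‖z₀ - w‖ := by
    rw [ae_iff]
    refine measure_mono_null (fun w hw => (hdU ?_).1) hμU
    rw [mem_ball_iff_norm, norm_sub_rev]
    simpa using hw
  have hsubc : Metric.closedBall z₀ r ⊆ Metric.ball 0 c₁ := fun x hx =>
    (hdU (Metric.closedBall_subset_ball (by rw [hr]; linarith) hx)).2
  have hsubb : Metric.closedBall z₀ r ⊆ Metric.ball 0 ρ :=
    hsubc.trans (Metric.ball_subset_ball hc₁.le)
  -- Near `z₀` domination gives one inequality between the potentials, and the pointwise equilibrium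
  -- conditions with exact sweeping in the inner disk give the other.
  have hT : truncPotential r τ z₀ = 0 := by
    refine truncPotential_eq_zero_of_eqOn hμ' hτD hq.continuous.measurable hr0
      (hsubb.trans Metric.ball_subset_closedBall) (hqh z₀ r hr0 hsubb) (c := c - C) (fun x hx => ?_) ?_
    · have hxb := hsubb hx
      have hxD := Metric.ball_subset_closedBall hxb
      have hxc := mem_ball_zero_iff.1 (hsubc hx)
      have hfin : truncPotential (2 * ρ) μ' x ≠ ⊤ := by
        refine truncPotential_ne_top_of_ae hM hr0 ?_
        filter_upwards [hd0] with w hw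
        rw [mem_closedBall_iff_norm] at hx
        have := norm_sub_le_norm_sub_add_norm_sub z₀ x w
        rw [norm_sub_rev z₀ x] at this
        linarith
      have hxs : x ∉ μ'.support := by
        refine Measure.notMem_support_iff_exists.2 ⟨Metric.ball z₀ d, Metric.isOpen_ball.mem_nhds
          (Metric.closedBall_subset_ball (by rw [hr]; linarith) hx),
          measure_mono_null (fun w hw => (hdU hw).1) hμU⟩
      refine ⟨hfin, hPτ' x hxD, le_antisymm
        (domination hρ hμ' hτD hq hmass' hae hxD hxs (hPτ' x hxD)) ?_⟩
      obtain ⟨hcont, hne⟩ := hv' x hxb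
      have h1 := h'.le_of_continuousAt hρ hμ' hxb hcont hne
      have hS : S x ≠ ⊤ := by
        rw [hvv' x hxD] at hne
        exact (ENNReal.add_ne_top.1 (ENNReal.add_ne_top.1 hne).1).2
      rw [hvv' x hxD] at h1
      have h2 := le_potential_add_of_le ht (hC x hxD) h.ne_top hK₁ hK₂ hS hfin h1 (hF x hxD)
        (hβeq x hxc).ge (hPτ x)
      rw [← hc] at h2
      linarith
    · exact truncPotential_eq_zero hr0 (hd0.mono fun w hw => by rw [hr]; linarith)
  have h1 : τ (Metric.ball z₀ r) = 0 := measure_ball_of_truncPotential_eq_zero hT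
  have h2 : β (Metric.ball z₀ r) = 0 :=
    measure_mono_null (Metric.ball_subset_closedBall.trans hsubc) hβc
  have h3 : (ENNReal.ofReal t • μ) (Metric.ball z₀ r) = 0 := by
    rw [← hτβ, Measure.add_apply, h1, h2, add_zero]
  rw [Measure.smul_apply, smul_eq_mul, mul_eq_zero, ENNReal.ofReal_eq_zero] at h3
  have h4 : z₀ ∈ μ.support := hμ ▸ mem_closedBall_zero_iff.2 (hz₀.le.trans hc₁.le)
  exact ((Measure.mem_support_iff_forall z₀).1 h4 _ (Metric.ball_mem_nhds z₀ hr0)).ne'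
    (h3.resolve_left (not_le.2 ht))

/-! ### Constants and conclusion -/

theorem halfPotential_eq_ofReal {N : ℝ} {V : ℂ → EReal} {z : ℂ} (h : ((-N : ℝ) : EReal) ≤ V z)
    (hz : V z ≠ ⊤) :
    halfPotential N V z = ENNReal.ofReal ((V z).toReal / 2 + N / 2) ∧
      0 ≤ (V z).toReal / 2 + N / 2 := by
  have hb : V z ≠ ⊥ := fun hb => by simp [hb] at h
  rw [halfPotential]
  lift V z to ℝ using ⟨hz, hb⟩ with x
  have h' : -N ≤ x := by exact_mod_cast h
  rw [← EReal.coe_mul, ← EReal.coe_add, EReal.real_coe_toENNReal, EReal.toReal_coe]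
  exact ⟨by ring_nf, by linarith⟩

theorem lintegral_circleMeasure_ne_top {f : ℂ → ℝ≥0∞} {z : ℂ} {r : ℝ} (hr : 0 ≤ r)
    (hf : ∀ x ∈ Metric.sphere z r, ContinuousAt f x ∧ f x ≠ ⊤) :
    ∫⁻ x, f x ∂circleMeasure z r ≠ ⊤ := by
  obtain ⟨y, hy, hmax⟩ := (isCompact_sphere z r).exists_isMaxOn (NormedSpace.sphere_nonempty.2 hr)
    fun x hx => (hf x hx).1.continuousWithinAt
  refine ne_top_of_le_ne_top (b := ∫⁻ _, f y ∂circleMeasure z r) (by simpa using (hf y hy).2) ?_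
  refine lintegral_mono_ae ?_
  filter_upwards [ae_circleMeasure_mem_sphere z hr] with x hx using hmax hx

theorem infDist_compl_closedBall_le {ρ : ℝ} {z : ℂ} (hz : ‖z‖ ≤ ρ) :
    Metric.infDist z {w : ℂ | ρ < ‖w‖} ≤ ρ - ‖z‖ := by
  refine le_of_forall_pos_le_add fun ε hε => ?_
  obtain ⟨u, hu, hzu⟩ : ∃ u : ℂ, ‖u‖ = 1 ∧ (‖z‖ : ℂ) * u = z := by
    refine ⟨Complex.exp (z.arg * Complex.I), Complex.norm_exp_ofReal_mul_I _,
      Complex.norm_mul_exp_arg_mul_I z⟩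
  have hd : 0 ≤ ρ - ‖z‖ + ε := by linarith
  have h1 : ‖z + ((ρ - ‖z‖ + ε : ℝ) : ℂ) * u‖ = ρ + ε := by
    have : z + ((ρ - ‖z‖ + ε : ℝ) : ℂ) * u = ((ρ + ε : ℝ) : ℂ) * u := by
      nth_rewrite 1 [← hzu]
      push_cast
      ring
    rw [this, norm_mul, hu, mul_one, Complex.norm_real, Real.norm_of_nonneg]
    linarith [norm_nonneg z]
  refine (Metric.infDist_le_dist_of_mem (y := z + ((ρ - ‖z‖ + ε : ℝ) : ℂ) * u) ?_).trans_eq ?_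
  · rw [Set.mem_ofPred_eq, h1]
    linarith
  · rw [dist_eq_norm, sub_add_cancel_left, norm_neg, norm_mul, hu, mul_one, Complex.norm_real,
      Real.norm_of_nonneg hd]

/-- Here $\rho-c>d/4$ and $c>\rho/2$, so the Poisson factor is at most `3 * c / (d / 4)` and the
numerator at most $\frac32adc$. The denominator is $2\pi c\cdot d/4=\frac{\pi}{2}cd$, and $\pi>3$
suffices. -/
theorem sweep_density_bound {ρ d a n s c : ℝ} (ha : 0 ≤ a) (hd : 0 < d)
    (hdρ : d ≤ ρ) (hs : 0 ≤ s) (hns : n + s = a * d ^ 2 / 8)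
    (hc : c ∈ Set.Ioo (ρ - d / 2) (ρ - d / 4)) :
    (n * ((ρ + c) / (ρ - c)) + s) * (2 * Real.pi * c * ((ρ - d / 4) - (ρ - d / 2)))⁻¹ ≤ a := by
  obtain ⟨h1, h2⟩ := hc
  have hc0 : 0 < c := by linarith
  have hρc : 0 < ρ - c := by linarith
  have hpi := Real.pi_gt_three
  have hq : 1 ≤ (ρ + c) / (ρ - c) := by rw [le_div_iff₀ hρc]; linarith
  have e1 : n * ((ρ + c) / (ρ - c)) + s ≤ a * d ^ 2 / 8 * ((ρ + c) / (ρ - c)) := by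
    rw [← hns, add_mul]
    linarith [le_mul_of_one_le_right hs hq]
  have e2 : (ρ + c) / (ρ - c) ≤ 3 * c / (d / 4) := by
    rw [div_le_div_iff₀ hρc (by positivity)]
    nlinarith
  have e3 : a * d ^ 2 / 8 * ((ρ + c) / (ρ - c)) ≤ a * d ^ 2 / 8 * (3 * c / (d / 4)) := by gcongr
  have e4 : a * d ^ 2 / 8 * (3 * c / (d / 4)) = 3 / 2 * (a * d * c) := by field_simp; ring
  have h3 : 0 < 2 * Real.pi * c * ((ρ - d / 4) - (ρ - d / 2)) := by
    have : (ρ - d / 4) - (ρ - d / 2) = d / 4 := by ring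
    rw [this]; positivity
  rw [← div_eq_mul_inv, div_le_iff₀ h3]
  have h4 : 0 ≤ a * d * c := by positivity
  nlinarith [mul_le_mul_of_nonneg_left hpi.le h4]

theorem max_le_of_kappa_le {ρ α t d : ℝ} (hα : 0 < α) (ht : 0 < t) {ν : Measure ℂ} {dR : ℂ → ℝ}
    (h : kappa ρ α t ν dR ≤ d) :
    max (ν.real Set.univ) (2 * ρ * (⨆ z : Metric.sphere (0 : ℂ) ρ, |dR z|) + (t - 1)) ≤
      α * t * d ^ 2 / 16 := by
  rw [kappa, mul_comm, ← le_div_iff₀ (by norm_num), Real.sqrt_le_iff] at h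
  have := (div_le_iff₀ (mul_pos hα ht)).1 h.2
  linarith

end LogPotential

open LogPotential in
theorem proposition3p3
    (ρ α t : ℝ) (hρ : 0 < ρ) (hα : 0 < α) (ht : 0 < t)
    -- the potential `V`, with values in `(-∞, +∞]`
    (V : ℂ → EReal) (hV_bot : ∀ z, V z ≠ ⊥) (hV_lsc : LowerSemicontinuous V)
    (hV_growth : LogPotential.HasLogGrowth V)
    (hV_top : ∀ z ∈ Metric.ball (0 : ℂ) ρ, V z ≠ ⊤)
    (hV_reg : LogPotential.IsLocallyC11On (fun z => (V z).toReal) (Metric.ball (0 : ℂ) ρ))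
    (hV_lap : ∀ᵐ z ∂(volume.restrict (Metric.ball (0 : ℂ) ρ)),
      α ≤ 1 / (4 * Real.pi) * Laplacian.laplacian (fun z => (V z).toReal) z)
    -- the support of the equilibrium measure of `V` is the closed disk
    (μV : Measure ℂ) (hμV : LogPotential.IsEquilibriumMeasure V μV)
    (hSV : μV.support = Metric.closedBall (0 : ℂ) ρ)
    -- the charge `ν`; its logarithmic moment makes `U^ν` well defined
    (ν : Measure ℂ) [IsFiniteMeasure ν] (hν_supp : Disjoint ν.support (Metric.ball (0 : ℂ) ρ))
    (hν_log : Integrable (fun w : ℂ => Real.log (1 + ‖w‖)) ν)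
    -- the perturbation `R` and its normal derivative from inside
    (R : ℂ → ℝ) (hR_cont : ContinuousOn R (Metric.closedBall (0 : ℂ) ρ))
    (hR_harm : InnerProductSpace.HarmonicOnNhd R (Metric.ball (0 : ℂ) ρ))
    (dR : ℂ → ℝ)
    (hdR : ∀ z ∈ Metric.sphere (0 : ℂ) ρ, LogPotential.HasInnerNormalDeriv R z (dR z))
    (hdR_bdd : ∃ C : ℝ, ∀ z ∈ Metric.sphere (0 : ℂ) ρ, |dR z| ≤ C)
    -- the equilibrium measure of `W`
    (μW : Measure ℂ)
    (hμW : LogPotential.IsEquilibriumMeasure (LogPotential.perturbedPotential ρ t V ν R) μW) :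
    {z : ℂ | z ∈ Metric.ball (0 : ℂ) ρ ∧
      LogPotential.kappa ρ α t ν dR ≤ Metric.infDist z {w : ℂ | ρ < ‖w‖}} ⊆ μW.support := by
  rintro z₀ ⟨hz₀, hκ⟩
  have hpV := hμV.isProbabilityMeasure
  have hpW := hμW.isProbabilityMeasure
  have hz₀ρ : ‖z₀‖ < ρ := mem_ball_zero_iff.1 hz₀
  have hbD : Metric.ball (0 : ℂ) ρ ⊆ Metric.closedBall 0 ρ := Metric.ball_subset_closedBall
  set g : ℂ → ℝ := fun z => (V z).toReal with hg
  -- the data of the sweeping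
  have hκ' := max_le_of_kappa_le hα ht (hκ.trans (infDist_compl_closedBall_le hz₀ρ.le))
  set d := ρ - ‖z₀‖ with hd
  have hd0 : 0 < d := sub_pos.2 hz₀ρ
  have hdρ : d ≤ ρ := by linarith [norm_nonneg z₀]
  -- Twice the bound obtained from `kappa`, so that both inequalities below become strict.
  set m := α * t * d ^ 2 / 8 with hm
  have hm0 : 0 < m := by positivity
  set C₁ := ⨆ z : Metric.sphere (0 : ℂ) ρ, |dR z| with hC₁
  have hnm : ν.real Set.univ < m := by
    have := (le_max_left _ _).trans hκ'
    linarith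
  have hbm : 2 * ρ * C₁ + (t - 1) < m := by
    have := (le_max_right _ _).trans hκ'
    linarith
  have hν0 : ν (Metric.ball 0 ρ) = 0 :=
    measure_mono_null (Set.subset_compl_iff_disjoint_left.2 hν_supp) Measure.measure_compl_support
  obtain ⟨β, K₁, K₂, hβle, hβm, hβc, hK₁, hK₂, hβeq, hβineq⟩ := exists_sweep (ρ := ρ)
    (s := m - ν.real Set.univ) (c₁ := ρ - d / 2) (c₂ := ρ - d / 4) (a := α * t) (ν := ν)
    (by linarith) (by linarith) (by linarith) hν0 (by linarith) fun c hc =>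
      sweep_density_bound (by positivity) hd0 hdρ (by linarith) (by rw [hm]; ring) hc
  have hβreal : β.real Set.univ = m := by
    rw [measureReal_def, hβm, ENNReal.toReal_add (by finiteness) (by finiteness),
      ENNReal.toReal_ofReal (by linarith), ← measureReal_def]
    ring
  -- the extension of the harmonic perturbation
  have hdRC : ∀ z ∈ Metric.sphere (0 : ℂ) ρ, |dR z| ≤ C₁ := fun z hz => by
    obtain ⟨C, hC⟩ := hdR_bdd
    refine le_ciSup (f := fun z : Metric.sphere (0 : ℂ) ρ => |dR z|) ⟨C, ?_⟩ ⟨z, hz⟩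
    rintro _ ⟨x, rfl⟩
    exact hC x x.2
  have hC₁0 : 0 ≤ C₁ := Real.iSup_nonneg fun z => abs_nonneg _
  -- Half of the slack in the mass inequality is spent on making the kink strictly convex.
  set C' := C₁ + (m - (2 * ρ * C₁ + (t - 1))) / (4 * ρ) with hC'
  have hCC' : C₁ < C' := by
    have : 0 < (m - (2 * ρ * C₁ + (t - 1))) / (4 * ρ) := div_pos (by linarith) (by positivity)
    linarith
  have hC'm : 2 * C' * ρ + t < 1 + m := by
    have : 2 * C' * ρ = 2 * ρ * C₁ + (m - (2 * ρ * C₁ + (t - 1))) / 2 := by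
      rw [hC']
      field_simp
      ring
    linarith
  have hq := isKinkedSubharmonic_reflectExtend hρ hCC' (by linarith) hR_cont hR_harm hdR
    fun z hz => (le_abs_self _).trans (hdRC z hz)
  set q := reflectExtend ρ (2 * C' * ρ) R with hqdef
  have hqR : ∀ z ∈ Metric.closedBall (0 : ℂ) ρ, q z = R z := fun z hz =>
    reflectExtend_of_le (mem_closedBall_zero_iff.1 hz)
  have hqh : ∀ z r, 0 < r → Metric.closedBall z r ⊆ Metric.ball 0 ρ →
      Real.circleAverage q z r = q z := by
    intro z r hr hsub
    rw [hqR z (hbD (hsub (Metric.mem_closedBall_self hr.le))),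
      Real.circleAverage_congr_sphere (f₂ := R)]
    · exact InnerProductSpace.HarmonicOnNhd.circleAverage_eq (fun x hx => hR_harm x (hsub (by
        rwa [abs_of_pos hr] at hx)))
    · intro x hx
      rw [abs_of_pos hr] at hx
      exact hqR x (hbD (hsub (Metric.sphere_subset_closedBall hx)))
  -- the normalizing constants
  obtain ⟨N, hN0, hVN⟩ := exists_neg_le_of_lowerSemicontinuous hV_lsc hV_bot
    (isCompact_closedBall (0 : ℂ) ρ) (max 0 (-Real.log (2 * ρ)))
  have hN1 := (le_max_left _ _).trans hN0
  have hN2 := (le_max_right _ _).trans hN0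
  obtain ⟨B, hB⟩ := (isCompact_closedBall (0 : ℂ) ρ).exists_bound_of_continuousOn hR_cont
  -- The bound `B` makes `R + C` nonnegative, and the logarithm ensures `0 ≤ log (2 * ρ) + N'`, as
  -- needed for `energy_eq`.
  set C := max B (|Real.log (2 * ρ)|) with hC
  have hRC : ∀ z ∈ Metric.closedBall (0 : ℂ) ρ, 0 ≤ R z + C := fun z hz => by
    have := (abs_le.1 (hB z hz)).1
    have := le_max_left B (|Real.log (2 * ρ)|)
    linarith
  set W := perturbedPotential ρ t V ν R with hW
  set N' := 2 * (scaleMoment ρ ν).toReal + t * N + 2 * C with hN'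
  have hhalf := fun z (hz : z ∈ Metric.closedBall (0 : ℂ) ρ) =>
    half_perturbedPotential hρ ht hν_log hz (hVN z hz) (hRC z hz)
  have hWN : ∀ z ∈ Metric.closedBall (0 : ℂ) ρ, ((-N' : ℝ) : EReal) ≤ W z := fun z hz =>
    le_of_half_add_eq (hhalf z hz)
  have hvv' : ∀ z ∈ Metric.closedBall (0 : ℂ) ρ, halfPotential N' W z =
      ENNReal.ofReal t * halfPotential N V z + scaledPotential ρ ν z + ENNReal.ofReal (q z + C) :=
    fun z hz => by rw [halfPotential, hhalf z hz, EReal.toENNReal_coe, hqR z hz]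
  have hN'0 : 0 ≤ Real.log (2 * ρ) + N' := by
    have h1 := le_max_right B (|Real.log (2 * ρ)|)
    have h2 := neg_abs_le (Real.log (2 * ρ))
    have h3 := abs_nonneg (Real.log (2 * ρ))
    have h4 := mul_nonneg ht.le hN1
    have h5 : 0 ≤ (scaleMoment ρ ν).toReal := ENNReal.toReal_nonneg
    linarith
  -- the potentials are finite and continuous inside the disk
  have hgc : ∀ z ∈ Metric.ball (0 : ℂ) ρ, ContinuousAt g z := fun z hz =>
    hV_reg.1.continuousOn.continuousAt (Metric.isOpen_ball.mem_nhds hz)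
  have hvr := fun z (hz : z ∈ Metric.ball (0 : ℂ) ρ) =>
    halfPotential_eq_ofReal (hVN z (hbD hz)) (hV_top z hz)
  have hv : ∀ z ∈ Metric.ball (0 : ℂ) ρ,
      ContinuousAt (halfPotential N V) z ∧ halfPotential N V z ≠ ⊤ := fun z hz => by
    refine ⟨?_, by rw [(hvr z hz).1]; exact ENNReal.ofReal_ne_top⟩
    have h1 : ContinuousAt (fun z => ENNReal.ofReal (g z / 2 + N / 2)) z :=
      ENNReal.continuous_ofReal.continuousAt.comp (((hgc z hz).div_const 2).add_const _)
    refine h1.congr ?_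
    filter_upwards [Metric.isOpen_ball.mem_nhds hz] with x hx using (hvr x hx).1.symm
  have hv' : ∀ z ∈ Metric.ball (0 : ℂ) ρ,
      ContinuousAt (halfPotential N' W) z ∧ halfPotential N' W z ≠ ⊤ := fun z hz => by
    have hz' := mem_ball_zero_iff.1 hz
    have hfin := scaledPotential_ne_top hρ hν_log hν0 hz'
    have hvfin := (hv z hz).2
    constructor
    · have h1 : ContinuousAt (fun z => ENNReal.ofReal t * halfPotential N V z +
          scaledPotential ρ ν z + ENNReal.ofReal (q z + C)) z := by
        refine ContinuousAt.add (ContinuousAt.add ?_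
          (continuousAt_scaledPotential hρ hν_log hν0 hz')) ?_
        · exact ENNReal.Tendsto.const_mul (hv z hz).1 (Or.inr ENNReal.ofReal_ne_top)
        · exact (ENNReal.continuous_ofReal.comp (hq.continuous.add_const C)).continuousAt
      refine h1.congr ?_
      filter_upwards [Metric.isOpen_ball.mem_nhds hz] with x hx using (hvv' x (hbD hx)).symm
    · rw [hvv' z (hbD hz)]
      finiteness
  -- the equilibrium conditions
  have hclos : Metric.closedBall (0 : ℂ) ρ = closure (Metric.ball 0 ρ) := (closure_ball 0 hρ.ne').symm
  have hsub0 : Metric.closedBall (0 : ℂ) (ρ / 2) ⊆ Metric.ball 0 ρ :=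
    Metric.closedBall_subset_ball (by linarith)
  have hsph0 : Metric.sphere (0 : ℂ) (ρ / 2) ⊆ Metric.ball 0 ρ :=
    Metric.sphere_subset_closedBall.trans hsub0
  have hμVD : μV (Metric.closedBall 0 ρ)ᶜ = 0 := hSV ▸ Measure.measure_compl_support
  have hμWD : μW (Metric.closedBall 0 ρ)ᶜ = 0 := measure_mono_null
    (Set.compl_subset_compl.2 (domainClosure_perturbedPotential_subset ρ t V ν R)) hμW.carried
  have h0D : circleMeasure 0 (ρ / 2) (Metric.closedBall 0 ρ)ᶜ = 0 := measure_mono_null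
    (Set.compl_subset_compl.2 (hsph0.trans hbD)) (circleMeasure_compl_sphere 0 (by positivity))
  have h0e := lintegral_truncPotential_circleMeasure_ne_top (half_pos hρ) hρ (hsub0.trans hbD)
  obtain ⟨F, hF⟩ := hμV.exists_isVariational hρ (by linarith) hV_lsc.measurable hVN hμVD
    (hclos ▸ closure_mono fun z hz => lt_top_iff_ne_top.2 (hV_top z hz)) h0D h0e
    (lintegral_circleMeasure_ne_top (by positivity) fun x hx => hv x (hsph0 hx))
  obtain ⟨F', hF'⟩ := hμW.exists_isVariational hρ hN'0
    (measurable_perturbedPotential hρ hV_lsc.measurable hν_log hR_cont) hWN hμWD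
    (hclos ▸ closure_mono fun z hz => by
      change W z < ⊤
      refine lt_top_iff_ne_top.2 fun htop : W z = ⊤ => (hv' z hz).2 ?_
      rw [halfPotential, htop, EReal.coe_mul_top_of_pos one_half_pos, EReal.top_add_coe,
        EReal.toENNReal_top]) h0D h0e
    (lintegral_circleMeasure_ne_top (by positivity) fun x hx => hv' x (hsph0 hx))
  -- the density of the equilibrium measure
  have hvlsc := lowerSemicontinuous_halfPotential N hV_lsc
  have hdens : ENNReal.ofReal α • volume.restrict (Metric.ball 0 ρ) ≤ μV := by
    refine smul_volume_restrict_ball_le (F := F.toReal - N / 2) hα hμVD hV_reg.1 hV_lap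
      fun x hx => ?_
    obtain ⟨h1, h2⟩ := hvr x hx
    -- Every point of the open disk lies in the support and is a continuity point of `V`, so both
    -- pointwise equilibrium inequalities hold.
    have h3 : truncPotential (2 * ρ) μV x + halfPotential N V x = F :=
      le_antisymm (hF.le_of_mem_support hvlsc (hSV ▸ hbD hx))
        (hF.le_of_continuousAt hρ hμVD hx (hv x hx).1 (hv x hx).2)
    have h4 : truncPotential (2 * ρ) μV x ≠ ⊤ := ne_top_of_le_ne_top hF.ne_top (h3 ▸ le_self_add)
    refine ⟨h4, ?_⟩
    rw [← h3, ENNReal.toReal_add h4 (hv x hx).2, h1, ENNReal.toReal_ofReal h2]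
    ring
  have hβV : β ≤ ENNReal.ofReal t • μV := by
    refine hβle.trans ?_
    rw [mul_comm α t, ENNReal.ofReal_mul ht.le, mul_smul]
    exact Measure.le_iff.2 fun s hs => mul_le_mul_right (Measure.le_iff.1 hdens s hs) _
  have hβfin : IsFiniteMeasure β :=
    have := Measure.smul_finite μV (c := ENNReal.ofReal t) ENNReal.ofReal_ne_top
    isFiniteMeasure_of_le _ hβV
  exact mem_support_of_sweep hρ ht (by linarith) hF hF' hSV hμWD hvlsc hv' hq hqh
    (fun z hz => hqR z hz ▸ hRC z hz) hvv' hβV hβc hK₁ hK₂ hβeq hβineq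
    (by rw [hβreal]; exact hC'm) (by rw [hd]; linarith)
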